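/- **Setting.** Let $K,c_v,\mu,\kappa>0$ with $\mu/(\kappa\theta_e)<1$, $\theta_e=1/c_v$, and let $\bar U=(v,u,E)$ be a constant state. Put $e=E-\tfrac12u^2$, $\theta=e/c_v$, $p=\frac{Ke}{c_vv}$, $p_v=-\frac{Ke}{c_vv^2}$, $p_e=\frac{K}{c_vv}$, all evaluated at $\bar U$, and $$F'=\begin{pmatrix}0&-1&0\\p_v&-p_eu&p_e\\p_vu&p-p_eu^2&p_eu\end{pmatrix},\qquad B=\begin{pmatrix}0&0&0\\0&\frac{\mu}{v}&0\\0&\left(\frac{\mu}{v}-\frac{\kappa\theta_e}{v}\right)u&\frac{\kappa\theta_e}{v}\end{pmatrix}.$$ Let $\mathbb G(x,t)$ be the Green's function of the linearized one-dimensional compressible Navier–Stokes system in Lagrangian coordinates, $\partial_t\mathbb G=(-F'\partial_x+B\partial_{xx})\mathbb G$, $\mathbb G(x,0)=\delta(x)I$. That is, its Fourier transform $\hat{\mathbb G}(\eta,t)$ (with $\hat f(\eta)=\int f(x)e^{-i\eta x}dx$) solves $\partial_t\hat{\mathbb G}=(-i\eta F'-\eta^2B)\hat{\mathbb G}$, $\hat{\mathbb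 G}(\eta,0)=I$. *Singular part.* Let $$\lambda_j^*(\eta)=-\alpha_j^*\eta^2+\beta_j^*+\sum_{m=1}^3\frac{A_{j,m}}{(1+\eta^2)^m}-\frac{K_j}{(1+\eta^2)^4},\quad j=1,2,3,\qquad \alpha_1^*=0,\ \alpha_2^*=\tfrac{\mu}{v},\ \alpha_3^*=\tfrac{\kappa\theta_e}{v},$$ where the real numbers $\beta_j^*,A_{j,m}$ are those for which $\lambda_j^*$ agrees, up to $O(|\eta|^{-8})$ as $|\eta|\to\infty$, with an eigenvalue of $-i\eta F'-\eta^2B$, and where $K_1,K_2,K_3>0$ are large enough constants in the following sense (call them admissible): there are $\sigma\in(0,1)$, $\sigma^*,\sigma_1>0$ such that for all complex $\eta$ with $|\mathrm{Im}\,\eta|<\sigma$ one has $\mathrm{Re}\left(\lambda_j^*+\tfrac{\alpha_j^*}{2}(\eta^2+1)\right)<-\sigma^*$ for every $j$, and $|\mathrm{Re}(\lambda_i^*-\lambda_j^*)|\ge\sigma_1$ for $i\ne j$. The singular part $\mathbb G^*$ is defined by $$\hat{\mathbb G}^*(\eta,t)=\sum_{j=1}^3e^{\lambda_j^*t}\,\frac{\mathrm{adj}\left(\lambda_j^*I+i\eta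 F'+\eta^2B\right)}{\prod_{k\ne j}(\lambda_j^*-\lambda_k^*)},$$ and the regular part is $\mathbb G^\dagger=\mathbb G-\mathbb G^*$, i.e. $\mathbb G^\dagger(x,t)=\frac1{2\pi}\int_{\mathbb R}e^{i\eta x}(\hat{\mathbb G}-\hat{\mathbb G}^*)(\eta,t)\,d\eta$. *Profile.* Let $$\alpha_1=\frac{-\kappa\theta_ep_v}{v(pp_e-p_v)},\quad\alpha_2=\alpha_3=\frac{\kappa p\theta_ep_e+\mu pp_e-\mu p_v}{2v(pp_e-p_v)},\quad\beta_1=0,\quad\beta_2=-\sqrt{pp_e-p_v},\quad\beta_3=\sqrt{pp_e-p_v},$$ and $g_j(x,t)=\frac{1}{2\sqrt{\pi\alpha_jt}}e^{-\frac{(x+\beta_jt)^2}{4\alpha_jt}}$. Let $M_j^0,M_j^1$ be the real matrices in the expansion $\hat{\mathbb M}_j=M_j^0+i\eta M_j^1+O(\eta^2)$, $\eta\to0$, of the spectral projection $\hat{\mathbb M}_j$ of $-i\eta F'-\eta^2B$ for the eigenvalue $\lambda_j=i\beta_j\eta-\alpha_j\eta^2+O(\eta^3)$. **Theorem 4.3.**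 There is $\varepsilon>0$ such that the following holds for every $\bar U=(v,u,E)$ with $\|(v,u,E)-(1,0,1)\|<\varepsilon$ (or with $\|(v,u,\theta)-(1,0,1)\|<\varepsilon$). Admissible $K_1,K_2,K_3$ exist. For every admissible choice, $\hat{\mathbb G}-\hat{\mathbb G}^*$ is integrable in $\eta$ and $\mathbb G^\dagger$ is $C^3$ in $x$ for each $t>0$, and there are constants $C,\sigma_0,\sigma_0^*,O_1>0$ (independent of $x$, $t$) such that, for all $x\in\mathbb R$, $$\sum_{k=0}^3|\partial_x^k\mathbb G^\dagger(x,t)|\le O_1\,t\,e^{-\sigma_0|x|},\qquad 0<t<1,$$ where $|A|=\sqrt{\mathrm{tr}(A^*A)}$, and for $t\ge1$, $0\le k\le3$, entry by entry (with $|\cdot|$ the entrywise absolute value of a matrix, and scalars on the right added to every entry), $$\left|\partial_x^k\mathbb G^\dagger-\sum_{j=1}^3\partial_x^kg_j\,M_j^0-\sum_{j=1}^3\partial_x^{k+1}g_j\,M_j^1\right|\le\sum_{j=1}^3\frac{O_1e^{-\frac{(x+\beta_jt)^2}{4Ct}}}{t^{\frac{k+2}2}}|M_j^0|+\sum_{j=1}^3\frac{O_1e^{-\frac{(x+\beta_jt)^2}{4Ct}}}{t^{\frac{k+3}2}}+O_1e^{-\sigma_0^*t-\sigma_0|x|}.$$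 -/

import Mathlib

noncomputable section

namespace NSGreen

/-- A polytropic ideal gas (`p = K θ / v`, `e = cv θ`), with viscosity `mu` and heat conductivity
`kappa`, together with a constant state `(v, u, E)`: specific volume, velocity, total energy. -/
structure GasState where
  K : ℝ
  cv : ℝ
  mu : ℝ
  kappa : ℝ
  v : ℝ
  u : ℝ
  E : ℝ

namespace GasState

variable (s : GasState)

/-- specific internal energy, from `E = e + u ^ 2 / 2` -/
def e : ℝ := s.E - s.u ^ 2 / 2

/-- absolute temperature, from `e = cv θ` -/
def theta : ℝ := s.e / s.cv

/-- the pressure `p(v, e) = K e / (cv v)` -/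
def p : ℝ := s.K * s.e / (s.cv * s.v)

/-- the partial derivative of `p(v, e)` in `v` -/
def pv : ℝ := -(s.K * s.e / (s.cv * s.v ^ 2))

/-- the partial derivative of `p(v, e)` in `e` -/
def pe : ℝ := s.K / (s.cv * s.v)

/-- the derivative of the temperature in `e` -/
def thetae : ℝ := 1 / s.cv

/-- the product `κ θ_e` -/
def k : ℝ := s.kappa * s.thetae

/-- the sound speed `√(p p_e - p_v)` -/
def c : ℝ := Real.sqrt (s.p * s.pe - s.pv)

/-- The Jacobian `F'(U)` of the flux `F(U) = (-u, p, p u)` in the variables `U = (v, u, E)`. -/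
def fluxJac : Matrix (Fin 3) (Fin 3) ℝ :=
  !![0, -1, 0;
     s.pv, -(s.pe * s.u), s.pe;
     s.pv * s.u, s.p - s.pe * s.u ^ 2, s.pe * s.u]

/-- The viscosity matrix `B(U)`. -/
def visc : Matrix (Fin 3) (Fin 3) ℝ :=
  !![0, 0, 0;
     0, s.mu / s.v, 0;
     0, (s.mu / s.v - s.k / s.v) * s.u, s.k / s.v]

/-! ### The Green's function -/

/-- The symbol `-iη F'(U) - η² B(U)` of the linearized operator `-F'(U) ∂ₓ + B(U) ∂ₓₓ`. -/
def symbol (η : ℂ) : Matrix (Fin 3) (Fin 3) ℂ :=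
  -((Complex.I * η) • s.fluxJac.map Complex.ofReal) - (η ^ 2) • s.visc.map Complex.ofReal

/-- The spatial Fourier transform (convention `f̂ η = ∫ f x e^{-iηx} dx`) of the Green's function
`𝔾` of the linearized system, i.e. of the solution of
`∂ₜ 𝔾 = (-F'(U) ∂ₓ + B(U) ∂ₓₓ) 𝔾`, `𝔾(x, 0) = δ(x) I`:
the solution of `∂ₜ Ĝ = (-iη F'(U) - η² B(U)) Ĝ`, `Ĝ(η, 0) = I`. -/
def greenHat (η t : ℝ) : Matrix (Fin 3) (Fin 3) ℂ :=
  NormedSpace.exp (t • s.symbol (η : ℂ))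

theorem greenHat_zero (η : ℝ) : s.greenHat η 0 = 1 := by
  simp [greenHat]

theorem hasDerivAt_greenHat (η t : ℝ) (a b : Fin 3) :
    HasDerivAt (fun τ => s.greenHat η τ a b) ((s.symbol (η : ℂ) * s.greenHat η t) a b) t := by
  let _ : NormedRing (Matrix (Fin 3) (Fin 3) ℂ) := Matrix.linftyOpNormedRing
  let _ : NormedAlgebra ℝ (Matrix (Fin 3) (Fin 3) ℂ) := Matrix.linftyOpNormedAlgebra
  have h := hasDerivAt_exp_smul_const' (𝕂 := ℝ) (s.symbol (η : ℂ)) t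
  have h1 := (Matrix.entryLinearMap ℝ ℂ a b).toContinuousLinearMap.hasFDerivAt.comp_hasDerivAt t h
  exact h1

theorem greenHat_unique (η : ℝ) (Y : ℝ → Matrix (Fin 3) (Fin 3) ℂ) (h0 : Y 0 = 1)
    (hY : ∀ t a b, HasDerivAt (fun τ => Y τ a b) ((s.symbol (η : ℂ) * Y t) a b) t) (t : ℝ) :
    Y t = s.greenHat η t := by
  let _ : NormedRing (Matrix (Fin 3) (Fin 3) ℂ) := Matrix.linftyOpNormedRing
  let _ : NormedAlgebra ℝ (Matrix (Fin 3) (Fin 3) ℂ) := Matrix.linftyOpNormedAlgebra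
  have key : ∀ Z : ℝ → Matrix (Fin 3) (Fin 3) ℂ,
      (∀ t a b, HasDerivAt (fun τ => Z τ a b) ((s.symbol (η : ℂ) * Z t) a b) t) →
      ∀ t, HasDerivAt Z (s.symbol (η : ℂ) * Z t) t := by
    intro Z hZ t
    have h1 : HasDerivAt Z (∑ a, ∑ b, Matrix.single a b ((s.symbol (η : ℂ) * Z t) a b)) t := by
      have h2 : Z = fun τ => ∑ a, ∑ b, Matrix.single a b (Z τ a b) := by
        funext τ
        exact Matrix.matrix_eq_sum_single (Z τ)
      rw [h2]
      refine HasDerivAt.fun_sum fun a _ => HasDerivAt.fun_sum fun b _ => ?_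
      rw [← h2]
      exact (Matrix.singleLinearMap ℝ a b).toContinuousLinearMap.hasFDerivAt.comp_hasDerivAt t
        (hZ t a b)
    rwa [← Matrix.matrix_eq_sum_single] at h1
  have h := ODE_solution_unique_univ (v := fun _ M => s.symbol (η : ℂ) * M) (s := fun _ => Set.univ)
    (K := ‖s.symbol (η : ℂ)‖₊) (f := Y) (g := s.greenHat η) (t₀ := 0)
    (fun _ => ((LipschitzWith.of_dist_le_mul fun M N => by
      simp only [dist_eq_norm, ← mul_sub]
      exact norm_mul_le _ _).lipschitzOnWith))
    (fun t => ⟨key Y hY t, trivial⟩)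
    (fun t => ⟨key _ (s.hasDerivAt_greenHat η) t, trivial⟩)
    (by rw [h0, s.greenHat_zero])
  rw [h]

/-! ### The singular part -/

/-- `α*_j`, `j = 1, 2, 3` (index shifted by one) -/
def alphaStar : Fin 3 → ℝ := ![0, s.mu / s.v, s.k / s.v]

/-- `β*_j` -/
def betaStar : Fin 3 → ℝ :=
  ![s.v * s.pv / s.mu,
    s.v * (s.mu * s.p * s.pe + s.k * s.pv - s.mu * s.pv) / (s.mu * (s.mu - s.k)),
    s.p * s.v * s.pe / (s.k - s.mu)]

def A11 : ℝ := -(s.v ^ 3 * (s.k * s.pv ^ 2 + s.mu * s.p * s.pe * s.pv) / (s.k * s.mu ^ 3))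

def A12 : ℝ :=
  s.v ^ 3 * (s.mu ^ 2 * s.p ^ 2 * s.v ^ 2 * s.pe ^ 2 * s.pv + 2 * s.k ^ 2 * s.v ^ 2 * s.pv ^ 3
    + 3 * s.k * s.mu * s.p * s.v ^ 2 * s.pe * s.pv ^ 2 + s.mu ^ 2 * s.p * s.v ^ 2 * s.pe * s.pv ^ 2
    - s.k ^ 2 * s.mu ^ 2 * s.pv ^ 2 - s.k * s.mu ^ 3 * s.p * s.pe * s.pv) / (s.k ^ 2 * s.mu ^ 5)

def A13 : ℝ :=
  -(s.v ^ 3 * s.pv * (s.mu ^ 3 * s.p ^ 3 * s.v ^ 4 * s.pe ^ 3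
    + s.mu ^ 2 * s.p ^ 2 * s.v ^ 2 * s.pe ^ 2
      * (3 * s.v ^ 2 * s.pv * (2 * s.k + s.mu) - 2 * s.k * s.mu ^ 2)
    + s.k ^ 3 * s.pv * (s.mu ^ 4 + 5 * s.v ^ 4 * s.pv ^ 2 - 4 * s.mu ^ 2 * s.v ^ 2 * s.pv)
    + s.mu * s.p * s.pe * (s.k ^ 2 * s.mu ^ 4
      + s.v ^ 4 * s.pv ^ 2 * (10 * s.k ^ 2 + 4 * s.k * s.mu + s.mu ^ 2)
      - 2 * s.k * s.mu ^ 2 * s.v ^ 2 * s.pv * (3 * s.k + s.mu))) / (s.k ^ 3 * s.mu ^ 7))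

def A21 : ℝ :=
  s.v ^ 3 * (s.mu ^ 3 * s.p ^ 2 * s.pe ^ 2
    - s.mu * s.p * s.pe * s.pv * (s.k ^ 2 - 3 * s.k * s.mu + 2 * s.mu ^ 2)
    + s.pv ^ 2 * (s.mu - s.k) ^ 3) / (s.mu ^ 3 * (s.mu - s.k) ^ 3)

def A22 : ℝ :=
  s.v ^ 3 * (s.mu * s.p * s.pe + s.pv * (s.k - s.mu))
    * (2 * s.mu ^ 4 * s.p ^ 2 * s.v ^ 2 * s.pe ^ 2
      + s.mu * s.p * s.pe * (s.mu - s.k)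
        * (s.mu ^ 3 * (s.mu - s.k) - s.v ^ 2 * s.pv * (s.k - 2 * s.mu) ^ 2)
      + s.pv * (2 * s.v ^ 2 * s.pv - s.mu ^ 2) * (s.mu - s.k) ^ 4) / (s.mu ^ 5 * (s.mu - s.k) ^ 5)

def A23 : ℝ :=
  s.v ^ 3 * (5 * s.mu ^ 7 * s.p ^ 4 * s.v ^ 4 * s.pe ^ 4
    + s.mu ^ 3 * s.p ^ 3 * s.v ^ 2 * s.pe ^ 3 * (s.mu - s.k) * (4 * s.mu ^ 4 * (s.mu - s.k)
      + s.v ^ 2 * s.pv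
        * (s.k ^ 3 - 6 * s.k ^ 2 * s.mu + 15 * s.k * s.mu ^ 2 - 20 * s.mu ^ 3))
    + s.mu ^ 2 * s.p ^ 2 * s.pe ^ 2 * (s.mu - s.k) ^ 2 * (s.mu ^ 5 * (s.mu - s.k) ^ 2
      + 3 * s.v ^ 4 * s.pv ^ 2
        * (-2 * s.k ^ 3 + 9 * s.k ^ 2 * s.mu - 15 * s.k * s.mu ^ 2 + 10 * s.mu ^ 3)
      - 2 * s.mu ^ 2 * s.v ^ 2 * s.pv
        * (-s.k ^ 3 + 5 * s.k ^ 2 * s.mu - 10 * s.k * s.mu ^ 2 + 6 * s.mu ^ 3))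
    - s.mu * s.p * s.pe * s.pv * (s.mu - s.k) ^ 3
      * (s.mu ^ 4 * (s.mu - s.k) ^ 2 * (2 * s.mu - s.k)
      + s.v ^ 4 * s.pv ^ 2
        * (-10 * s.k ^ 3 + 36 * s.k ^ 2 * s.mu - 45 * s.k * s.mu ^ 2 + 20 * s.mu ^ 3)
      + 2 * s.mu ^ 2 * s.v ^ 2 * s.pv
        * (3 * s.k ^ 3 - 11 * s.k ^ 2 * s.mu + 14 * s.k * s.mu ^ 2 - 6 * s.mu ^ 3))
    + s.pv ^ 2 * (s.mu ^ 4 + 5 * s.v ^ 4 * s.pv ^ 2 - 4 * s.mu ^ 2 * s.v ^ 2 * s.pv)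
      * (s.mu - s.k) ^ 7) / (s.mu ^ 7 * (s.mu - s.k) ^ 7)

def A31 : ℝ :=
  s.p * s.v ^ 3 * s.pe * (s.k * s.p * s.pe + s.pv * (s.k - s.mu)) / (s.k * (s.k - s.mu) ^ 3)

def A32 : ℝ :=
  s.p * s.v ^ 3 * s.pe * (2 * s.k ^ 2 * s.p ^ 2 * s.v ^ 2 * s.pe ^ 2
    + s.p * s.pe * (s.mu - s.k)
      * (s.k ^ 2 * (s.mu - s.k) + s.v ^ 2 * s.pv * (s.mu - 4 * s.k))
    + s.pv * (s.mu - s.k) ^ 2 * (s.k * (s.k - s.mu) + s.v ^ 2 * s.pv))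
    / (s.k ^ 2 * (s.k - s.mu) ^ 5)

def A33 : ℝ :=
  s.p * s.v ^ 3 * s.pe * (5 * s.k ^ 3 * s.p ^ 3 * s.v ^ 4 * s.pe ^ 3
    - s.p ^ 2 * s.v ^ 2 * s.pe ^ 2 * (s.mu - s.k) * (4 * s.k ^ 3 * (s.k - s.mu)
      + s.v ^ 2 * s.pv * (15 * s.k ^ 2 - 6 * s.k * s.mu + s.mu ^ 2))
    + s.p * s.pe * (s.mu - s.k) ^ 2 * (s.k ^ 3 * (s.mu - s.k) ^ 2
      - 3 * s.v ^ 4 * s.pv ^ 2 * (s.mu - 3 * s.k)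
      + 2 * s.k * s.v ^ 2 * s.pv * (4 * s.k ^ 2 - 5 * s.k * s.mu + s.mu ^ 2))
    - s.pv * (s.mu - s.k) ^ 3 * (s.k * (s.k - s.mu) + s.v ^ 2 * s.pv) ^ 2)
    / (s.k ^ 3 * (s.k - s.mu) ^ 7)

/-- The coefficients `A_{j,m}`, `j, m = 1, 2, 3` (both indices shifted by one), of the expansion
at infinity of the eigenvalues of the symbol. -/
def A : Fin 3 → Fin 3 → ℝ :=
  ![![s.A11, s.A12, s.A13], ![s.A21, s.A22, s.A23], ![s.A31, s.A32, s.A33]]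

/-- The approximate eigenvalues
`λ*_j = -α*_j η² + β*_j + ∑_{m=1}^3 A_{j,m} / (1 + η²)^m - K_j / (1 + η²)^4`. -/
def lamStar (Kc : Fin 3 → ℝ) (j : Fin 3) (η : ℂ) : ℂ :=
  -(s.alphaStar j : ℂ) * η ^ 2 + (s.betaStar j : ℂ)
    + ∑ m : Fin 3, (s.A j m : ℂ) / (1 + η ^ 2) ^ ((m : ℕ) + 1)
    - (Kc j : ℂ) / (1 + η ^ 2) ^ 4

/-- The positive constants `K_1, K_2, K_3` are large enough: on a strip around the real axis
(on which `1 + η²` has no zero) the `λ*_j` have uniformly negative real parts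
`Re λ*_1`, `Re (λ*_2 + μ (η² + 1) / (2 v))`, `Re (λ*_3 + κ θ_e (η² + 1) / (2 v)) < -σ*`,
and the real parts of the `λ*_j` are uniformly separated. -/
def Admissible (Kc : Fin 3 → ℝ) : Prop :=
  (∀ j, 0 < Kc j) ∧
  ∃ σ σs σ1 : ℝ, 0 < σ ∧ σ < 1 ∧ 0 < σs ∧ 0 < σ1 ∧
    ∀ η : ℂ, |η.im| < σ →
      (∀ j, (s.lamStar Kc j η + (s.alphaStar j : ℂ) / 2 * (η ^ 2 + 1)).re < -σs) ∧
      (∀ i j, i ≠ j → σ1 ≤ |(s.lamStar Kc i η - s.lamStar Kc j η).re|)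

/-- `M̂*_j = adj(λ I + iη F'(U) + η² B(U))|_{λ = λ*_j} / ∏_{k ≠ j} (λ*_j - λ*_k)` -/
def MhatStar (Kc : Fin 3 → ℝ) (j : Fin 3) (η : ℂ) : Matrix (Fin 3) (Fin 3) ℂ :=
  (∏ k ∈ Finset.univ.erase j, (s.lamStar Kc j η - s.lamStar Kc k η))⁻¹ •
    (s.lamStar Kc j η • (1 : Matrix (Fin 3) (Fin 3) ℂ) - s.symbol η).adjugate

/-- The Fourier transform `∑_j e^{λ*_j t} M̂*_j` of the singular part `𝔾*`. -/
def singHat (Kc : Fin 3 → ℝ) (η t : ℝ) : Matrix (Fin 3) (Fin 3) ℂ :=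
  ∑ j, Complex.exp (s.lamStar Kc j η * t) • s.MhatStar Kc j η

/-! ### The regular part -/

/-- The Fourier transform of the regular part `𝔾† = 𝔾 - 𝔾*`. -/
def regHat (Kc : Fin 3 → ℝ) (η t : ℝ) : Matrix (Fin 3) (Fin 3) ℂ :=
  s.greenHat η t - s.singHat Kc η t

/-- The regular part `𝔾†(x, t) = (2π)⁻¹ ∫ e^{iηx} (Ĝ - Ĝ*)(η, t) dη`, entrywise. -/
def reg (Kc : Fin 3 → ℝ) (x t : ℝ) : Matrix (Fin 3) (Fin 3) ℂ :=
  Matrix.of fun a b =>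
    (2 * (Real.pi : ℂ))⁻¹ * ∫ η : ℝ, Complex.exp (Complex.I * η * x) * s.regHat Kc η t a b

/-- `∂ₓ^n 𝔾†(x, t)`, entrywise. -/
def dxReg (Kc : Fin 3 → ℝ) (n : ℕ) (x t : ℝ) : Matrix (Fin 3) (Fin 3) ℂ :=
  Matrix.of fun a b => iteratedDeriv n (fun y => s.reg Kc y t a b) x

/-! ### The large time profile -/

/-- The diffusivities `α_j`. -/
def alpha : Fin 3 → ℝ :=
  ![-(s.k * s.pv) / (s.v * (s.p * s.pe - s.pv)),
    (s.k * s.p * s.pe + s.mu * s.p * s.pe - s.mu * s.pv) / (2 * s.v * (s.p * s.pe - s.pv)),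
    (s.k * s.p * s.pe + s.mu * s.p * s.pe - s.mu * s.pv) / (2 * s.v * (s.p * s.pe - s.pv))]

/-- The speeds `β_j`. -/
def beta : Fin 3 → ℝ := ![0, -s.c, s.c]

/-- The Gaussian `e^{-(x + β_j t)² / (4 α_j t)} / (2 √(π α_j t))`. -/
def gauss (j : Fin 3) (t x : ℝ) : ℝ :=
  Real.exp (-(x + s.beta j * t) ^ 2 / (4 * s.alpha j * t))
    / (2 * Real.sqrt (Real.pi * s.alpha j * t))

/-- `M_1^0` -/
def entropyM0 : Matrix (Fin 3) (Fin 3) ℝ :=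
  (s.p * s.pe - s.pv)⁻¹ •
    !![s.p * s.pe, -(s.u * s.pe), s.pe;
       0, 0, 0;
       -(s.p * s.pv), s.u * s.pv, -s.pv]

/-- `M_2^0` for `c = √(p p_e - p_v)`, and `M_3^0` for `c = -√(p p_e - p_v)`. -/
def acousticM0 (c : ℝ) : Matrix (Fin 3) (Fin 3) ℝ :=
  !![-s.pv / (2 * c ^ 2), (s.u * s.pe - c) / (2 * c ^ 2), -s.pe / (2 * c ^ 2);
     s.pv / (2 * c), 1 / 2 - s.u * s.pe / (2 * c), s.pe / (2 * c);
     (s.p + s.u * c) * s.pv / (2 * c ^ 2),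
       (-(s.pe * c * s.u ^ 2) - s.pv * s.u + s.p * c) / (2 * c ^ 2),
       s.pe * (s.p + s.u * c) / (2 * c ^ 2)]

/-- `M_1^1` -/
def entropyM1 : Matrix (Fin 3) (Fin 3) ℝ :=
  (s.k / (s.v * (s.p * s.pe - s.pv) ^ 2)) •
    !![0, s.p * s.pe, 0;
       -(s.p * s.pe * s.pv), s.u * s.pe * s.pv, -(s.pe * s.pv);
       -(s.p * s.u * s.pe * s.pv), -((s.p - s.u ^ 2 * s.pe) * s.pv), -(s.u * s.pe * s.pv)]

/-- `M_2^1` for `c = √(p p_e - p_v)`, and `M_3^1` for `c = -√(p p_e - p_v)`. -/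
def acousticM1 (c : ℝ) : Matrix (Fin 3) (Fin 3) ℝ :=
  !![s.pv * (s.mu * s.pv - s.p * s.pe * (s.mu + 3 * s.k)) / (4 * s.v * c ^ 5),
     s.pe * (-2 * s.p * s.k * c - s.u * s.pv * (s.mu - 2 * s.k)
       + s.p * s.u * s.pe * (s.mu + s.k)) / (4 * s.v * c ^ 5),
     -(s.pe * (s.p * s.pe * (s.mu + s.k) - s.pv * (s.mu - 2 * s.k))) / (4 * s.v * c ^ 5);
     s.p * s.k * s.pe * s.pv / (2 * s.v * c ^ 4),
     -(s.pe * (s.p * c * s.mu + (2 * s.u * s.pv - s.p * c) * s.k) - s.mu * c * s.pv)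
       / (4 * s.v * c ^ 4),
     s.k * s.pe * s.pv / (2 * s.v * c ^ 4);
     s.p * s.pv * (s.pe * (s.p * s.mu + (s.p + 2 * s.u * c) * s.k) - s.pv * (s.mu - 2 * s.k))
       / (4 * s.v * c ^ 5),
     -(2 * s.p ^ 2 * s.u * (s.mu - s.k) * s.pe ^ 2
       + s.u * s.pv * ((5 * s.p + 2 * s.u * c) * s.k - 3 * s.p * s.mu) * s.pe
       + s.pv * (s.u * s.mu * s.pv - 2 * s.p * s.k * c)) / (4 * s.v * c ^ 5),
     s.pe * (s.pe * (s.mu - s.k) * s.p ^ 2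
       + s.pv * (2 * (2 * s.p + s.u * c) * s.k - s.p * s.mu)) / (4 * s.v * c ^ 5)]

/-- The matrices `M_j^0`. -/
def M0 : Fin 3 → Matrix (Fin 3) (Fin 3) ℝ :=
  ![s.entropyM0, s.acousticM0 s.c, s.acousticM0 (-s.c)]

/-- The matrices `M_j^1`. -/
def M1 : Fin 3 → Matrix (Fin 3) (Fin 3) ℝ :=
  ![s.entropyM1, s.acousticM1 s.c, s.acousticM1 (-s.c)]

/-- `∑_j ∂ₓ^n [gauss_j] M_j^0 + ∑_j ∂ₓ^{n+1} [gauss_j] M_j^1`. -/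
def profile (n : ℕ) (x t : ℝ) : Matrix (Fin 3) (Fin 3) ℝ :=
  ∑ j, iteratedDeriv n (s.gauss j t) x • s.M0 j
    + ∑ j, iteratedDeriv (n + 1) (s.gauss j t) x • s.M1 j

end GasState

/-- The trace norm `√(tr(A* A))` of a matrix. -/
def matNorm (A : Matrix (Fin 3) (Fin 3) ℂ) : ℝ := Real.sqrt (∑ a, ∑ b, ‖A a b‖ ^ 2)

end NSGreen

end

/-!
For real `η` the eigenvalues of the symbol `-iη F' - η² B` satisfy `Re λ ≤ -c η² / (1 + η²)`, so
that the Green's function decays exponentially in time at frequencies away from `0`, and only the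
behaviour as `η → 0` and as `|η| → ∞` matters.

*Dissipation.* In the variables `√(-p_v) v`, `u`, `√(p_e / p) e` the system becomes symmetric with a
positive semidefinite viscosity that misses the first variable. Adding to the energy a small
multiple of the product of the first two variables transfers the damping to the first one, and gives
`|Ĝ(η, t)| ≤ C e^{-c η² t / (1 + η²)}` on the real line (`exists_greenC_decay`). In a strip around
the real line the energy grows at most exponentially (`exists_greenC_bound`). Neither bound needs
information on the eigenvalues.

*High frequencies.* With the given coefficients, the characteristic polynomial at `λ*_j` is
`O(η⁻²)`. Hence the matrix `Ĝ*`, a spectral sum with the `λ*_j` in place of the eigenvalues, solves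
the equation of `Ĝ` up to a remainder which is the sum over `j` of that polynomial times
`e^{λ*_j t} / ∏_{k ≠ j} (λ*_j - λ*_k)`. It is of size `O(η⁻⁶)`, as the differences of the `λ*_j`
grow like `η²`. At `t = 0` the two agree exactly, by Lagrange interpolation. Duhamel's principle
then yields `|Ĝ - Ĝ*| ≤ C t e^{K t} / (1 + η²)³` in the strip (`Gap.exists_regC_strip_bound`) and
`C t e^{-c t} / (1 + η²)³` on the real line away from the origin (`Gap.exists_regC_decay`). This is
integrable against `|η|³`, and moving the contour to `Im η = ± σ / 2` gives the factor
`e^{-σ|x|/2}`. This settles small times (`Gap.exists_small_time_bound`), and also the region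
`|x| ≥ X t` for large times (`Gap.exists_far_bound`).

*Low frequencies.* With `z = iη` the symbol is `z (-F' + z B)`, and `-F'` has the simple eigenvalues
`β_j`; the implicit function theorem gives holomorphic eigenvalues and spectral projections near
`z = 0`, whose Taylor coefficients of order at most one are `β_j, α_j` and `M_j^0, M_j^1`
(`exists_lowFrequency`). For `|x| ≤ X t` the integral of `Ĝ` minus the Fourier transform of the
profile over `|η| ≤ δ` splits into its three modes, and the contour of the `j`-th one is moved to
height `(x + β_j t) / (L t)`, which produces `e^{-(x + β_j t)² / (4 L t)}`
(`LowFrequency.exists_mode_bound`). The error of the eigenvalue is of relative size `|η|³ t` and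
multiplies `M_j^0` at leading order; the error of the projection is `O(η²)`. Since
`∫ |η|^m e^{-θ η² t} dη` is of order `t^{-(m + 1) / 2}`, these are the two rates of the statement.
What remains is exponentially small in `t`, and in the region `|x| ≤ X t` also in `x`.
-/

noncomputable section

namespace NSGreen

open MeasureTheory Filter Topology

/-! ### Spectral representations of the matrix exponential -/

/-- `∑_j e^{t l_j} adj(l_j - S) / ∏_{k ≠ j} (l_j - l_k)`: it is `exp(t S)` if the `l_j` are the
eigenvalues of `S`, and an approximation of it if the `l_j` are approximate eigenvalues. -/
def spectralSum (S : Matrix (Fin 3) (Fin 3) ℂ) (l : Fin 3 → ℂ) (t : ℝ) :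
    Matrix (Fin 3) (Fin 3) ℂ :=
  ∑ j, Complex.exp (l j * t) • ((∏ k ∈ Finset.univ.erase j, (l j - l k))⁻¹ •
    (l j • (1 : Matrix (Fin 3) (Fin 3) ℂ) - S).adjugate)

theorem prod_erase_zero (l : Fin 3 → ℂ) :
    ∏ k ∈ Finset.univ.erase (0 : Fin 3), (l 0 - l k) = (l 0 - l 1) * (l 0 - l 2) := by
  rw [show Finset.univ.erase (0 : Fin 3) = {1, 2} by decide, Finset.prod_pair (by decide)]

theorem prod_erase_one (l : Fin 3 → ℂ) :
    ∏ k ∈ Finset.univ.erase (1 : Fin 3), (l 1 - l k) = (l 1 - l 0) * (l 1 - l 2) := by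
  rw [show Finset.univ.erase (1 : Fin 3) = {0, 2} by decide, Finset.prod_pair (by decide)]

theorem prod_erase_two (l : Fin 3 → ℂ) :
    ∏ k ∈ Finset.univ.erase (2 : Fin 3), (l 2 - l k) = (l 2 - l 0) * (l 2 - l 1) := by
  rw [show Finset.univ.erase (2 : Fin 3) = {0, 1} by decide, Finset.prod_pair (by decide)]

/-- The Lagrange interpolation identity: the adjugate is a monic quadratic polynomial in `l`. -/
theorem spectralSum_zero (S : Matrix (Fin 3) (Fin 3) ℂ) (l : Fin 3 → ℂ)
    (h : Function.Injective l) : spectralSum S l 0 = 1 := by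
  have h01 : l 0 - l 1 ≠ 0 := sub_ne_zero.2 (h.ne (by decide))
  have h02 : l 0 - l 2 ≠ 0 := sub_ne_zero.2 (h.ne (by decide))
  have h12 : l 1 - l 2 ≠ 0 := sub_ne_zero.2 (h.ne (by decide))
  have h10 : l 1 - l 0 ≠ 0 := sub_ne_zero.2 (h.ne (by decide))
  have h20 : l 2 - l 0 ≠ 0 := sub_ne_zero.2 (h.ne (by decide))
  have h21 : l 2 - l 1 ≠ 0 := sub_ne_zero.2 (h.ne (by decide))
  ext a b
  simp only [spectralSum, Fin.sum_univ_three, prod_erase_zero, prod_erase_one, prod_erase_two,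
    Matrix.add_apply, Matrix.smul_apply, Complex.ofReal_zero, mul_zero, Complex.exp_zero, one_smul,
    smul_eq_mul]
  rw [← mul_right_inj' (mul_ne_zero (mul_ne_zero h01 h02) h12)]
  have e1 : (l 0 - l 1) * (l 0 - l 2) * (l 1 - l 2) * ((l 0 - l 1) * (l 0 - l 2))⁻¹
      = l 1 - l 2 := by
    field_simp
  have e2 : (l 0 - l 1) * (l 0 - l 2) * (l 1 - l 2) * ((l 1 - l 0) * (l 1 - l 2))⁻¹
      = -(l 0 - l 2) := by
    rw [← neg_sub (l 0) (l 1)]; field_simp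
  have e3 : (l 0 - l 1) * (l 0 - l 2) * (l 1 - l 2) * ((l 2 - l 0) * (l 2 - l 1))⁻¹
      = l 0 - l 1 := by
    rw [← neg_sub (l 0) (l 2), ← neg_sub (l 1) (l 2)]; field_simp
  rw [mul_add, mul_add, ← mul_assoc, ← mul_assoc, ← mul_assoc, e1, e2, e3]
  fin_cases a <;> fin_cases b <;>
    simp [Matrix.adjugate_fin_three] <;> ring

theorem hasDerivAt_spectralSum (S : Matrix (Fin 3) (Fin 3) ℂ) (l : Fin 3 → ℂ) (t : ℝ)
    (a b : Fin 3) :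
    HasDerivAt (fun τ => spectralSum S l τ a b)
      ((S * spectralSum S l t + (∑ j, Complex.exp (l j * t) *
        ((∏ k ∈ Finset.univ.erase j, (l j - l k))⁻¹ *
          (l j • (1 : Matrix (Fin 3) (Fin 3) ℂ) - S).det)) • 1) a b) t := by
  have h1 : ∀ j, HasDerivAt (fun τ : ℝ => Complex.exp (l j * τ))
      (Complex.exp (l j * t) * l j) t := by
    intro j
    have := ((hasDerivAt_id (t : ℂ)).const_mul (l j)).cexp.comp_ofReal
    simpa using this
  have h2 : ∀ j, l j • (l j • (1 : Matrix (Fin 3) (Fin 3) ℂ) - S).adjugate =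
      S * (l j • (1 : Matrix (Fin 3) (Fin 3) ℂ) - S).adjugate +
        (l j • (1 : Matrix (Fin 3) (Fin 3) ℂ) - S).det • 1 := by
    intro j
    rw [← Matrix.mul_adjugate, sub_mul]
    simp
  have h3 : S * spectralSum S l t + (∑ j, Complex.exp (l j * t) *
        ((∏ k ∈ Finset.univ.erase j, (l j - l k))⁻¹ *
          (l j • (1 : Matrix (Fin 3) (Fin 3) ℂ) - S).det)) • 1 =
      ∑ j, (Complex.exp (l j * t) * l j) • ((∏ k ∈ Finset.univ.erase j, (l j - l k))⁻¹ •
        (l j • (1 : Matrix (Fin 3) (Fin 3) ℂ) - S).adjugate) := by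
    rw [spectralSum, Finset.mul_sum, Finset.sum_smul, ← Finset.sum_add_distrib]
    refine Finset.sum_congr rfl fun j _ => ?_
    rw [mul_smul (Complex.exp (l j * t)) (l j), smul_comm (l j), h2 j, mul_smul, mul_smul]
    simp only [smul_add, Matrix.mul_smul]
  rw [h3]
  simp only [spectralSum, Matrix.sum_apply, Matrix.smul_apply]
  exact HasDerivAt.fun_sum fun j _ => (h1 j).smul_const _

/-- Duhamel's principle in the form of a mean value inequality for `τ ↦ e^{(t-τ)S} Y(τ)`. -/
theorem norm_sub_exp_le (S : Matrix (Fin 3) (Fin 3) ℂ) (Y : ℝ → Matrix (Fin 3) (Fin 3) ℂ)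
    (ρ : ℝ → ℂ) (h0 : Y 0 = 1)
    (hY : ∀ t a b, HasDerivAt (fun τ => Y τ a b) ((S * Y t + ρ t • 1) a b) t)
    (t : ℝ) (ht : 0 ≤ t) (a b : Fin 3) (D : ℝ)
    (hD : ∀ τ, 0 ≤ τ → τ ≤ t → ‖ρ τ‖ * ‖NormedSpace.exp ((t - τ) • S) a b‖ ≤ D) :
    ‖Y t a b - NormedSpace.exp (t • S) a b‖ ≤ D * t := by
  let _ : NormedRing (Matrix (Fin 3) (Fin 3) ℂ) := Matrix.linftyOpNormedRing
  let _ : NormedAlgebra ℝ (Matrix (Fin 3) (Fin 3) ℂ) := Matrix.linftyOpNormedAlgebra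
  have hE : ∀ τ c d, HasDerivAt (fun τ => NormedSpace.exp ((t - τ) • S) c d)
      (-((NormedSpace.exp ((t - τ) • S) * S) c d)) τ := by
    intro τ c d
    have h1 := hasDerivAt_exp_smul_const (𝕂 := ℝ) S (t - τ)
    have h2 := (Matrix.entryLinearMap ℝ ℂ c d).toContinuousLinearMap.hasFDerivAt.comp_hasDerivAt
      (t - τ) h1
    have h3 := HasDerivAt.scomp τ h2 ((hasDerivAt_id τ).const_sub t)
    rw [neg_one_smul] at h3
    exact h3
  have hF : ∀ τ, HasDerivAt (fun τ => (NormedSpace.exp ((t - τ) • S) * Y τ) a b)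
      (ρ τ * NormedSpace.exp ((t - τ) • S) a b) τ := by
    intro τ
    simp only [Matrix.mul_apply]
    have h1 : HasDerivAt (fun τ => ∑ j, NormedSpace.exp ((t - τ) • S) a j * Y τ j b)
      (∑ j, (-((NormedSpace.exp ((t - τ) • S) * S) a j) * Y τ j b +
        NormedSpace.exp ((t - τ) • S) a j * (S * Y τ + ρ τ • 1) j b)) τ :=
      HasDerivAt.fun_sum fun j _ => (hE τ a j).mul (hY τ j b)
    convert h1 using 1
    have h2 : (-(NormedSpace.exp ((t - τ) • S) * S)) * Y τ +
        NormedSpace.exp ((t - τ) • S) * (S * Y τ + ρ τ • 1)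
        = ρ τ • NormedSpace.exp ((t - τ) • S) := by
      rw [mul_add, Matrix.neg_mul, Matrix.mul_assoc]
      simp
    have h3 := congrFun (congrFun h2 a) b
    simp only [Matrix.add_apply, Matrix.mul_apply, Matrix.neg_apply, Matrix.smul_apply,
      smul_eq_mul] at h3
    simp only [Finset.sum_add_distrib, Matrix.mul_apply, Matrix.add_apply, Matrix.smul_apply,
      smul_eq_mul]
    exact h3.symm
  have h4 := norm_image_sub_le_of_norm_deriv_le_segment' (a := 0) (b := t) (C := D)
    (f := fun τ => (NormedSpace.exp ((t - τ) • S) * Y τ) a b)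
    (f' := fun τ => ρ τ * NormedSpace.exp ((t - τ) • S) a b)
    (fun τ _ => (hF τ).hasDerivWithinAt)
    (fun τ hτ => by rw [norm_mul]; exact hD τ hτ.1 hτ.2.le) t ⟨ht, le_refl t⟩
  simpa [h0] using h4

/-- If the `l_j` are distinct eigenvalues of `S`, then `spectralSum` is the exponential. -/
theorem exp_eq_spectralSum (S : Matrix (Fin 3) (Fin 3) ℂ) (l : Fin 3 → ℂ)
    (h : Function.Injective l)
    (hl : ∀ j, (l j • (1 : Matrix (Fin 3) (Fin 3) ℂ) - S).det = 0) (t : ℝ) (ht : 0 ≤ t) :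
    NormedSpace.exp (t • S) = spectralSum S l t := by
  ext a b
  have := norm_sub_exp_le S (spectralSum S l) (fun _ => 0) (spectralSum_zero S l h)
    (fun t a b => by simpa [hl] using hasDerivAt_spectralSum S l t a b) t ht a b 0 (by simp)
  rw [zero_mul, norm_le_zero_iff, sub_eq_zero] at this
  exact this.symm

namespace GasState

/-! ### The characteristic polynomial of the symbol -/

/-- The characteristic polynomial of the symbol at `l`, as a function of `q = η²`. -/
def dispersion (s : GasState) (l q : ℂ) : ℂ :=
  l ^ 3 + (s.mu + s.k) / s.v * q * l ^ 2
    + (s.mu * s.k / s.v ^ 2 * q ^ 2 + (s.p * s.pe - s.pv) * q) * l - s.pv * s.k / s.v * q ^ 2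

theorem det_sub_symbol (s : GasState) (hv : s.v ≠ 0) (l η : ℂ) :
    (l • (1 : Matrix (Fin 3) (Fin 3) ℂ) - s.symbol η).det = s.dispersion l (η ^ 2) := by
  have hv' : (s.v : ℂ) ≠ 0 := by exact_mod_cast hv
  rw [Matrix.det_fin_three]
  simp [symbol, fluxJac, visc, dispersion]
  field_simp
  ring_nf
  simp only [Complex.I_sq]
  ring

/-- If `1 / w = 1 + η²` and `l = a₀ / w + a₁ + a₂ w + a₃ w² + h w³`, where the `a_i` make the
terms of order `w⁻³, …, w⁰` vanish, then the characteristic polynomial at `l` is `O(w)`. -/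
theorem exists_dispersion_bound (s : GasState) (a0 a1 a2 a3 : ℝ) (H W : ℝ)
    (h0 : a0 ^ 3 + (s.mu + s.k) / s.v * a0 ^ 2 + s.mu * s.k / s.v ^ 2 * a0 = 0)
    (h1 : 3 * a0 ^ 2 * a1 + (s.mu + s.k) / s.v * (2 * a0 * a1 - a0 ^ 2)
      + s.mu * s.k / s.v ^ 2 * (a1 - 2 * a0) + (s.p * s.pe - s.pv) * a0
      - s.pv * s.k / s.v = 0)
    (h2 : 3 * a0 ^ 2 * a2 + 3 * a0 * a1 ^ 2
      + (s.mu + s.k) / s.v * (2 * a0 * a2 + a1 ^ 2 - 2 * a0 * a1)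
      + s.mu * s.k / s.v ^ 2 * (a2 - 2 * a1 + a0) + (s.p * s.pe - s.pv) * (a1 - a0)
      + 2 * (s.pv * s.k / s.v) = 0)
    (h3 : 3 * a0 ^ 2 * a3 + 6 * a0 * a1 * a2 + a1 ^ 3
      + (s.mu + s.k) / s.v * (2 * a0 * a3 + 2 * a1 * a2 - 2 * a0 * a2 - a1 ^ 2)
      + s.mu * s.k / s.v ^ 2 * (a3 - 2 * a2 + a1) + (s.p * s.pe - s.pv) * (a2 - a1)
      - s.pv * s.k / s.v = 0) :
    ∃ C : ℝ, ∀ w h : ℂ, w ≠ 0 → ‖w‖ ≤ W → ‖h‖ ≤ H →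
      ‖s.dispersion (a0 / w + a1 + a2 * w + a3 * w ^ 2 + h * w ^ 3) (1 / w - 1)‖ ≤ C * ‖w‖ := by
  set c2 := (s.mu + s.k) / s.v with hc2
  set c11 := s.mu * s.k / s.v ^ 2 with hc11
  set c12 := s.p * s.pe - s.pv with hc12
  set c0 := s.pv * s.k / s.v with hc0
  let g : ℂ × ℂ → ℂ := fun x =>
    let w := x.1
    let h := x.2
    -- the quotient by `w⁴` of the remainder, in powers of the tail `u = a₂ + a₃ w + h w²`
    -- beyond the terms that cancel
    3 * a0 ^ 2 * h + 6 * a0 * a1 * (a3 + h * w) + 3 * a1 ^ 2 * (a2 + a3 * w + h * w ^ 2)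
      + 3 * (a0 + a1 * w) * (a2 + a3 * w + h * w ^ 2) ^ 2
      + w ^ 2 * (a2 + a3 * w + h * w ^ 2) ^ 3
      + c2 * (2 * a0 * h + 2 * a1 * (a3 + h * w) + (a2 + a3 * w + h * w ^ 2) ^ 2
        - (2 * a0 * (a3 + h * w) + 2 * a1 * (a2 + a3 * w + h * w ^ 2)
        + w * (a2 + a3 * w + h * w ^ 2) ^ 2))
      + c11 * (h - 2 * (a3 + h * w) + (a2 + a3 * w + h * w ^ 2))
      + c12 * ((a3 + h * w) - (a2 + a3 * w + h * w ^ 2))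
  have hg : Continuous g := by fun_prop
  obtain ⟨C, hC⟩ := ((isCompact_closedBall (0 : ℂ) W).prod
    (isCompact_closedBall (0 : ℂ) H)).exists_bound_of_continuousOn hg.continuousOn
  refine ⟨C, fun w h hw hwW hhH => ?_⟩
  have key : s.dispersion (a0 / w + a1 + a2 * w + a3 * w ^ 2 + h * w ^ 3) (1 / w - 1)
      = w * g (w, h) := by
    have e0 : (a0 : ℂ) ^ 3 + c2 * a0 ^ 2 + c11 * a0 = 0 := by exact_mod_cast h0
    have e1 : 3 * (a0 : ℂ) ^ 2 * a1 + c2 * (2 * a0 * a1 - a0 ^ 2)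
      + c11 * (a1 - 2 * a0) + c12 * a0 - c0 = 0 := by exact_mod_cast h1
    have e2 : 3 * (a0 : ℂ) ^ 2 * a2 + 3 * a0 * a1 ^ 2 + c2 * (2 * a0 * a2 + a1 ^ 2 - 2 * a0 * a1)
      + c11 * (a2 - 2 * a1 + a0) + c12 * (a1 - a0) + 2 * c0 = 0 := by exact_mod_cast h2
    have e3 : 3 * (a0 : ℂ) ^ 2 * a3 + 6 * a0 * a1 * a2 + a1 ^ 3
      + c2 * (2 * a0 * a3 + 2 * a1 * a2 - 2 * a0 * a2 - a1 ^ 2)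
      + c11 * (a3 - 2 * a2 + a1) + c12 * (a2 - a1) - c0 = 0 := by exact_mod_cast h3
    have e : s.dispersion (a0 / w + a1 + a2 * w + a3 * w ^ 2 + h * w ^ 3) (1 / w - 1) =
        (a0 / w + a1 + a2 * w + a3 * w ^ 2 + h * w ^ 3) ^ 3
        + c2 * (1 / w - 1) * (a0 / w + a1 + a2 * w + a3 * w ^ 2 + h * w ^ 3) ^ 2
        + (c11 * (1 / w - 1) ^ 2 + c12 * (1 / w - 1))
          * (a0 / w + a1 + a2 * w + a3 * w ^ 2 + h * w ^ 3) - c0 * (1 / w - 1) ^ 2 := by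
      simp [dispersion, hc2, hc11, hc12, hc0]
    rw [e]
    simp only [g]
    field_simp
    linear_combination e0 + w * e1 + w ^ 2 * e2 + w ^ 3 * e3
  rw [key, norm_mul, mul_comm]
  gcongr
  exact hC (w, h) ⟨by simpa using hwW, by simpa using hhH⟩

/-- This and the three following identities are the hypotheses of `exists_dispersion_bound` for the
coefficients `a₀ = -α*_j`, `a₁ = α*_j + β*_j`, `a₂ = A_{j,1}`, `a₃ = A_{j,2}` of `λ*_j`. -/
theorem singular_coeff_order_zero (s : GasState) (j : Fin 3) :
    (-s.alphaStar j) ^ 3 + (s.mu + s.k) / s.v * (-s.alphaStar j) ^ 2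
      + s.mu * s.k / s.v ^ 2 * (-s.alphaStar j) = 0 := by
  fin_cases j <;> simp [alphaStar] <;> ring

theorem singular_coeff_order_one (s : GasState) (hv : s.v ≠ 0) (hmu : s.mu ≠ 0)
    (hmk : s.mu - s.k ≠ 0) (j : Fin 3) :
    3 * (-s.alphaStar j) ^ 2 * (s.alphaStar j + s.betaStar j)
      + (s.mu + s.k) / s.v * (2 * (-s.alphaStar j) * (s.alphaStar j + s.betaStar j)
        - (-s.alphaStar j) ^ 2)
      + s.mu * s.k / s.v ^ 2 * ((s.alphaStar j + s.betaStar j) - 2 * (-s.alphaStar j))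
      + (s.p * s.pe - s.pv) * (-s.alphaStar j)
      - s.pv * s.k / s.v = 0 := by
  have hkm : s.k - s.mu ≠ 0 := by rwa [← neg_ne_zero, neg_sub]
  fin_cases j
  · simp [alphaStar, betaStar]; field_simp; ring
  · simp [alphaStar, betaStar]; field_simp; ring
  · simp [alphaStar, betaStar]; field_simp; ring

theorem singular_coeff_order_two (s : GasState) (hv : s.v ≠ 0) (hmu : s.mu ≠ 0) (hk : s.k ≠ 0)
    (hmk : s.mu - s.k ≠ 0) (j : Fin 3) :
    3 * (-s.alphaStar j) ^ 2 * s.A j 0 + 3 * (-s.alphaStar j) * (s.alphaStar j + s.betaStar j) ^ 2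
      + (s.mu + s.k) / s.v * (2 * (-s.alphaStar j) * s.A j 0 + (s.alphaStar j + s.betaStar j) ^ 2
        - 2 * (-s.alphaStar j) * (s.alphaStar j + s.betaStar j))
      + s.mu * s.k / s.v ^ 2 * (s.A j 0 - 2 * (s.alphaStar j + s.betaStar j) + (-s.alphaStar j))
      + (s.p * s.pe - s.pv) * ((s.alphaStar j + s.betaStar j) - (-s.alphaStar j))
      + 2 * (s.pv * s.k / s.v) = 0 := by
  have hkm : s.k - s.mu ≠ 0 := by rwa [← neg_ne_zero, neg_sub]
  fin_cases j
  · simp [alphaStar, betaStar, A, A11]; field_simp; ring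
  · simp [alphaStar, betaStar, A, A21]
    rw [show s.k = s.mu - (s.mu - s.k) by ring]
    generalize s.mu - s.k = d at *
    simp only [sub_sub_cancel]
    field_simp; ring
  · simp [alphaStar, betaStar, A, A31]
    rw [show s.mu = s.k - (s.k - s.mu) by ring]
    generalize s.k - s.mu = d at *
    simp only [sub_sub_cancel]
    field_simp; ring

theorem singular_coeff_order_three (s : GasState) (hv : s.v ≠ 0) (hmu : s.mu ≠ 0) (hk : s.k ≠ 0)
    (hmk : s.mu - s.k ≠ 0) (j : Fin 3) :
    3 * (-s.alphaStar j) ^ 2 * s.A j 1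
      + 6 * (-s.alphaStar j) * (s.alphaStar j + s.betaStar j) * s.A j 0
      + (s.alphaStar j + s.betaStar j) ^ 3
      + (s.mu + s.k) / s.v * (2 * (-s.alphaStar j) * s.A j 1
        + 2 * (s.alphaStar j + s.betaStar j) * s.A j 0
        - 2 * (-s.alphaStar j) * s.A j 0 - (s.alphaStar j + s.betaStar j) ^ 2)
      + s.mu * s.k / s.v ^ 2 * (s.A j 1 - 2 * s.A j 0 + (s.alphaStar j + s.betaStar j))
      + (s.p * s.pe - s.pv) * (s.A j 0 - (s.alphaStar j + s.betaStar j))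
      - s.pv * s.k / s.v = 0 := by
  have hkm : s.k - s.mu ≠ 0 := by rwa [← neg_ne_zero, neg_sub]
  fin_cases j
  · simp [alphaStar, betaStar, A, A11, A12]; field_simp; ring
  · simp [alphaStar, betaStar, A, A21, A22]
    rw [show s.k = s.mu - (s.mu - s.k) by ring]
    generalize s.mu - s.k = d at *
    simp only [sub_sub_cancel]
    field_simp; ring
  · simp [alphaStar, betaStar, A, A31, A32]
    rw [show s.mu = s.k - (s.k - s.mu) by ring]
    generalize s.k - s.mu = d at *
    simp only [sub_sub_cancel]
    field_simp; ring

/-! ### The expansion of the spectral projections at the origin -/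

/-- The matrices `M_j^0` are the spectral projections of `-F'` for its eigenvalues `β_j`. -/
theorem adjugate_eq_smul_M0 (s : GasState) (hc0 : s.c ≠ 0) (hc : s.c ^ 2 = s.p * s.pe - s.pv)
    (j : Fin 3) :
    (s.beta j • (1 : Matrix (Fin 3) (Fin 3) ℝ) + s.fluxJac).adjugate =
      (∏ k ∈ Finset.univ.erase j, (s.beta j - s.beta k)) • s.M0 j := by
  have hpv : s.pv = s.p * s.pe - s.c ^ 2 := by rw [hc]; ring
  have e0 : Finset.univ.erase (0 : Fin 3) = {1, 2} := by decide
  have e1 : Finset.univ.erase (1 : Fin 3) = {0, 2} := by decide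
  have e2 : Finset.univ.erase (2 : Fin 3) = {0, 1} := by decide
  have hE0 : s.entropyM0 = (s.c ^ 2)⁻¹ •
      !![s.p * s.pe, -(s.u * s.pe), s.pe; 0, 0, 0; -(s.p * s.pv), s.u * s.pv, -s.pv] := by
    rw [entropyM0, ← hc]
  generalize hcc : s.c = c at *
  fin_cases j
  · simp only [Fin.zero_eta, e0]
    rw [Finset.prod_pair (by decide)]
    ext a b
    fin_cases a <;> fin_cases b <;>
      simp [Matrix.adjugate_fin_three, beta, M0, hE0, fluxJac, hcc] <;>
      field_simp <;> (try simp only [hpv]) <;> ring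
  · simp only [Fin.mk_one, e1]
    rw [Finset.prod_pair (by decide)]
    ext a b
    fin_cases a <;> fin_cases b <;>
      simp [Matrix.adjugate_fin_three, beta, M0, acousticM0, fluxJac, hcc] <;>
      field_simp <;> (try simp only [hpv]) <;> ring
  · simp only [Fin.reduceFinMk, e2]
    rw [Finset.prod_pair (by decide)]
    ext a b
    fin_cases a <;> fin_cases b <;>
      simp [Matrix.adjugate_fin_three, beta, M0, acousticM0, fluxJac, hcc] <;>
      field_simp <;> (try simp only [hpv]) <;> ring

set_option maxHeartbeats 1600000 in
/-- The first order terms in `z` of `adj(m_j(z) + F' - z B) = ∏_{k ≠ j} (m_j - m_k)(z) M̂_j(z)`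
for `m_j(z) = β_j + α_j z + O(z²)`. -/
theorem adjugate_polar_eq (s : GasState) (hv : s.v ≠ 0) (hc0 : s.c ≠ 0)
    (hc : s.c ^ 2 = s.p * s.pe - s.pv) (j k l : Fin 3) (hjk : j ≠ k) (hjl : j ≠ l) (hkl : k ≠ l) :
    (s.beta j • (1 : Matrix (Fin 3) (Fin 3) ℝ) + s.fluxJac
        + (s.alpha j • (1 : Matrix (Fin 3) (Fin 3) ℝ) - s.visc)).adjugate
      - (s.beta j • (1 : Matrix (Fin 3) (Fin 3) ℝ) + s.fluxJac).adjugate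
      - (s.alpha j • (1 : Matrix (Fin 3) (Fin 3) ℝ) - s.visc).adjugate =
    ((s.alpha j - s.alpha k) * (s.beta j - s.beta l)
      + (s.beta j - s.beta k) * (s.alpha j - s.alpha l)) • s.M0 j
    + ((s.beta j - s.beta k) * (s.beta j - s.beta l)) • s.M1 j := by
  have hpv : s.pv = s.p * s.pe - s.c ^ 2 := by rw [hc]; ring
  wlog hkl' : k < l generalizing k l
  · rw [this l k hjl hjk hkl.symm (lt_of_le_of_ne (not_lt.1 hkl') hkl.symm)]
    congr 2 <;> ring
  have ha : s.alpha = ![-(s.k * (s.p * s.pe - s.c ^ 2)) / (s.v * s.c ^ 2),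
      (s.k * s.p * s.pe + s.mu * s.p * s.pe - s.mu * (s.p * s.pe - s.c ^ 2)) / (2 * s.v * s.c ^ 2),
      (s.k * s.p * s.pe + s.mu * s.p * s.pe - s.mu * (s.p * s.pe - s.c ^ 2))
        / (2 * s.v * s.c ^ 2)] := by
    rw [alpha, ← hc, hpv]
  have hE0 : s.entropyM0 = (s.c ^ 2)⁻¹ •
      !![s.p * s.pe, -(s.u * s.pe), s.pe; 0, 0, 0; -(s.p * s.pv), s.u * s.pv, -s.pv] := by
    rw [entropyM0, ← hc]
  have hE1 : s.entropyM1 = (s.k / (s.v * (s.c ^ 2) ^ 2)) •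
    !![0, s.p * s.pe, 0;
       -(s.p * s.pe * s.pv), s.u * s.pe * s.pv, -(s.pe * s.pv);
       -(s.p * s.u * s.pe * s.pv), -((s.p - s.u ^ 2 * s.pe) * s.pv), -(s.u * s.pe * s.pv)] := by
    rw [entropyM1, ← hc]
  generalize hcc : s.c = c at *
  fin_cases j
  · obtain ⟨rfl, rfl⟩ : k = 1 ∧ l = 2 := by revert hjk hjl hkl'; revert k l; decide
    ext a b
    fin_cases a <;> fin_cases b <;>
      simp [Matrix.adjugate_fin_three, ha, beta, M0, M1, hE0, hE1, fluxJac, visc, hcc] <;>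
      (try left) <;> field_simp <;> (try simp only [hpv]) <;> ring
  · obtain ⟨rfl, rfl⟩ : k = 0 ∧ l = 2 := by revert hjk hjl hkl'; revert k l; decide
    ext a b
    fin_cases a <;> fin_cases b <;>
      simp [Matrix.adjugate_fin_three, ha, beta, M0, M1, acousticM0, acousticM1, fluxJac, visc,
        hcc] <;>
      field_simp <;> (try simp only [hpv]) <;> ring
  · obtain ⟨rfl, rfl⟩ : k = 0 ∧ l = 1 := by revert hjk hjl hkl'; revert k l; decide
    ext a b
    fin_cases a <;> fin_cases b <;>
      simp [Matrix.adjugate_fin_three, ha, beta, M0, M1, acousticM0, acousticM1, fluxJac, visc,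
        hcc] <;>
      field_simp <;> (try simp only [hpv]) <;> ring

end GasState

/-- The adjugate of a `3 × 3` matrix is quadratic, so its derivative is its polar form. -/
theorem hasDerivAt_adjugate (X : ℂ → Matrix (Fin 3) (Fin 3) ℂ) (X1 : Matrix (Fin 3) (Fin 3) ℂ)
    (z : ℂ) (hX : ∀ a b, HasDerivAt (fun w => X w a b) (X1 a b) z) (a b : Fin 3) :
    HasDerivAt (fun w => (X w).adjugate a b)
      (((X z + X1).adjugate - (X z).adjugate - X1.adjugate) a b) z := by
  have key : ∀ i j k l i' j' k' l', HasDerivAt (fun w => X w i j * X w k l - X w i' j' * X w k' l')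
      (X1 i j * X z k l + X z i j * X1 k l - (X1 i' j' * X z k' l' + X z i' j' * X1 k' l')) z :=
    fun i j k l i' j' k' l' => ((hX i j).mul (hX k l)).sub ((hX i' j').mul (hX k' l'))
  have key' : ∀ i j k l i' j' k' l',
      HasDerivAt (fun w => -(X w i j * X w k l) + X w i' j' * X w k' l')
      (-(X1 i j * X z k l + X z i j * X1 k l) + (X1 i' j' * X z k' l' + X z i' j' * X1 k' l')) z :=
    fun i j k l i' j' k' l' => ((hX i j).mul (hX k l)).neg.add ((hX i' j').mul (hX k' l'))
  simp only [Matrix.adjugate_fin_three]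
  fin_cases a <;> fin_cases b <;> simp <;>
    first
    | (refine (key _ _ _ _ _ _ _ _).congr_deriv ?_; ring)
    | (refine (key' _ _ _ _ _ _ _ _).congr_deriv ?_; ring)

/-! ### Energy estimates for the exponential of the symbol -/

/-- A differential form of Grönwall's inequality. -/
theorem le_mul_exp_of_deriv_le {N N' : ℝ → ℝ} {K : ℝ} (hN : ∀ t, HasDerivAt N (N' t) t)
    (h : ∀ t, N' t ≤ K * N t) {t : ℝ} (ht : 0 ≤ t) : N t ≤ N 0 * Real.exp (K * t) := by
  have hd : ∀ t, HasDerivAt (fun t => N t * Real.exp (-(K * t)))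
      ((N' t - K * N t) * Real.exp (-(K * t))) t := by
    intro t
    have h1 : HasDerivAt (fun t : ℝ => Real.exp (-(K * t))) (Real.exp (-(K * t)) * -K) t := by
      have := ((hasDerivAt_id t).const_mul K).neg.exp
      simpa using this
    refine ((hN t).mul h1).congr_deriv ?_
    ring
  have hanti : Antitone (fun t => N t * Real.exp (-(K * t))) := by
    refine antitone_of_deriv_nonpos (fun t => (hd t).differentiableAt) fun t => ?_
    rw [(hd t).deriv]
    exact mul_nonpos_of_nonpos_of_nonneg (by linarith [h t]) (Real.exp_pos _).le
  have h2 := hanti ht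
  simp only [mul_zero, neg_zero, Real.exp_zero, mul_one] at h2
  calc N t = N t * Real.exp (-(K * t)) * Real.exp (K * t) := by
        rw [mul_assoc, ← Real.exp_add]; simp
    _ ≤ _ := by gcongr

/-- The symmetrized form of the system `w' = (-iη F' - η² B) w`: for real `η`, the coupling of `y`
to `x` and `z` is skew-Hermitian and `y`, `z` are damped. -/
structure IsSymmetrized (m₁ m₂ μ κ : ℝ) (η : ℂ) (x y z : ℝ → ℂ) : Prop where
  hx : ∀ t, HasDerivAt x (Complex.I * η * m₁ * y t) t
  hy : ∀ t, HasDerivAt y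
    (Complex.I * η * m₁ * x t - Complex.I * η * m₂ * z t - η ^ 2 * μ * y t) t
  hz : ∀ t, HasDerivAt z (-(Complex.I * η * m₂ * y t) - η ^ 2 * κ * z t) t

theorem hasDerivAt_re {f : ℝ → ℂ} {f' : ℂ} {t : ℝ} (h : HasDerivAt f f' t) :
    HasDerivAt (fun t => (f t).re) f'.re t :=
  Complex.reCLM.hasFDerivAt.comp_hasDerivAt t h

theorem hasDerivAt_im {f : ℝ → ℂ} {f' : ℂ} {t : ℝ} (h : HasDerivAt f f' t) :
    HasDerivAt (fun t => (f t).im) f'.im t :=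
  Complex.imCLM.hasFDerivAt.comp_hasDerivAt t h

theorem IsSymmetrized.energy_le {m₁ m₂ μ κ : ℝ} {η : ℂ} {x y z : ℝ → ℂ}
    (h : IsSymmetrized m₁ m₂ μ κ η x y z) (h1 : 0 < m₁) (h2 : 0 < m₂) (hμ : 0 < μ) (hκ : 0 < κ)
    (hη : |η.im| ≤ 1) {t : ℝ} (ht : 0 ≤ t) :
    ‖x t‖ ^ 2 + ‖y t‖ ^ 2 + ‖z t‖ ^ 2 ≤
      (‖x 0‖ ^ 2 + ‖y 0‖ ^ 2 + ‖z 0‖ ^ 2) * Real.exp (2 * (m₁ + m₂ + μ + κ) * t) := by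
  simp only [← Complex.normSq_eq_norm_sq, Complex.normSq_apply]
  obtain ⟨a, b⟩ := η
  simp only at hη
  have hd := fun t => ((((hasDerivAt_re (h.hx t)).mul (hasDerivAt_re (h.hx t))).add
    ((hasDerivAt_im (h.hx t)).mul (hasDerivAt_im (h.hx t)))).add
    (((hasDerivAt_re (h.hy t)).mul (hasDerivAt_re (h.hy t))).add
    ((hasDerivAt_im (h.hy t)).mul (hasDerivAt_im (h.hy t))))).add
    (((hasDerivAt_re (h.hz t)).mul (hasDerivAt_re (h.hz t))).add
    ((hasDerivAt_im (h.hz t)).mul (hasDerivAt_im (h.hz t))))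
  refine le_mul_exp_of_deriv_le hd (fun t => ?_) ht
  simp [pow_two]
  generalize (x t).re = xr
  generalize (x t).im = xi
  generalize (y t).re = yr
  generalize (y t).im = yi
  generalize (z t).re = zr
  generalize (z t).im = zi
  obtain ⟨hb1, hb2⟩ := abs_le.1 hη
  have hb : b ^ 2 ≤ 1 := by nlinarith
  -- a product of two components is at most half the sum of their squares
  have hp : ∀ p q : ℝ, -(b * (p * q)) * 2 ≤ p ^ 2 + q ^ 2 := fun p q => by
    nlinarith [mul_nonneg (sub_nonneg.2 hb1) (sq_nonneg (p - q)),
      mul_nonneg (sub_nonneg.2 hb2) (sq_nonneg (p + q)), sq_nonneg (p - q), sq_nonneg (p + q)]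
  have hm : ∀ p q : ℝ, b * (p * q) * 2 ≤ p ^ 2 + q ^ 2 := fun p q => by
    have := hp p (-q); nlinarith
  have e1 := mul_le_mul_of_nonneg_left (hp xr yr) h1.le
  have e2 := mul_le_mul_of_nonneg_left (hp xi yi) h1.le
  have e3 := mul_le_mul_of_nonneg_left (hm yr zr) h2.le
  have e4 := mul_le_mul_of_nonneg_left (hm yi zi) h2.le
  have e5 : -(a ^ 2 - b ^ 2) * (μ * (yr ^ 2 + yi ^ 2)) ≤ μ * (yr ^ 2 + yi ^ 2) :=
    mul_le_of_le_one_left (by positivity) (by nlinarith)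
  have e6 : -(a ^ 2 - b ^ 2) * (κ * (zr ^ 2 + zi ^ 2)) ≤ κ * (zr ^ 2 + zi ^ 2) :=
    mul_le_of_le_one_left (by positivity) (by nlinarith)
  have e7 : 0 ≤ m₁ * (zr ^ 2 + zi ^ 2) := by positivity
  have e8 : 0 ≤ m₂ * (xr ^ 2 + xi ^ 2) := by positivity
  have e9 : 0 ≤ μ * (xr ^ 2 + xi ^ 2 + zr ^ 2 + zi ^ 2) := by positivity
  have e10 : 0 ≤ κ * (xr ^ 2 + xi ^ 2 + yr ^ 2 + yi ^ 2) := by positivity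
  have e11 : 0 ≤ m₁ * (xr ^ 2 + xi ^ 2 + yr ^ 2 + yi ^ 2) := by positivity
  have e12 : 0 ≤ m₂ * (yr ^ 2 + yi ^ 2 + zr ^ 2 + zi ^ 2) := by positivity
  nlinarith

/-- The dissipation inequality behind `exists_energy_decay`, with `q = a² / (1 + a²)`. -/
theorem compensated_dissipation {m₁ m₂ μ κ ε c q a : ℝ} (h1 : 0 < m₁) (hε : 0 < ε)
    (hq0 : 0 ≤ q) (hq1 : q ≤ 1) (hqa : q ≤ a ^ 2)
    (hεy : 2 * ε * m₁ + 2 * ε * (μ ^ 2 / m₁) ≤ μ) (hεz : 2 * ε * (m₂ ^ 2 / m₁) ≤ κ)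
    (hc : 0 < c) (hcx : 3 / 2 * c ≤ ε * m₁) (hcy : 3 / 2 * c ≤ μ) (hcz : 3 / 2 * c ≤ κ)
    (xr xi yr yi zr zi : ℝ) :
    3 / 2 * c * q * (xr ^ 2 + xi ^ 2 + (yr ^ 2 + yi ^ 2) + (zr ^ 2 + zi ^ 2))
      - 2 * (μ * a ^ 2 * (yr ^ 2 + yi ^ 2)) - 2 * (κ * a ^ 2 * (zr ^ 2 + zi ^ 2)) ≤
    2 * (ε * m₁ * q * (xr ^ 2 + xi ^ 2)) - 2 * ε * m₁ * q * (yr ^ 2 + yi ^ 2)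
      - (2 * ε * q * m₂ * (xr * zr) + 2 * ε * q * m₂ * (xi * zi))
      - (2 * ε * q * (a * μ) * (xr * yi) - 2 * ε * q * (a * μ) * (xi * yr)) := by
  have hμ : 0 < μ := by linarith
  have hκ : 0 < κ := by linarith
  -- Young's inequality for the two terms coupling `x` to the damped components
  have young : ∀ β p o : ℝ, |2 * ε * q * β * (p * o)| ≤
      ε * q * (m₁ / 2 * p ^ 2 + 2 * (β ^ 2 / m₁) * o ^ 2) := by
    intro β p o
    have e1 : m₁ / 2 * p ^ 2 + 2 * (β ^ 2 / m₁) * o ^ 2 - 2 * β * (p * o) =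
        (m₁ * p - 2 * β * o) ^ 2 / (2 * m₁) := by field_simp; ring
    have e2 : m₁ / 2 * p ^ 2 + 2 * (β ^ 2 / m₁) * o ^ 2 + 2 * β * (p * o) =
        (m₁ * p + 2 * β * o) ^ 2 / (2 * m₁) := by field_simp; ring
    have e3 : 0 ≤ (m₁ * p - 2 * β * o) ^ 2 / (2 * m₁) := by positivity
    have e4 : 0 ≤ (m₁ * p + 2 * β * o) ^ 2 / (2 * m₁) := by positivity
    have e5 : 0 ≤ ε * q := by positivity
    rw [abs_le]
    constructor <;> nlinarith
  have hxz : ∀ p o : ℝ, |2 * ε * q * m₂ * (p * o)| ≤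
      ε * q * (m₁ / 2 * p ^ 2 + 2 * (m₂ ^ 2 / m₁) * o ^ 2) := young m₂
  have hxy : ∀ p o : ℝ, |2 * ε * q * (a * μ) * (p * o)| ≤
      ε * q * (m₁ / 2 * p ^ 2) + 2 * ε * (μ ^ 2 / m₁) * a ^ 2 * o ^ 2 := by
    intro p o
    refine (young (a * μ) p o).trans ?_
    have e1 : ε * q * (2 * ((a * μ) ^ 2 / m₁) * o ^ 2) ≤
        ε * 1 * (2 * ((a * μ) ^ 2 / m₁) * o ^ 2) := by gcongr
    have e2 : ε * 1 * (2 * ((a * μ) ^ 2 / m₁) * o ^ 2) =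
        2 * ε * (μ ^ 2 / m₁) * a ^ 2 * o ^ 2 := by ring
    linarith
  have b1 := (abs_le.1 (hxz xr zr))
  have b2 := (abs_le.1 (hxz xi zi))
  have b3 := (abs_le.1 (hxy xr yi))
  have b4 := (abs_le.1 (hxy xi yr))
  -- comparison of the damping coefficients
  have dx : 3 / 2 * c * q * (xr ^ 2 + xi ^ 2) ≤ ε * m₁ * q * (xr ^ 2 + xi ^ 2) := by
    gcongr
  have dy1 : 3 / 2 * c * q * (yr ^ 2 + yi ^ 2) ≤ μ * a ^ 2 * (yr ^ 2 + yi ^ 2) := by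
    gcongr
  have dy2 : (2 * ε * m₁ + 2 * ε * (μ ^ 2 / m₁)) * a ^ 2 * (yr ^ 2 + yi ^ 2) ≤
      μ * a ^ 2 * (yr ^ 2 + yi ^ 2) := by gcongr
  have dy3 : 2 * ε * m₁ * q * (yr ^ 2 + yi ^ 2) ≤
      2 * ε * m₁ * a ^ 2 * (yr ^ 2 + yi ^ 2) := by gcongr
  have dz1 : 3 / 2 * c * q * (zr ^ 2 + zi ^ 2) ≤ κ * a ^ 2 * (zr ^ 2 + zi ^ 2) := by
    gcongr
  have dz2 : 2 * ε * (m₂ ^ 2 / m₁) * q * (zr ^ 2 + zi ^ 2) ≤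
      κ * a ^ 2 * (zr ^ 2 + zi ^ 2) := by gcongr
  have dz3 : 0 ≤ κ * a ^ 2 * (zr ^ 2 + zi ^ 2) := by positivity
  linarith

/-- The dissipation reaches the undamped component `x` through the compensating term
`-2 ε a / (1 + a²) Im(x̄ y)` in the energy. -/
theorem exists_energy_decay {m₁ m₂ μ κ : ℝ} (h1 : 0 < m₁) (h2 : 0 < m₂) (hμ : 0 < μ) (hκ : 0 < κ) :
    ∃ c : ℝ, 0 < c ∧ ∀ (a : ℝ) (x y z : ℝ → ℂ), IsSymmetrized m₁ m₂ μ κ a x y z → ∀ t : ℝ, 0 ≤ t →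
      ‖x t‖ ^ 2 + ‖y t‖ ^ 2 + ‖z t‖ ^ 2 ≤
        3 * (‖x 0‖ ^ 2 + ‖y 0‖ ^ 2 + ‖z 0‖ ^ 2) * Real.exp (-(c * (a ^ 2 / (1 + a ^ 2))) * t) := by
  obtain ⟨ε, hε, hε1, hεy, hεz⟩ : ∃ ε : ℝ, 0 < ε ∧ ε ≤ 1 ∧
      2 * ε * m₁ + 2 * ε * (μ ^ 2 / m₁) ≤ μ ∧ 2 * ε * (m₂ ^ 2 / m₁) ≤ κ := by
    refine ⟨min 1 (min (μ / (2 * m₁ + 2 * (μ ^ 2 / m₁))) (κ / (2 * (m₂ ^ 2 / m₁)))),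
      by positivity, min_le_left _ _, ?_, ?_⟩
    · have h := (min_le_right 1 _).trans (min_le_left (μ / (2 * m₁ + 2 * (μ ^ 2 / m₁)))
        (κ / (2 * (m₂ ^ 2 / m₁))))
      rw [le_div_iff₀ (by positivity)] at h
      linarith
    · have h := (min_le_right 1 _).trans (min_le_right (μ / (2 * m₁ + 2 * (μ ^ 2 / m₁)))
        (κ / (2 * (m₂ ^ 2 / m₁))))
      rw [le_div_iff₀ (by positivity)] at h
      linarith
  obtain ⟨c, hc, hcx, hcy, hcz⟩ : ∃ c : ℝ, 0 < c ∧ 3 / 2 * c ≤ ε * m₁ ∧ 3 / 2 * c ≤ μ ∧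
      3 / 2 * c ≤ κ := by
    refine ⟨2 / 3 * min (ε * m₁) (min μ κ), by positivity, ?_, ?_, ?_⟩
    · linarith [min_le_left (ε * m₁) (min μ κ)]
    · linarith [(min_le_right (ε * m₁) (min μ κ)).trans (min_le_left _ _)]
    · linarith [(min_le_right (ε * m₁) (min μ κ)).trans (min_le_right _ _)]
  refine ⟨c, hc, fun a x y z h t ht => ?_⟩
  set r := a / (1 + a ^ 2) with hr
  have ha : 0 < 1 + a ^ 2 := by positivity
  have hq : a ^ 2 / (1 + a ^ 2) = r * a := by rw [hr]; field_simp
  rw [hq]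
  have hq0 : 0 ≤ r * a := by rw [← hq]; positivity
  have hq1 : r * a ≤ 1 := by rw [← hq, div_le_one ha]; linarith
  have hqa : r * a ≤ a ^ 2 := by
    rw [← hq]; exact div_le_self (sq_nonneg a) (by nlinarith [sq_nonneg a])
  have hr1 : |r| ≤ 1 / 2 := by
    rw [hr, abs_div, abs_of_pos ha, div_le_iff₀ ha]
    nlinarith [sq_abs a, sq_nonneg (|a| - 1)]
  have hcross : ∀ X Y : ℂ, |2 * ε * r * (X.re * Y.im - X.im * Y.re)| ≤ (‖X‖ ^ 2 + ‖Y‖ ^ 2) / 2 := by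
    intro X Y
    simp only [← Complex.normSq_eq_norm_sq, Complex.normSq_apply]
    have h3 : |X.re * Y.im - X.im * Y.re| ≤ (X.re * X.re + X.im * X.im +
        (Y.re * Y.re + Y.im * Y.im)) / 2 := by
      rw [abs_le]
      constructor
      · nlinarith [sq_nonneg (X.re + Y.im), sq_nonneg (X.im - Y.re)]
      · nlinarith [sq_nonneg (X.re - Y.im), sq_nonneg (X.im + Y.re)]
    rw [abs_mul, abs_mul, abs_of_pos (by positivity : 0 < 2 * ε)]
    calc 2 * ε * |r| * |X.re * Y.im - X.im * Y.re| ≤ 2 * 1 * (1 / 2) * _ := by gcongr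
      _ ≤ _ := by linarith
  have hd := fun t => (((((hasDerivAt_re (h.hx t)).mul (hasDerivAt_re (h.hx t))).add
    ((hasDerivAt_im (h.hx t)).mul (hasDerivAt_im (h.hx t)))).add
    (((hasDerivAt_re (h.hy t)).mul (hasDerivAt_re (h.hy t))).add
    ((hasDerivAt_im (h.hy t)).mul (hasDerivAt_im (h.hy t))))).add
    (((hasDerivAt_re (h.hz t)).mul (hasDerivAt_re (h.hz t))).add
    ((hasDerivAt_im (h.hz t)).mul (hasDerivAt_im (h.hz t))))).sub
    ((((hasDerivAt_re (h.hx t)).mul (hasDerivAt_im (h.hy t))).sub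
    ((hasDerivAt_im (h.hx t)).mul (hasDerivAt_re (h.hy t)))).const_mul (2 * ε * r))
  have hN := le_mul_exp_of_deriv_le (K := -(c * (r * a))) hd (fun t => ?_) ht
  · have n0 : ∀ τ, ((x τ).re * (x τ).re + (x τ).im * (x τ).im + ((y τ).re * (y τ).re +
        (y τ).im * (y τ).im) + ((z τ).re * (z τ).re + (z τ).im * (z τ).im)) =
        ‖x τ‖ ^ 2 + ‖y τ‖ ^ 2 + ‖z τ‖ ^ 2 := by
      intro τ
      simp only [← Complex.normSq_eq_norm_sq, Complex.normSq_apply]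
    simp only [Pi.add_apply, Pi.mul_apply, Pi.sub_apply, n0] at hN
    have l1 := (abs_le.1 (hcross (x t) (y t))).2
    have l2 := (abs_le.1 (hcross (x 0) (y 0))).1
    have l3 : (‖x 0‖ ^ 2 + ‖y 0‖ ^ 2 + ‖z 0‖ ^ 2 - 2 * ε * r * ((x 0).re * (y 0).im
        - (x 0).im * (y 0).re)) * Real.exp (-(c * (r * a)) * t) ≤
        (3 / 2 * (‖x 0‖ ^ 2 + ‖y 0‖ ^ 2 + ‖z 0‖ ^ 2)) * Real.exp (-(c * (r * a)) * t) := by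
      gcongr
      nlinarith [sq_nonneg ‖z 0‖]
    nlinarith [sq_nonneg ‖z t‖]
  · simp only [Pi.add_apply, Pi.mul_apply, Pi.sub_apply]
    have hK : -(c * (r * a)) * ((x t).re * (x t).re + (x t).im * (x t).im + ((y t).re * (y t).re +
        (y t).im * (y t).im) + ((z t).re * (z t).re + (z t).im * (z t).im)
        - 2 * ε * r * ((x t).re * (y t).im - (x t).im * (y t).re)) ≥
        -(3 / 2 * c * (r * a)) * ((x t).re * (x t).re + (x t).im * (x t).im +
        ((y t).re * (y t).re + (y t).im * (y t).im) +
        ((z t).re * (z t).re + (z t).im * (z t).im)) := by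
      have := (abs_le.1 (hcross (x t) (y t))).1
      simp only [← Complex.normSq_eq_norm_sq, Complex.normSq_apply] at this
      have h0 : 0 ≤ c * (r * a) := by positivity
      have h00 := mul_self_nonneg (z t).re
      have h01 := mul_self_nonneg (z t).im
      nlinarith
    refine le_trans ?_ hK
    simp [pow_two]
    generalize (x t).re = xr
    generalize (x t).im = xi
    generalize (y t).re = yr
    generalize (y t).im = yi
    generalize (z t).re = zr
    generalize (z t).im = zi
    have := compensated_dissipation h1 hε hq0 hq1 hqa hεy hεz hc hcx hcy hcz xr xi yr yi zr zi
    linarith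

namespace GasState

/-- The conditions on the gas under which the linearized system is dissipative and the two
diffusivities `μ / v < κ θ_e / v` are distinct. -/
structure Regular (s : GasState) : Prop where
  v_pos : 0 < s.v
  mu_pos : 0 < s.mu
  mu_lt_k : s.mu < s.k
  p_pos : 0 < s.p
  pv_neg : s.pv < 0
  pe_pos : 0 < s.pe

namespace Regular

variable {s : GasState}

theorem k_pos (hs : s.Regular) : 0 < s.k := hs.mu_pos.trans hs.mu_lt_k

theorem sq_c_pos (hs : s.Regular) : 0 < s.p * s.pe - s.pv := by
  have := mul_pos hs.p_pos hs.pe_pos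
  have := hs.pv_neg
  linarith

theorem c_pos (hs : s.Regular) : 0 < s.c := Real.sqrt_pos.2 hs.sq_c_pos

theorem sq_c (hs : s.Regular) : s.c ^ 2 = s.p * s.pe - s.pv := Real.sq_sqrt hs.sq_c_pos.le

end Regular

/-- The Fourier transform `greenHat` of the Green's function, continued to complex frequencies. -/
def greenC (s : GasState) (η : ℂ) (t : ℝ) : Matrix (Fin 3) (Fin 3) ℂ :=
  NormedSpace.exp (t • s.symbol η)

theorem hasDerivAt_greenC (s : GasState) (η : ℂ) (t : ℝ) (a b : Fin 3) :
    HasDerivAt (fun τ => s.greenC η τ a b) ((s.symbol η * s.greenC η t) a b) t := by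
  let _ : NormedRing (Matrix (Fin 3) (Fin 3) ℂ) := Matrix.linftyOpNormedRing
  let _ : NormedAlgebra ℝ (Matrix (Fin 3) (Fin 3) ℂ) := Matrix.linftyOpNormedAlgebra
  have h := hasDerivAt_exp_smul_const' (𝕂 := ℝ) (s.symbol η) t
  have h1 := (Matrix.entryLinearMap ℝ ℂ a b).toContinuousLinearMap.hasFDerivAt.comp_hasDerivAt t h
  exact h1

theorem differentiable_greenC (s : GasState) (t : ℝ) (a b : Fin 3) :
    Differentiable ℂ (fun η => s.greenC η t a b) := by
  let _ : NormedRing (Matrix (Fin 3) (Fin 3) ℂ) := Matrix.linftyOpNormedRing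
  let _ : NormedAlgebra ℂ (Matrix (Fin 3) (Fin 3) ℂ) := Matrix.linftyOpNormedAlgebra
  have h1 : Differentiable ℂ (fun η => t • s.symbol η) := by
    have : ∀ η, t • s.symbol η = (-(t * Complex.I) * η) • s.fluxJac.map Complex.ofReal
        - ((t : ℂ) * η ^ 2) • s.visc.map Complex.ofReal := by
      intro η
      ext i j
      simp [symbol]
      ring
    simp only [this]
    fun_prop
  intro η
  have h2 : DifferentiableAt ℂ (NormedSpace.exp : Matrix (Fin 3) (Fin 3) ℂ → _)
    (t • s.symbol η) := (NormedSpace.exp_analytic (𝕂 := ℂ) _).differentiableAt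
  have h3 := h2.comp η (h1 η)
  exact ((Matrix.entryLinearMap ℂ ℂ a b).toContinuousLinearMap.differentiableAt).comp η h3

/-- Each column of the Green's function is a solution of the symmetrized system, in the variables
`√(-p_v) v`, `u` and `√(p_e / p) e`. -/
theorem isSymmetrized_greenC {s : GasState} (hs : s.Regular) (η : ℂ) (j : Fin 3) :
    IsSymmetrized (Real.sqrt (-s.pv)) (Real.sqrt (s.p * s.pe)) (s.mu / s.v) (s.k / s.v) η
      (fun t => Real.sqrt (-s.pv) * s.greenC η t 0 j) (fun t => s.greenC η t 1 j)
      (fun t => Real.sqrt (s.p * s.pe) / s.p * (s.greenC η t 2 j - s.u * s.greenC η t 1 j)) := by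
  have hd : ∀ t i, HasDerivAt (fun τ => s.greenC η τ i j)
      (∑ k, s.symbol η i k * s.greenC η t k j) t := fun t i => by
    simpa only [Matrix.mul_apply] using s.hasDerivAt_greenC η t i j
  have h1 : ((Real.sqrt (-s.pv) : ℝ) : ℂ) * (Real.sqrt (-s.pv) : ℝ) = -s.pv := by
    rw [← Complex.ofReal_mul, Real.mul_self_sqrt (by linarith [hs.pv_neg])]
    simp
  have h2 : ((Real.sqrt (s.p * s.pe) : ℝ) : ℂ) * (Real.sqrt (s.p * s.pe) : ℝ) = s.p * s.pe := by
    rw [← Complex.ofReal_mul, Real.mul_self_sqrt (mul_pos hs.p_pos hs.pe_pos).le]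
    simp
  have hp : (s.p : ℂ) ≠ 0 := by exact_mod_cast hs.p_pos.ne'
  have hv : (s.v : ℂ) ≠ 0 := by exact_mod_cast hs.v_pos.ne'
  refine ⟨fun t => ?_, fun t => ?_, fun t => ?_⟩
  · refine ((hd t 0).const_mul _).congr_deriv ?_
    simp [Fin.sum_univ_three, symbol, fluxJac, visc]
    ring
  · refine (hd t 1).congr_deriv ?_
    simp [Fin.sum_univ_three, symbol, fluxJac, visc]
    field_simp
    linear_combination (-s.v * Complex.I * η * s.p * s.greenC η t 0 j) * h1 +
      (s.v * Complex.I * η * (s.greenC η t 2 j - s.u * s.greenC η t 1 j)) * h2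
  · refine (((hd t 2).sub ((hd t 1).const_mul _)).const_mul _).congr_deriv ?_
    simp [Fin.sum_univ_three, symbol, fluxJac, visc]
    field_simp
    ring

/-- Transfer of an energy bound to the entries of the Green's function. -/
theorem exists_entry_bound {s : GasState} (hs : s.Regular) :
    ∃ C : ℝ, 0 < C ∧ ∀ (η : ℂ) (t : ℝ) (j : Fin 3) (D : ℝ), 0 ≤ D →
      (∀ x y z : ℝ → ℂ, IsSymmetrized (Real.sqrt (-s.pv)) (Real.sqrt (s.p * s.pe)) (s.mu / s.v)
        (s.k / s.v) η x y z → ‖x t‖ ^ 2 + ‖y t‖ ^ 2 + ‖z t‖ ^ 2 ≤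
          (‖x 0‖ ^ 2 + ‖y 0‖ ^ 2 + ‖z 0‖ ^ 2) * D ^ 2) →
      ∀ i, ‖s.greenC η t i j‖ ≤ C * D := by
  set m₁ := Real.sqrt (-s.pv) with hm1
  set m₃ := Real.sqrt (s.p * s.pe) / s.p with hm3
  have p1 : 0 < m₁ := Real.sqrt_pos.2 (by linarith [hs.pv_neg])
  have p3 : 0 < m₃ := div_pos (Real.sqrt_pos.2 (mul_pos hs.p_pos hs.pe_pos)) hs.p_pos
  set Z := m₁ + 1 + m₃ * (1 + |s.u|) with hZ
  have pZ : 0 < Z := by positivity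
  refine ⟨Z * (m₁⁻¹ + 1 + (m₃⁻¹ + |s.u|)), by positivity, fun η t j D hD h i => ?_⟩
  have h0 : ∀ i, ‖s.greenC η 0 i j‖ ≤ 1 := by
    intro i
    simp only [greenC, zero_smul, NormedSpace.exp_zero, Matrix.one_apply]
    split_ifs <;> simp
  have hb := h _ _ _ (isSymmetrized_greenC hs η j)
  rw [← hm1] at hb
  have hq : ((Real.sqrt (s.p * s.pe) : ℝ) : ℂ) / s.p = (m₃ : ℂ) := by rw [hm3]; push_cast; rfl
  rw [hq] at hb
  set w := s.greenC η t with hw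
  set w0 := s.greenC η 0 with hw0
  have hin : ‖(m₁ : ℂ) * w0 0 j‖ ^ 2 + ‖w0 1 j‖ ^ 2 + ‖(m₃ : ℂ) * (w0 2 j - s.u * w0 1 j)‖ ^ 2
      ≤ Z ^ 2 := by
    have e1 : ‖(m₁ : ℂ) * w0 0 j‖ ≤ m₁ := by
      rw [norm_mul, Complex.norm_real, Real.norm_of_nonneg p1.le]
      exact mul_le_of_le_one_right p1.le (h0 0)
    have e2 : ‖(m₃ : ℂ) * (w0 2 j - s.u * w0 1 j)‖ ≤ m₃ * (1 + |s.u|) := by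
      rw [norm_mul, Complex.norm_real, Real.norm_of_nonneg p3.le]
      gcongr
      refine (norm_sub_le _ _).trans ?_
      rw [norm_mul, Complex.norm_real, Real.norm_eq_abs]
      have := mul_le_of_le_one_right (abs_nonneg s.u) (h0 1)
      linarith [h0 2]
    have := h0 1
    calc _ ≤ m₁ ^ 2 + 1 ^ 2 + (m₃ * (1 + |s.u|)) ^ 2 := by gcongr
      _ ≤ Z ^ 2 := by
        rw [hZ]
        have : 0 < m₃ * (1 + |s.u|) := by positivity
        nlinarith
  have hout : ‖(m₁ : ℂ) * w 0 j‖ ^ 2 + ‖w 1 j‖ ^ 2 + ‖(m₃ : ℂ) * (w 2 j - s.u * w 1 j)‖ ^ 2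
      ≤ (Z * D) ^ 2 := by
    rw [mul_pow]
    exact hb.trans (by gcongr)
  have hZD : 0 ≤ Z * D := by positivity
  have hle : ∀ r : ℝ, r ^ 2 ≤ (Z * D) ^ 2 → r ≤ Z * D := fun r hr =>
    (abs_le_of_sq_le_sq' hr hZD).2
  have s1 := sq_nonneg (‖(m₁ : ℂ) * w 0 j‖)
  have s2 := sq_nonneg (‖w 1 j‖)
  have s3 := sq_nonneg (‖(m₃ : ℂ) * (w 2 j - s.u * w 1 j)‖)
  have f1 := hle _ (show ‖(m₁ : ℂ) * w 0 j‖ ^ 2 ≤ (Z * D) ^ 2 by linarith)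
  have f2 := hle _ (show ‖w 1 j‖ ^ 2 ≤ (Z * D) ^ 2 by linarith)
  have f3 := hle _ (show ‖(m₃ : ℂ) * (w 2 j - s.u * w 1 j)‖ ^ 2 ≤ (Z * D) ^ 2 by linarith)
  rw [norm_mul, Complex.norm_real, Real.norm_of_nonneg p1.le] at f1
  rw [norm_mul, Complex.norm_real, Real.norm_of_nonneg p3.le] at f3
  have g1 : ‖w 0 j‖ ≤ m₁⁻¹ * (Z * D) := by
    rw [← div_eq_inv_mul, le_div_iff₀ p1]; linarith
  have g3 : ‖w 2 j‖ ≤ (m₃⁻¹ + |s.u|) * (Z * D) := by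
    have : ‖w 2 j - s.u * w 1 j‖ ≤ m₃⁻¹ * (Z * D) := by
      rw [← div_eq_inv_mul, le_div_iff₀ p3]; linarith
    calc ‖w 2 j‖ = ‖(w 2 j - s.u * w 1 j) + s.u * w 1 j‖ := by ring_nf
      _ ≤ ‖w 2 j - s.u * w 1 j‖ + |s.u| * ‖w 1 j‖ := by
        refine (norm_add_le _ _).trans ?_
        rw [norm_mul, Complex.norm_real, Real.norm_eq_abs]
      _ ≤ m₃⁻¹ * (Z * D) + |s.u| * (Z * D) := by gcongr
      _ = _ := by ring
  have k1 : 0 ≤ m₁⁻¹ * (Z * D) := by positivity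
  have k3 : 0 ≤ (m₃⁻¹ + |s.u|) * (Z * D) := by positivity
  have : Z * (m₁⁻¹ + 1 + (m₃⁻¹ + |s.u|)) * D =
    m₁⁻¹ * (Z * D) + Z * D + (m₃⁻¹ + |s.u|) * (Z * D) := by ring
  rw [this]
  fin_cases i
  · exact g1.trans (by linarith)
  · exact f2.trans (by linarith)
  · exact g3.trans (by linarith)

/-- The exponential growth of the energy in the strip `|Im η| ≤ 1`. -/
theorem exists_greenC_bound {s : GasState} (hs : s.Regular) :
    ∃ C K : ℝ, 0 < C ∧ 0 < K ∧ ∀ (η : ℂ) (t : ℝ), |η.im| ≤ 1 → 0 ≤ t → ∀ i j,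
      ‖s.greenC η t i j‖ ≤ C * Real.exp (K * t) := by
  obtain ⟨C, hC, h⟩ := exists_entry_bound hs
  have h1 : 0 < Real.sqrt (-s.pv) := Real.sqrt_pos.2 (by linarith [hs.pv_neg])
  have h2 := Real.sqrt_pos.2 (mul_pos hs.p_pos hs.pe_pos)
  have h3 := div_pos hs.mu_pos hs.v_pos
  have h4 := div_pos hs.k_pos hs.v_pos
  refine ⟨C, Real.sqrt (-s.pv) + Real.sqrt (s.p * s.pe) + s.mu / s.v + s.k / s.v, hC,
    by positivity, fun η t hη ht i j => h η t j _ (Real.exp_pos _).le (fun x y z hxyz => ?_) i⟩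
  refine (hxyz.energy_le h1 h2 h3 h4 hη ht).trans (le_of_eq ?_)
  rw [← Real.exp_nat_mul]
  push_cast
  ring_nf

/-- The decay of the Green's function at real frequencies, from the compensated energy. -/
theorem exists_greenC_decay {s : GasState} (hs : s.Regular) :
    ∃ C c : ℝ, 0 < C ∧ 0 < c ∧ ∀ (η : ℝ) (t : ℝ), 0 ≤ t → ∀ i j,
      ‖s.greenC η t i j‖ ≤ C * Real.exp (-(c * (η ^ 2 / (1 + η ^ 2))) * t) := by
  obtain ⟨C, hC, h⟩ := exists_entry_bound hs
  have h1 : 0 < Real.sqrt (-s.pv) := Real.sqrt_pos.2 (by linarith [hs.pv_neg])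
  have h2 := Real.sqrt_pos.2 (mul_pos hs.p_pos hs.pe_pos)
  have h3 := div_pos hs.mu_pos hs.v_pos
  have h4 := div_pos hs.k_pos hs.v_pos
  obtain ⟨c, hc, hdec⟩ := exists_energy_decay h1 h2 h3 h4
  refine ⟨C * 2, c / 2, by positivity, by positivity, fun η t ht i j => ?_⟩
  rw [mul_assoc]
  refine h η t j _ (by positivity) (fun x y z hxyz => ?_) i
  refine (hdec η x y z hxyz t ht).trans ?_
  rw [mul_pow, ← Real.exp_nat_mul]
  have e : ((2 : ℕ) : ℝ) * (-(c / 2 * (η ^ 2 / (1 + η ^ 2))) * t) =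
    -(c * (η ^ 2 / (1 + η ^ 2))) * t := by push_cast; ring
  rw [e]
  have : 0 ≤ (‖x 0‖ ^ 2 + ‖y 0‖ ^ 2 + ‖z 0‖ ^ 2) *
    Real.exp (-(c * (η ^ 2 / (1 + η ^ 2))) * t) := by positivity
  linarith

end GasState

/-! ### Fourier integrals and shifts of the contour -/

/-- `∫ e^{iηx} (iη)^k f(η) dη`, the `k`-th derivative in `x` of `∫ e^{iηx} f(η) dη`. -/
def fourierInt (f : ℝ → ℂ) (k : ℕ) (x : ℝ) : ℂ :=
  ∫ η : ℝ, Complex.exp (Complex.I * η * x) * ((Complex.I * η) ^ k * f η)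

theorem norm_exp_I_mul (η x : ℝ) : ‖Complex.exp (Complex.I * η * x)‖ = 1 := by
  rw [show Complex.I * η * x = ((η * x : ℝ) : ℂ) * Complex.I by push_cast; ring]
  exact Complex.norm_exp_ofReal_mul_I _

theorem hasDerivAt_fourierInt {f : ℝ → ℂ} {k : ℕ}
    (h0 : Integrable (fun η : ℝ => (Complex.I * η) ^ k * f η))
    (h1 : Integrable (fun η : ℝ => (Complex.I * η) ^ (k + 1) * f η)) (x : ℝ) :
    HasDerivAt (fourierInt f k) (fourierInt f (k + 1) x) x := by
  have hc : ∀ y : ℝ, Continuous (fun η : ℝ => Complex.exp (Complex.I * η * y)) := by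
    intro y; fun_prop
  refine (hasDerivAt_integral_of_dominated_loc_of_deriv_le (μ := volume) (s := Set.univ)
    (F := fun y η => Complex.exp (Complex.I * η * (y : ℝ)) * ((Complex.I * η) ^ k * f η))
    (F' := fun y η => Complex.exp (Complex.I * η * (y : ℝ)) * ((Complex.I * η) ^ (k + 1) * f η))
    (bound := fun η => ‖(Complex.I * η) ^ (k + 1) * f η‖) univ_mem
    (Eventually.of_forall fun y => (hc y).aestronglyMeasurable.mul h0.1) ?_
    ((hc x).aestronglyMeasurable.mul h1.1) ?_ h1.norm ?_).2
  · refine h0.norm.mono ((hc x).aestronglyMeasurable.mul h0.1) (Eventually.of_forall fun η => ?_)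
    rw [norm_mul, norm_exp_I_mul, one_mul, norm_norm]
  · refine Eventually.of_forall fun η y _ => ?_
    rw [norm_mul, norm_exp_I_mul, one_mul]
  · refine Eventually.of_forall fun η y _ => ?_
    have := (((hasDerivAt_id (y : ℂ)).const_mul (Complex.I * η)).cexp.comp_ofReal).mul_const
      ((Complex.I * η) ^ k * f η)
    refine this.congr_deriv ?_
    simp only [id, mul_one]
    ring

theorem iteratedDeriv_fourierInt {f : ℝ → ℂ} {n : ℕ}
    (h : ∀ k ≤ n, Integrable (fun η : ℝ => (Complex.I * η) ^ k * f η)) :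
    ∀ k ≤ n, iteratedDeriv k (fourierInt f 0) = fourierInt f k := by
  intro k
  induction k with
  | zero => intro _; exact iteratedDeriv_zero
  | succ k ih =>
    intro hk
    rw [iteratedDeriv_succ, ih (by omega)]
    funext x
    exact (hasDerivAt_fourierInt (h k (by omega)) (h (k + 1) hk) x).deriv

theorem contDiff_fourierInt {f : ℝ → ℂ} {n : ℕ}
    (h : ∀ k ≤ n, Integrable (fun η : ℝ => (Complex.I * η) ^ k * f η)) :
    ContDiff ℝ n (fourierInt f 0) := by
  rw [contDiff_nat_iff_iteratedDeriv]
  refine ⟨fun k hk => ?_, fun k hk => ?_⟩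
  · rw [iteratedDeriv_fourierInt h k hk]
    refine continuous_of_dominated (fun x => ?_) (fun x => Eventually.of_forall fun η => ?_)
      (h k hk).norm (Eventually.of_forall fun η => by fun_prop)
    · exact (Continuous.aestronglyMeasurable (by fun_prop)).mul (h k hk).1
    · rw [norm_mul, norm_exp_I_mul, one_mul]
  · rw [iteratedDeriv_fourierInt h k hk.le]
    exact fun x => (hasDerivAt_fourierInt (h k hk.le) (h (k + 1) hk) x).differentiableAt

/-- If a function bounded by `D / (1 + a²)` is holomorphic in a strip, then its integral does not
change if the real line is moved inside the strip. -/
theorem integral_shift {f : ℂ → ℂ} {σ b D : ℝ} (hb : |b| < σ)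
    (hf : DifferentiableOn ℂ f {z | |z.im| < σ})
    (hD : ∀ a y : ℝ, |y| ≤ |b| → ‖f (a + y * Complex.I)‖ ≤ D / (1 + a ^ 2)) :
    Integrable (fun a : ℝ => f (a + b * Complex.I)) ∧
      ∫ a : ℝ, f a = ∫ a : ℝ, f (a + b * Complex.I) := by
  have hint : ∀ y : ℝ, |y| ≤ |b| → Integrable (fun a : ℝ => f (a + y * Complex.I)) := by
    intro y hy
    refine (integrable_inv_one_add_sq.const_mul D).mono' ?_ (Eventually.of_forall fun a => ?_)
    · refine Continuous.aestronglyMeasurable ?_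
      refine hf.continuousOn.comp_continuous (by fun_prop) fun a => ?_
      simpa using lt_of_le_of_lt hy hb
    · simpa [div_eq_mul_inv] using hD a y hy
  refine ⟨hint b le_rfl, ?_⟩
  have h0 : Integrable (fun a : ℝ => f a) := by
    simpa using hint 0 (by simp)
  have key : ∀ R : ℝ, (∫ a in -R..R, f a) - (∫ a in -R..R, f (a + b * Complex.I)) =
      Complex.I • (∫ y in (0 : ℝ)..b, f ((-R : ℝ) + y * Complex.I)) -
      Complex.I • (∫ y in (0 : ℝ)..b, f (R + y * Complex.I)) := by
    intro R
    have := Complex.integral_boundary_rect_eq_zero_of_differentiableOn f (-R : ℂ)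
      (R + b * Complex.I)
      (hf.mono ?_)
    · simp at this
      rw [← sub_eq_zero, ← this]
      push_cast
      simp
      ring
    · intro z hz
      rw [Complex.mem_reProdIm] at hz
      have h2 := hz.2
      simp at h2
      have : |z.im| ≤ |b| := by simpa using Set.abs_sub_left_of_mem_uIcc h2
      exact lt_of_le_of_lt this hb
  have hside : ∀ R : ℝ, ‖∫ y in (0 : ℝ)..b, f (R + y * Complex.I)‖ ≤ D / (1 + R ^ 2) * |b| := by
    intro R
    have := intervalIntegral.norm_integral_le_of_norm_le_const (a := 0) (b := b)
      (f := fun y : ℝ => f (R + y * Complex.I)) (C := D / (1 + R ^ 2)) (fun y hy => hD R y ?_)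
    · simpa using this
    · simpa using Set.abs_sub_left_of_mem_uIcc (Set.uIoc_subset_uIcc hy)
  have hlim : Tendsto (fun R : ℝ => D / (1 + R ^ 2) * |b|) atTop (𝓝 0) := by
    have : Tendsto (fun R : ℝ => 1 + R ^ 2) atTop atTop :=
      tendsto_atTop_add_const_left _ _ (tendsto_pow_atTop (by norm_num))
    simpa using (this.const_div_atTop D).mul_const |b|
  have l1 := (intervalIntegral_tendsto_integral h0 tendsto_neg_atTop_atBot tendsto_id).sub
    (intervalIntegral_tendsto_integral (hint b le_rfl) tendsto_neg_atTop_atBot tendsto_id)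
  have l2 : Tendsto (fun R : ℝ => (∫ a in -R..R, f a) - (∫ a in -R..R, f (a + b * Complex.I)))
      atTop (𝓝 0) := by
    simp only [key]
    have s1 : Tendsto (fun R : ℝ => ∫ y in (0 : ℝ)..b, f (R + y * Complex.I)) atTop (𝓝 0) :=
      squeeze_zero_norm hside hlim
    have s2 : Tendsto (fun R : ℝ => ∫ y in (0 : ℝ)..b, f ((-R : ℝ) + y * Complex.I)) atTop (𝓝 0) :=
      squeeze_zero_norm (fun R => by simpa using hside (-R)) hlim
    simpa using (s2.const_smul Complex.I).sub (s1.const_smul Complex.I)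
  exact sub_eq_zero.1 (tendsto_nhds_unique l1 l2)

/-- A bound for an integral over a segment of the real line, by moving the segment to the height
`b` in the complex plane. -/
theorem norm_integral_le_of_shift {f : ℂ → ℂ} {δ b S : ℝ} {g : ℝ → ℝ} (hδ : 0 ≤ δ)
    (hf : DifferentiableOn ℂ f {z | |z.re| ≤ δ ∧ |z.im| ≤ |b|})
    (hg : Integrable g) (hg0 : ∀ a, 0 ≤ g a)
    (hfg : ∀ a : ℝ, |a| ≤ δ → ‖f (a + b * Complex.I)‖ ≤ g a)
    (hS : ∀ y : ℝ, |y| ≤ |b| → 0 ≤ y * b → ‖f (δ + y * Complex.I)‖ ≤ S ∧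
      ‖f (-δ + y * Complex.I)‖ ≤ S) :
    ‖∫ a in -δ..δ, f a‖ ≤ (∫ a, g a) + 2 * |b| * S := by
  have key : (∫ a in -δ..δ, f a) = (∫ a in -δ..δ, f (a + b * Complex.I)) +
      (Complex.I • (∫ y in (0 : ℝ)..b, f (-δ + y * Complex.I)) -
      Complex.I • (∫ y in (0 : ℝ)..b, f (δ + y * Complex.I))) := by
    have := Complex.integral_boundary_rect_eq_zero_of_differentiableOn f (-δ : ℂ)
      (δ + b * Complex.I)
      (hf.mono ?_)
    · simp at this
      rw [← sub_eq_zero, ← this]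
      simp
      ring
    · intro z hz
      rw [Complex.mem_reProdIm] at hz
      obtain ⟨h1, h2⟩ := hz
      simp at h1 h2
      refine ⟨?_, by simpa using Set.abs_sub_left_of_mem_uIcc h2⟩
      rw [Set.uIcc_of_le (by linarith)] at h1
      exact abs_le.2 h1
  have hy : ∀ y ∈ Set.uIoc 0 b, |y| ≤ |b| ∧ 0 ≤ y * b := by
    intro y hy
    refine ⟨by simpa using Set.abs_sub_left_of_mem_uIcc (Set.uIoc_subset_uIcc hy), ?_⟩
    rcases Set.mem_uIoc.1 hy with h | h
    · exact mul_nonneg h.1.le (h.1.le.trans h.2)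
    · exact mul_nonneg_of_nonpos_of_nonpos h.2 (h.1.le.trans h.2)
  have s1 := intervalIntegral.norm_integral_le_of_norm_le_const (a := 0) (b := b)
    (f := fun y : ℝ => f (-δ + y * Complex.I)) (C := S)
    (fun y h => (hS y (hy y h).1 (hy y h).2).2)
  have s2 := intervalIntegral.norm_integral_le_of_norm_le_const (a := 0) (b := b)
    (f := fun y : ℝ => f (δ + y * Complex.I)) (C := S)
    (fun y h => (hS y (hy y h).1 (hy y h).2).1)
  have s3 : ‖∫ a in -δ..δ, f (a + b * Complex.I)‖ ≤ ∫ a, g a := by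
    refine (intervalIntegral.norm_integral_le_of_norm_le (g := g) (by linarith)
      (Eventually.of_forall fun a ha => hfg a (abs_le.2 ⟨ha.1.le, ha.2⟩))
      hg.intervalIntegrable).trans ?_
    rw [intervalIntegral.integral_of_le (by linarith)]
    exact setIntegral_le_integral hg (Eventually.of_forall hg0)
  rw [key]
  refine (norm_add_le _ _).trans ?_
  have := norm_sub_le (Complex.I • (∫ y in (0 : ℝ)..b, f (-δ + y * Complex.I)))
    (Complex.I • (∫ y in (0 : ℝ)..b, f (δ + y * Complex.I)))
  simp only [norm_smul, Complex.norm_I, one_mul, sub_zero] at this s1 s2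
  linarith

/-! ### Gaussian bounds -/

theorem pow_mul_exp_le (m : ℕ) {θ : ℝ} (hθ : 0 < θ) :
    ∃ C : ℝ, 0 < C ∧ ∀ r t : ℝ, 0 ≤ r → 0 < t →
      r ^ m * Real.exp (-(θ * r ^ 2 * t)) ≤ C * t ^ (-((m : ℝ) / 2)) := by
  refine ⟨1 + m.factorial / θ ^ m, by positivity, fun r t hr ht => ?_⟩
  set u := r * Real.sqrt t with hu
  have hst : 0 < Real.sqrt t := Real.sqrt_pos.2 ht
  have hu0 : 0 ≤ u := by positivity
  have e1 : θ * r ^ 2 * t = θ * u ^ 2 := by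
    rw [hu, mul_pow, Real.sq_sqrt ht.le]; ring
  have e2 : t ^ (-((m : ℝ) / 2)) = (Real.sqrt t ^ m)⁻¹ := by
    rw [Real.rpow_neg ht.le, Real.sqrt_eq_rpow, ← Real.rpow_natCast, ← Real.rpow_mul ht.le]
    ring_nf
  rw [e1, e2, Real.exp_neg, ← div_eq_mul_inv, ← div_eq_mul_inv, div_le_div_iff₀ (Real.exp_pos _)
    (by positivity), ← mul_pow, ← hu]
  have e3 : u ^ m ≤ 1 + (u ^ 2) ^ m := by
    rw [← pow_mul, mul_comm 2 m, pow_mul]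
    nlinarith [sq_nonneg (u ^ m - 1), sq_nonneg (u ^ m)]
  have e4 : (u ^ 2) ^ m ≤ m.factorial / θ ^ m * Real.exp (θ * u ^ 2) := by
    have := Real.pow_div_factorial_le_exp (θ * u ^ 2) (by positivity) m
    rw [div_le_iff₀ (by positivity), mul_pow] at this
    rw [div_mul_eq_mul_div, le_div_iff₀ (by positivity)]
    linarith
  have e5 : 1 ≤ Real.exp (θ * u ^ 2) := Real.one_le_exp (by positivity)
  nlinarith

theorem integral_exp_neg_mul_sq_mul {θ t : ℝ} (hθ : 0 < θ) (ht : 0 < t) :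
    Integrable (fun a : ℝ => Real.exp (-(θ * a ^ 2 * t))) ∧
    ∫ a : ℝ, Real.exp (-(θ * a ^ 2 * t)) = Real.sqrt (Real.pi / θ) * t ^ (-(1 : ℝ) / 2) := by
  have e : ∀ a : ℝ, Real.exp (-(θ * a ^ 2 * t)) = Real.exp (-(θ * t) * a ^ 2) := by
    intro a; ring_nf
  simp only [e]
  refine ⟨integrable_exp_neg_mul_sq (by positivity), ?_⟩
  rw [integral_gaussian, ← div_div, Real.sqrt_div (by positivity), div_eq_mul_inv]
  congr 1
  rw [Real.sqrt_eq_rpow, ← Real.rpow_neg ht.le]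
  norm_num

/-! ### The Fourier transform of the large time profile -/

theorem ofReal_iteratedDeriv {F : ℕ → ℝ → ℂ} (hF : ∀ k x, HasDerivAt (F k) (F (k + 1) x) x)
    {g : ℝ → ℝ} (hg : ∀ x, (g x : ℂ) = F 0 x) (n : ℕ) (x : ℝ) :
    ((iteratedDeriv n g x : ℝ) : ℂ) = F n x := by
  induction n generalizing x with
  | zero => simpa using hg x
  | succ n ih =>
    have h1 : HasDerivAt (iteratedDeriv n g) (F (n + 1) x).re x := by
      have := hasDerivAt_re (hF n x)
      simpa [← ih] using this
    have h2 : (F (n + 1) x).im = 0 := by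
      have h3 := hasDerivAt_im (hF n x)
      simp only [← ih, Complex.ofReal_im] at h3
      exact h3.unique (hasDerivAt_const x 0)
    rw [iteratedDeriv_succ, h1.deriv]
    exact Complex.ext (by simp) (by simp [h2])

namespace GasState

theorem Regular.alpha_pos {s : GasState} (hs : s.Regular) (j : Fin 3) : 0 < s.alpha j := by
  have h1 := hs.sq_c_pos
  have hk := hs.k_pos
  have hv := hs.v_pos
  have hmu := hs.mu_pos
  have hp := hs.p_pos
  have hpe := hs.pe_pos
  have hpv : 0 < -s.pv := by linarith [hs.pv_neg]
  have e1 : 0 < -(s.k * s.pv) / (s.v * (s.p * s.pe - s.pv)) := by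
    rw [← mul_neg]; positivity
  have e2 : 0 < (s.k * s.p * s.pe + s.mu * s.p * s.pe - s.mu * s.pv) /
      (2 * s.v * (s.p * s.pe - s.pv)) := by
    rw [sub_eq_add_neg, ← mul_neg]; positivity
  fin_cases j <;> simpa [alpha]

/-- The Fourier transform `e^{(iβ_jη - α_jη²)t}` of `gauss`. -/
def gaussHat (s : GasState) (j : Fin 3) (η : ℂ) (t : ℝ) : ℂ :=
  Complex.exp ((Complex.I * η * s.beta j + s.alpha j * (Complex.I * η) ^ 2) * t)

theorem norm_gaussHat (s : GasState) (j : Fin 3) (a y t : ℝ) :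
    ‖s.gaussHat j (a + y * Complex.I) t‖ =
      Real.exp ((-(y * s.beta j) + s.alpha j * (y ^ 2 - a ^ 2)) * t) := by
  rw [gaussHat, Complex.norm_exp]
  congr 1
  simp [pow_two]

theorem norm_gaussHat_ofReal (s : GasState) (j : Fin 3) (a t : ℝ) :
    ‖s.gaussHat j a t‖ = Real.exp (-(s.alpha j * a ^ 2 * t)) := by
  have := s.norm_gaussHat j a 0 t
  simp only [Complex.ofReal_zero, zero_mul, add_zero] at this
  rw [this]
  ring_nf

theorem integrable_gaussHat {s : GasState} (hs : s.Regular) (j : Fin 3) {t : ℝ} (ht : 0 < t)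
    (k : ℕ) : Integrable (fun η : ℝ => (Complex.I * η) ^ k * s.gaussHat j η t) := by
  have hα := hs.alpha_pos j
  obtain ⟨C, hC, h⟩ := pow_mul_exp_le k (half_pos hα)
  have hi := (integral_exp_neg_mul_sq_mul (half_pos hα) ht).1
  refine (hi.const_mul (C * t ^ (-((k : ℝ) / 2)))).mono' ?_ (Eventually.of_forall fun η => ?_)
  · unfold gaussHat
    exact Continuous.aestronglyMeasurable (by fun_prop)
  · rw [norm_mul, norm_gaussHat_ofReal, norm_pow, norm_mul, Complex.norm_I, one_mul,
      Complex.norm_real, Real.norm_eq_abs]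
    have e : Real.exp (-(s.alpha j * η ^ 2 * t)) = Real.exp (-(s.alpha j / 2 * |η| ^ 2 * t)) *
        Real.exp (-(s.alpha j / 2 * η ^ 2 * t)) := by
      rw [← Real.exp_add, sq_abs]; ring_nf
    rw [e, ← mul_assoc]
    exact mul_le_mul_of_nonneg_right (h |η| t (abs_nonneg η) ht) (Real.exp_pos _).le

theorem ofReal_gauss {s : GasState} (hs : s.Regular) (j : Fin 3) {t : ℝ} (ht : 0 < t) (x : ℝ) :
    ((s.gauss j t x : ℝ) : ℂ) =
      (2 * (Real.pi : ℂ))⁻¹ * fourierInt (fun η => s.gaussHat j η t) 0 x := by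
  have hα := hs.alpha_pos j
  have hb : 0 < ((s.alpha j * t : ℝ) : ℂ).re := by simpa using mul_pos hα ht
  have h := fourierIntegral_gaussian hb ((x + s.beta j * t : ℝ) : ℂ)
  have e1 : fourierInt (fun η => s.gaussHat j η t) 0 x = ∫ η : ℝ, Complex.exp
      (Complex.I * ((x + s.beta j * t : ℝ) : ℂ) * η) *
        Complex.exp (-((s.alpha j * t : ℝ) : ℂ) * η ^ 2) := by
    refine integral_congr_ae (Eventually.of_forall fun η => ?_)
    simp only [gaussHat, pow_zero, one_mul]
    rw [← Complex.exp_add, ← Complex.exp_add]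
    congr 1
    push_cast
    linear_combination (s.alpha j * η ^ 2 * t : ℂ) * Complex.I_sq
  have e2 : ((Real.pi : ℂ) / ((s.alpha j * t : ℝ) : ℂ)) ^ (1 / 2 : ℂ) =
      ((Real.sqrt (Real.pi / (s.alpha j * t)) : ℝ) : ℂ) := by
    rw [Real.sqrt_eq_rpow, Complex.ofReal_cpow (by positivity)]
    push_cast
    rfl
  rw [e1, h, e2, gauss]
  have e3 : Real.sqrt (Real.pi / (s.alpha j * t)) =
      Real.pi / Real.sqrt (Real.pi * s.alpha j * t) := by
    rw [eq_div_iff (by positivity), ← Real.sqrt_mul (by positivity),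
      show Real.pi / (s.alpha j * t) * (Real.pi * s.alpha j * t) = Real.pi ^ 2 by field_simp,
      Real.sqrt_sq Real.pi_pos.le]
  rw [e3]
  have hpi : (Real.pi : ℂ) ≠ 0 := by exact_mod_cast Real.pi_ne_zero
  push_cast
  rw [show (-((x : ℂ) + s.beta j * t) ^ 2 / (4 * (s.alpha j * t))) =
    -((x : ℂ) + s.beta j * t) ^ 2 / (4 * s.alpha j * t) by rw [mul_assoc]]
  generalize Complex.exp (-((x : ℂ) + s.beta j * t) ^ 2 / (4 * s.alpha j * t)) = E
  have hq : ((Real.sqrt (Real.pi * s.alpha j * t) : ℝ) : ℂ) ≠ 0 := by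
    exact_mod_cast (by positivity : Real.sqrt (Real.pi * s.alpha j * t) ≠ 0)
  field_simp

theorem ofReal_iteratedDeriv_gauss {s : GasState} (hs : s.Regular) (j : Fin 3) {t : ℝ}
    (ht : 0 < t) (n : ℕ) (x : ℝ) :
    ((iteratedDeriv n (s.gauss j t) x : ℝ) : ℂ) =
      (2 * (Real.pi : ℂ))⁻¹ * fourierInt (fun η => s.gaussHat j η t) n x :=
  ofReal_iteratedDeriv
    (F := fun n x => (2 * (Real.pi : ℂ))⁻¹ * fourierInt (fun η => s.gaussHat j η t) n x)
    (fun k x => (hasDerivAt_fourierInt (integrable_gaussHat hs j ht k)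
      (integrable_gaussHat hs j ht (k + 1)) x).const_mul _) (ofReal_gauss hs j ht) n x

/-- The Fourier transform `∑_j e^{(iβ_jη - α_jη²)t} (M_j^0 + iη M_j^1)` of the profile. -/
def profileHat (s : GasState) (a b : Fin 3) (η : ℂ) (t : ℝ) : ℂ :=
  ∑ j, s.gaussHat j η t * (s.M0 j a b + Complex.I * η * s.M1 j a b)

theorem integrable_profileHat {s : GasState} (hs : s.Regular) (a b : Fin 3) {t : ℝ} (ht : 0 < t)
    (k : ℕ) : Integrable (fun η : ℝ => (Complex.I * η) ^ k * s.profileHat a b η t) := by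
  have h : ∀ j, Integrable (fun η : ℝ => (s.M0 j a b : ℂ) * ((Complex.I * η) ^ k * s.gaussHat j η t)
      + s.M1 j a b * ((Complex.I * η) ^ (k + 1) * s.gaussHat j η t)) := fun j =>
    ((integrable_gaussHat hs j ht k).const_mul _).add
      ((integrable_gaussHat hs j ht (k + 1)).const_mul _)
  refine (integrable_finsetSum Finset.univ fun j _ => h j).congr (Eventually.of_forall fun η => ?_)
  simp only [profileHat, Finset.mul_sum]
  refine Finset.sum_congr rfl fun j _ => ?_
  ring

theorem ofReal_profile {s : GasState} (hs : s.Regular) (n : ℕ) (x : ℝ) {t : ℝ} (ht : 0 < t)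
    (a b : Fin 3) :
    ((s.profile n x t a b : ℝ) : ℂ) =
      (2 * (Real.pi : ℂ))⁻¹ * fourierInt (fun η => s.profileHat a b η t) n x := by
  have hE : ∀ (k : ℕ) j, Integrable (fun η : ℝ => Complex.exp (Complex.I * η * x) *
      ((Complex.I * η) ^ k * s.gaussHat j η t)) := by
    intro k j
    refine (integrable_gaussHat hs j ht k).norm.mono'
      ((Continuous.aestronglyMeasurable (by fun_prop)).mul (integrable_gaussHat hs j ht k).1)
      (Eventually.of_forall fun η => ?_)
    rw [norm_mul, norm_exp_I_mul, one_mul]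
  have e1 : fourierInt (fun η => s.profileHat a b η t) n x =
      ∑ j, ((s.M0 j a b : ℂ) * fourierInt (fun η => s.gaussHat j η t) n x
        + s.M1 j a b * fourierInt (fun η => s.gaussHat j η t) (n + 1) x) := by
    simp only [fourierInt]
    simp only [← integral_const_mul]
    rw [← Finset.sum_congr rfl fun j _ => integral_add ((hE n j).const_mul _)
      ((hE (n + 1) j).const_mul _), ← integral_finsetSum]
    · refine integral_congr_ae (Eventually.of_forall fun η => ?_)
      simp only [profileHat, Finset.mul_sum]
      refine Finset.sum_congr rfl fun j _ => ?_
      ring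
    · exact fun j _ => ((hE n j).const_mul _).add ((hE (n + 1) j).const_mul _)
  rw [e1, profile]
  simp only [Matrix.add_apply, Matrix.sum_apply, Matrix.smul_apply, smul_eq_mul]
  push_cast
  simp only [ofReal_iteratedDeriv_gauss hs _ ht, Finset.mul_sum, ← Finset.sum_add_distrib]
  refine Finset.sum_congr rfl fun j _ => ?_
  ring

end GasState

theorem differentiableAt_adjugate {X : ℂ → Matrix (Fin 3) (Fin 3) ℂ} {z : ℂ}
    (hX : ∀ a b, DifferentiableAt ℂ (fun w => X w a b) z) (a b : Fin 3) :
    DifferentiableAt ℂ (fun w => (X w).adjugate a b) z :=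
  (hasDerivAt_adjugate X (Matrix.of fun a b => deriv (fun w => X w a b) z) z
    (fun a b => (hX a b).hasDerivAt) a b).differentiableAt

namespace GasState

/-! ### The singular part in a strip around the real line -/

theorem re_one_add_sq_ge {b : ℝ} (η : ℂ) (hη : |η.im| ≤ b) :
    (1 - b ^ 2) * (1 + η.re ^ 2) ≤ (1 + η ^ 2).re := by
  have h1 : η.im ^ 2 ≤ b ^ 2 := by
    rw [← sq_abs]; gcongr
  simp [pow_two]
  nlinarith [mul_nonneg (sq_nonneg b) (sq_nonneg η.re)]

theorem norm_one_add_sq_ge {b : ℝ} (η : ℂ) (hη : |η.im| ≤ b) :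
    (1 - b ^ 2) * (1 + η.re ^ 2) ≤ ‖1 + η ^ 2‖ :=
  (re_one_add_sq_ge η hη).trans (Complex.re_le_norm _)

theorem one_add_sq_ne_zero {η : ℂ} (hη : |η.im| < 1) : 1 + η ^ 2 ≠ 0 := by
  intro h
  have := norm_one_add_sq_ge η le_rfl
  rw [h, norm_zero, sq_abs] at this
  have h1 : η.im ^ 2 < 1 := by
    rw [← sq_abs, sq_lt_one_iff₀ (abs_nonneg _)]; exact hη
  nlinarith [sq_nonneg η.re]

/-- `λ*_j` in powers of `w = 1 / (1 + η²)`, with the terms from the order `w³` on collected. -/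
theorem lamStar_eq (s : GasState) (Kc : Fin 3 → ℝ) (j : Fin 3) (η : ℂ) (hη : |η.im| < 1) :
    s.lamStar Kc j η = ((-s.alphaStar j : ℝ) : ℂ) / (1 / (1 + η ^ 2))
      + ((s.alphaStar j + s.betaStar j : ℝ) : ℂ) + s.A j 0 * (1 / (1 + η ^ 2))
      + s.A j 1 * (1 / (1 + η ^ 2)) ^ 2
      + (s.A j 2 - Kc j * (1 / (1 + η ^ 2))) * (1 / (1 + η ^ 2)) ^ 3 := by
  have h := one_add_sq_ne_zero hη
  simp only [lamStar, Fin.sum_univ_three]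
  simp
  field_simp
  ring

theorem differentiableAt_lamStar (s : GasState) (Kc : Fin 3 → ℝ) (j : Fin 3) {η : ℂ}
    (hη : |η.im| < 1) : DifferentiableAt ℂ (s.lamStar Kc j) η := by
  have h := one_add_sq_ne_zero hη
  unfold lamStar
  simp only [Fin.sum_univ_three]
  refine DifferentiableAt.sub (DifferentiableAt.add (by fun_prop) ?_) ?_
  · refine DifferentiableAt.add (DifferentiableAt.add ?_ ?_) ?_ <;>
      exact (differentiableAt_const _).div (by fun_prop) (pow_ne_zero _ h)
  · exact (differentiableAt_const _).div (by fun_prop) (pow_ne_zero _ h)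

theorem norm_inv_one_add_sq_le {b : ℝ} (hb0 : 0 ≤ b) (hb : b < 1) {η : ℂ} (hη : |η.im| ≤ b) :
    ‖1 / (1 + η ^ 2)‖ ≤ 1 / ((1 - b ^ 2) * (1 + η.re ^ 2)) := by
  have hκ : 0 < 1 - b ^ 2 := by nlinarith
  rw [norm_div, norm_one]
  exact one_div_le_one_div_of_le (by positivity) (norm_one_add_sq_ge η hη)

theorem norm_inv_one_add_sq_le' {b : ℝ} (hb0 : 0 ≤ b) (hb : b < 1) {η : ℂ} (hη : |η.im| ≤ b) :
    ‖1 / (1 + η ^ 2)‖ ≤ 1 / (1 - b ^ 2) := by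
  have hκ : 0 < 1 - b ^ 2 := by nlinarith
  refine (norm_inv_one_add_sq_le hb0 hb hη).trans (one_div_le_one_div_of_le hκ ?_)
  nlinarith [mul_nonneg hκ.le (sq_nonneg η.re)]

/-- The `λ*_j` solve the characteristic equation up to `O(η⁻²)`. -/
theorem exists_dispersion_lamStar_bound {s : GasState} (hs : s.Regular) (Kc : Fin 3 → ℝ) {b : ℝ}
    (hb0 : 0 ≤ b) (hb : b < 1) :
    ∃ C : ℝ, 0 < C ∧ ∀ j (η : ℂ), |η.im| ≤ b →
      ‖s.dispersion (s.lamStar Kc j η) (η ^ 2)‖ ≤ C / (1 + η.re ^ 2) := by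
  have hκ : 0 < 1 - b ^ 2 := by nlinarith
  have hmk : s.mu - s.k ≠ 0 := by linarith [hs.mu_lt_k] |> fun h : s.mu - s.k < 0 => h.ne
  have h := fun j => s.exists_dispersion_bound (-s.alphaStar j) (s.alphaStar j + s.betaStar j)
    (s.A j 0) (s.A j 1) (|s.A j 2| + |Kc j| * (1 / (1 - b ^ 2))) (1 / (1 - b ^ 2))
    (s.singular_coeff_order_zero j)
    (s.singular_coeff_order_one hs.v_pos.ne' hs.mu_pos.ne' hmk j)
    (s.singular_coeff_order_two hs.v_pos.ne' hs.mu_pos.ne' hs.k_pos.ne' hmk j)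
    (s.singular_coeff_order_three hs.v_pos.ne' hs.mu_pos.ne' hs.k_pos.ne' hmk j)
  choose C hC using h
  refine ⟨(1 + ∑ j, |C j|) / (1 - b ^ 2), by positivity, fun j η hη => ?_⟩
  have hη1 : |η.im| < 1 := lt_of_le_of_lt hη hb
  have hne := one_add_sq_ne_zero hη1
  have h1 := hC j (1 / (1 + η ^ 2)) (s.A j 2 - Kc j * (1 / (1 + η ^ 2))) (one_div_ne_zero hne)
    (norm_inv_one_add_sq_le' hb0 hb hη) ?_
  · rw [one_div_one_div, add_sub_cancel_left] at h1
    rw [s.lamStar_eq Kc j η hη1]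
    refine h1.trans ?_
    have h2 : C j ≤ 1 + ∑ j, |C j| := by
      have := Finset.single_le_sum (f := fun j => |C j|) (fun i _ => abs_nonneg _)
        (Finset.mem_univ j)
      linarith [le_abs_self (C j)]
    calc C j * ‖1 / (1 + η ^ 2)‖ ≤ (1 + ∑ j, |C j|) * (1 / ((1 - b ^ 2) * (1 + η.re ^ 2))) :=
          mul_le_mul h2 (norm_inv_one_add_sq_le hb0 hb hη) (norm_nonneg _) (by positivity)
      _ = _ := by field_simp
  · refine (norm_sub_le _ _).trans ?_
    rw [norm_mul, Complex.norm_real, Complex.norm_real, Real.norm_eq_abs, Real.norm_eq_abs]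
    gcongr
    exact norm_inv_one_add_sq_le' hb0 hb hη

theorem alphaStar_injective {s : GasState} (hs : s.Regular) : Function.Injective s.alphaStar := by
  have hv := hs.v_pos
  have h1 : 0 < s.mu / s.v := div_pos hs.mu_pos hs.v_pos
  have h2 : s.mu / s.v < s.k / s.v := by have := hs.mu_lt_k; gcongr
  intro i j hij
  fin_cases i <;> fin_cases j <;> simp [alphaStar] at hij ⊢ <;> exfalso <;>
    first
    | exact h2.ne hij
    | exact h2.ne hij.symm
    | (rcases hij with h | h
       · linarith [hs.mu_pos, hs.mu_lt_k]
       · linarith)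
    | linarith

theorem exists_lamStar_sub_bound {s : GasState} (hs : s.Regular) (Kc : Fin 3 → ℝ) {b σ1 : ℝ}
    (hb0 : 0 ≤ b) (hb : b < 1) (hσ1 : 0 < σ1) {σ : ℝ} (hbσ : b < σ)
    (hsep : ∀ η : ℂ, |η.im| < σ → ∀ i j, i ≠ j →
      σ1 ≤ |(s.lamStar Kc i η - s.lamStar Kc j η).re|) :
    ∃ c : ℝ, 0 < c ∧ ∀ (η : ℂ), |η.im| ≤ b → ∀ i j, i ≠ j →
      c * (1 + η.re ^ 2) ≤ ‖s.lamStar Kc i η - s.lamStar Kc j η‖ := by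
  have hκ : 0 < 1 - b ^ 2 := by nlinarith
  set W := 1 / (1 - b ^ 2) with hW
  have hW0 : 0 < W := by positivity
  let G : Fin 3 → ℝ := fun j => |s.alphaStar j + s.betaStar j| + |s.A j 0| * W + |s.A j 1| * W ^ 2 +
    (|s.A j 2| + |Kc j| * W) * W ^ 3
  have hG0 : ∀ j, 0 ≤ G j := fun j => by positivity
  have hG : ∀ j (η : ℂ), |η.im| ≤ b →
      ‖s.lamStar Kc j η + s.alphaStar j * (1 + η ^ 2)‖ ≤ G j := by
    intro j η hη
    have hw := norm_inv_one_add_sq_le' hb0 hb hη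
    rw [← hW] at hw
    have e : s.lamStar Kc j η + s.alphaStar j * (1 + η ^ 2) =
        ((s.alphaStar j + s.betaStar j : ℝ) : ℂ) + s.A j 0 * (1 / (1 + η ^ 2))
        + s.A j 1 * (1 / (1 + η ^ 2)) ^ 2
        + (s.A j 2 - Kc j * (1 / (1 + η ^ 2))) * (1 / (1 + η ^ 2)) ^ 3 := by
      rw [s.lamStar_eq Kc j η (lt_of_le_of_lt hη hb),
        show ((-s.alphaStar j : ℝ) : ℂ) / (1 / (1 + η ^ 2)) = -(s.alphaStar j * (1 + η ^ 2)) by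
          rw [div_div_eq_mul_div, div_one]; push_cast; ring]
      ring
    rw [e]
    generalize 1 / (1 + η ^ 2) = w at hw
    calc _ ≤ ‖((s.alphaStar j + s.betaStar j : ℝ) : ℂ)‖ + ‖(s.A j 0 : ℂ) * w‖
          + ‖(s.A j 1 : ℂ) * w ^ 2‖ + ‖((s.A j 2 : ℂ) - Kc j * w) * w ^ 3‖ := by
          refine (norm_add_le _ _).trans ?_
          gcongr
          refine (norm_add_le _ _).trans ?_
          gcongr
          exact norm_add_le _ _
      _ ≤ G j := by
          simp only [norm_mul, norm_pow, Complex.norm_real, Real.norm_eq_abs, G]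
          gcongr
          refine (norm_sub_le _ _).trans ?_
          simp only [norm_mul, Complex.norm_real, Real.norm_eq_abs]
          gcongr
  have hpos : ∀ i j, i ≠ j → 0 < |s.alphaStar j - s.alphaStar i| := fun i j hij =>
    abs_pos.2 (sub_ne_zero.2 ((alphaStar_injective hs).ne hij.symm))
  have main : ∀ i j, i ≠ j → ∃ c : ℝ, 0 < c ∧ ∀ (η : ℂ), |η.im| ≤ b →
      c * (1 + η.re ^ 2) ≤ ‖s.lamStar Kc i η - s.lamStar Kc j η‖ := by
    intro i j hij
    have hd := hpos i j hij
    have hGij : 0 ≤ G i + G j := add_nonneg (hG0 i) (hG0 j)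
    refine ⟨|s.alphaStar j - s.alphaStar i| * (1 - b ^ 2) / (1 + (G i + G j) / σ1), by positivity,
      fun η hη => ?_⟩
    have h1 : σ1 ≤ ‖s.lamStar Kc i η - s.lamStar Kc j η‖ :=
      (hsep η (lt_of_le_of_lt hη hbσ) i j hij).trans (Complex.abs_re_le_norm _)
    have h2 : |s.alphaStar j - s.alphaStar i| * ((1 - b ^ 2) * (1 + η.re ^ 2)) ≤
        ‖s.lamStar Kc i η - s.lamStar Kc j η‖ + (G i + G j) := by
      calc _ ≤ |s.alphaStar j - s.alphaStar i| * ‖1 + η ^ 2‖ := by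
            gcongr; exact norm_one_add_sq_ge η hη
        _ = ‖((s.alphaStar j - s.alphaStar i : ℝ) : ℂ) * (1 + η ^ 2)‖ := by
            rw [norm_mul, Complex.norm_real, Real.norm_eq_abs]
        _ = ‖(s.lamStar Kc i η - s.lamStar Kc j η) -
            (s.lamStar Kc i η + s.alphaStar i * (1 + η ^ 2)) +
            (s.lamStar Kc j η + s.alphaStar j * (1 + η ^ 2))‖ := by
            congr 1; push_cast; ring
        _ ≤ _ := by
            refine (norm_add_le _ _).trans ?_
            have := norm_sub_le (s.lamStar Kc i η - s.lamStar Kc j η)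
              (s.lamStar Kc i η + s.alphaStar i * (1 + η ^ 2))
            linarith [hG i η hη, hG j η hη]
    rw [div_mul_eq_mul_div, div_le_iff₀ (by positivity)]
    have h3 : G i + G j ≤ ‖s.lamStar Kc i η - s.lamStar Kc j η‖ * ((G i + G j) / σ1) := by
      calc G i + G j = σ1 * ((G i + G j) / σ1) := by field_simp
        _ ≤ _ := by gcongr
    linarith
  choose! c hc hc' using main
  obtain ⟨m, hm, hm'⟩ : ∃ m : ℝ, 0 < m ∧ ∀ i j, i ≠ j → m ≤ c i j := by
    refine ⟨min (min (c 0 1) (c 0 2)) (min (min (c 1 0) (c 1 2)) (min (c 2 0) (c 2 1))), ?_, ?_⟩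
    · simp only [lt_min_iff]
      refine ⟨⟨?_, ?_⟩, ⟨?_, ?_⟩, ?_, ?_⟩ <;> exact hc _ _ (by decide)
    · intro i j hij
      fin_cases i <;> fin_cases j <;> simp at hij ⊢
  refine ⟨m, hm, fun η hη i j hij => le_trans ?_ (hc' i j hij η hη)⟩
  have := hm' i j hij
  gcongr

theorem lamStar_injective (s : GasState) (Kc : Fin 3 → ℝ) {η : ℂ} {σ1 : ℝ} (hσ1 : 0 < σ1)
    (hsep : ∀ i j, i ≠ j → σ1 ≤ |(s.lamStar Kc i η - s.lamStar Kc j η).re|) :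
    Function.Injective (fun j => s.lamStar Kc j η) := by
  intro i j hij
  by_contra hne
  have := hsep i j hne
  simp only at hij
  rw [hij] at this
  simp at this
  linarith

/-- The Fourier transform of the singular part, continued to complex frequencies. -/
def singC (s : GasState) (Kc : Fin 3 → ℝ) (η : ℂ) (t : ℝ) : Matrix (Fin 3) (Fin 3) ℂ :=
  spectralSum (s.symbol η) (fun j => s.lamStar Kc j η) t

theorem singC_apply (s : GasState) (Kc : Fin 3 → ℝ) (η : ℂ) (t : ℝ) (a b : Fin 3) :
    s.singC Kc η t a b = ∑ j, Complex.exp (s.lamStar Kc j η * t) * s.MhatStar Kc j η a b := by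
  simp only [singC, spectralSum, MhatStar, Matrix.sum_apply, Matrix.smul_apply, smul_eq_mul]

/-- The Fourier transform of the regular part, continued to complex frequencies. -/
def regC (s : GasState) (Kc : Fin 3 → ℝ) (η : ℂ) (t : ℝ) : Matrix (Fin 3) (Fin 3) ℂ :=
  s.greenC η t - s.singC Kc η t

theorem regHat_eq (s : GasState) (Kc : Fin 3 → ℝ) (η t : ℝ) :
    s.regHat Kc η t = s.regC Kc η t := rfl

/-- The conditions of admissibility, for given widths and gaps. -/
structure Gap (s : GasState) (Kc : Fin 3 → ℝ) (σ σs σ1 : ℝ) : Prop where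
  pos : 0 < σ
  lt_one : σ < 1
  decay_pos : 0 < σs
  sep_pos : 0 < σ1
  decay : ∀ η : ℂ, |η.im| < σ →
    ∀ j, (s.lamStar Kc j η + (s.alphaStar j : ℂ) / 2 * (η ^ 2 + 1)).re < -σs
  sep : ∀ η : ℂ, |η.im| < σ →
    ∀ i j, i ≠ j → σ1 ≤ |(s.lamStar Kc i η - s.lamStar Kc j η).re|

theorem Admissible.exists_gap {s : GasState} {Kc : Fin 3 → ℝ} (h : s.Admissible Kc) :
    ∃ σ σs σ1 : ℝ, s.Gap Kc σ σs σ1 := by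
  obtain ⟨-, σ, σs, σ1, h1, h2, h3, h4, h5⟩ := h
  exact ⟨σ, σs, σ1, h1, h2, h3, h4, fun η hη => (h5 η hη).1, fun η hη => (h5 η hη).2⟩

theorem alphaStar_nonneg {s : GasState} (hs : s.Regular) (j : Fin 3) : 0 ≤ s.alphaStar j := by
  have h1 := div_pos hs.mu_pos hs.v_pos
  have h2 := div_pos hs.k_pos hs.v_pos
  fin_cases j <;> simp [alphaStar] <;> linarith

namespace Gap

variable {s : GasState} {Kc : Fin 3 → ℝ} {σ σs σ1 : ℝ}

theorem injective (hg : s.Gap Kc σ σs σ1) {η : ℂ} (hη : |η.im| < σ) :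
    Function.Injective (fun j => s.lamStar Kc j η) :=
  s.lamStar_injective Kc hg.sep_pos (hg.sep η hη)

theorem norm_exp_le (hg : s.Gap Kc σ σs σ1) (hs : s.Regular) {η : ℂ} (hη : |η.im| < σ) (j : Fin 3)
    {t : ℝ} (ht : 0 ≤ t) : ‖Complex.exp (s.lamStar Kc j η * t)‖ ≤ Real.exp (-(σs * t)) := by
  rw [Complex.norm_exp, Real.exp_le_exp]
  have h1 := hg.decay η hη j
  have h2 := re_one_add_sq_ge η le_rfl
  have h3 : |η.im| ^ 2 < 1 := by
    rw [sq_lt_one_iff₀ (abs_nonneg _)]; exact hη.trans hg.lt_one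
  have h4 : 0 ≤ (1 + η ^ 2).re := by
    refine le_trans ?_ h2
    have : 0 < 1 - |η.im| ^ 2 := by linarith
    positivity
  have h5 : (s.lamStar Kc j η + (s.alphaStar j : ℂ) / 2 * (η ^ 2 + 1)).re =
      (s.lamStar Kc j η).re + s.alphaStar j / 2 * (1 + η ^ 2).re := by
    rw [show (s.alphaStar j : ℂ) / 2 * (η ^ 2 + 1) = ((s.alphaStar j / 2 : ℝ) : ℂ) * (1 + η ^ 2) by
      push_cast; ring, Complex.add_re, Complex.re_ofReal_mul]
  have h6 : 0 ≤ s.alphaStar j / 2 * (1 + η ^ 2).re :=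
    mul_nonneg (by linarith [alphaStar_nonneg hs j]) h4
  have h7 : (s.lamStar Kc j η * t).re = (s.lamStar Kc j η).re * t := by simp
  rw [h7]
  nlinarith

theorem differentiableAt_MhatStar (hg : s.Gap Kc σ σs σ1) {η : ℂ} (hη : |η.im| < σ)
    (j a b : Fin 3) : DifferentiableAt ℂ (fun η => s.MhatStar Kc j η a b) η := by
  have hl := fun j => s.differentiableAt_lamStar Kc j (hη.trans hg.lt_one)
  simp only [MhatStar, Matrix.smul_apply, smul_eq_mul]
  refine DifferentiableAt.mul ?_ ?_
  · refine DifferentiableAt.fun_inv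
      (DifferentiableAt.fun_finsetProd fun k _ => (hl j).sub (hl k)) ?_
    refine Finset.prod_ne_zero_iff.2 fun k hk => sub_ne_zero.2 fun h => ?_
    exact (Finset.ne_of_mem_erase hk) (hg.injective hη h).symm
  · refine differentiableAt_adjugate (fun c d => ?_) a b
    simp only [Matrix.sub_apply, Matrix.smul_apply, smul_eq_mul, symbol, Matrix.neg_apply]
    exact ((hl j).mul_const _).sub (by fun_prop)

theorem differentiableOn_singC (hg : s.Gap Kc σ σs σ1) (t : ℝ) (a b : Fin 3) :
    DifferentiableOn ℂ (fun η => s.singC Kc η t a b) {z | |z.im| < σ} := by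
  intro η hη
  refine DifferentiableAt.differentiableWithinAt ?_
  have hl := fun j => s.differentiableAt_lamStar Kc j (lt_trans hη hg.lt_one)
  simp only [singC_apply]
  exact DifferentiableAt.fun_sum fun j _ =>
    ((hl j).mul_const _).cexp.mul (hg.differentiableAt_MhatStar hη j a b)

theorem differentiableOn_regC (hg : s.Gap Kc σ σs σ1) (t : ℝ) (a b : Fin 3) :
    DifferentiableOn ℂ (fun η => s.regC Kc η t a b) {z | |z.im| < σ} :=
  (s.differentiable_greenC t a b).differentiableOn.sub (hg.differentiableOn_singC t a b)

/-- Duhamel's principle for the regular part: the approximate eigenvalues leave a remainder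
`O((1 + η²)⁻³)`. -/
theorem exists_regC_le (hg : s.Gap Kc σ σs σ1) (hs : s.Regular) {b : ℝ} (hb0 : 0 ≤ b)
    (hb : b < σ) :
    ∃ C : ℝ, 0 < C ∧ ∀ (η : ℂ) (t D : ℝ), |η.im| ≤ b → 0 ≤ t → ∀ i j,
      (∀ τ, 0 ≤ τ → τ ≤ t → Real.exp (-(σs * τ)) * ‖s.greenC η (t - τ) i j‖ ≤ D) →
      ‖s.regC Kc η t i j‖ ≤ C * t * D / (1 + η.re ^ 2) ^ 3 := by
  obtain ⟨C, hC, hdisp⟩ := exists_dispersion_lamStar_bound hs Kc hb0 (hb.trans hg.lt_one)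
  obtain ⟨c, hc, hsub⟩ := exists_lamStar_sub_bound hs Kc hb0 (hb.trans hg.lt_one) hg.sep_pos hb
    hg.sep
  refine ⟨3 * (C / c ^ 2), by positivity, fun η t D hη ht i j hD => ?_⟩
  have hησ : |η.im| < σ := lt_of_le_of_lt hη hb
  set X := 1 + η.re ^ 2 with hX
  have hX0 : 0 < X := by positivity
  have hprod : ∀ j : Fin 3, c ^ 2 * X ^ 2 ≤
      ‖∏ k ∈ Finset.univ.erase j, (s.lamStar Kc j η - s.lamStar Kc k η)‖ := by
    intro j
    rw [norm_prod]
    have : c ^ 2 * X ^ 2 = ∏ k ∈ Finset.univ.erase j, c * X := by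
      rw [Finset.prod_const, Finset.card_erase_of_mem (Finset.mem_univ j), Finset.card_univ,
        Fintype.card_fin]
      ring
    rw [this]
    refine Finset.prod_le_prod (fun _ _ => by positivity) fun k hk => ?_
    exact hsub η hη j k (Finset.ne_of_mem_erase hk).symm
  have hρ : ∀ τ : ℝ, 0 ≤ τ → ‖∑ j, Complex.exp (s.lamStar Kc j η * τ) *
        ((∏ k ∈ Finset.univ.erase j, (s.lamStar Kc j η - s.lamStar Kc k η))⁻¹ *
          (s.lamStar Kc j η • (1 : Matrix (Fin 3) (Fin 3) ℂ) - s.symbol η).det)‖ ≤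
      3 * (C / c ^ 2) / X ^ 3 * Real.exp (-(σs * τ)) := by
    intro τ hτ
    have h1 : ∀ j : Fin 3, ‖Complex.exp (s.lamStar Kc j η * τ) *
        ((∏ k ∈ Finset.univ.erase j, (s.lamStar Kc j η - s.lamStar Kc k η))⁻¹ *
          (s.lamStar Kc j η • (1 : Matrix (Fin 3) (Fin 3) ℂ) - s.symbol η).det)‖ ≤
        C / c ^ 2 / X ^ 3 * Real.exp (-(σs * τ)) := by
      intro j
      rw [norm_mul, norm_mul, norm_inv, s.det_sub_symbol hs.v_pos.ne', mul_comm]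
      gcongr
      · calc _ ≤ (c ^ 2 * X ^ 2)⁻¹ * (C / X) := by
              gcongr
              · exact hprod j
              · exact hdisp j η hη
          _ = _ := by field_simp
      · exact hg.norm_exp_le hs hησ j hτ
    refine (norm_sum_le _ _).trans ((Finset.sum_le_sum fun j _ => h1 j).trans (le_of_eq ?_))
    rw [Finset.sum_const, Finset.card_univ, Fintype.card_fin, nsmul_eq_mul]
    push_cast
    ring
  have h := norm_sub_exp_le (s.symbol η) (spectralSum (s.symbol η) fun j => s.lamStar Kc j η)
    _ (spectralSum_zero _ _ (hg.injective hησ)) (hasDerivAt_spectralSum _ _) t ht i j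
    (3 * (C / c ^ 2) / X ^ 3 * D) (fun τ h1 h2 => ?_)
  · rw [norm_sub_rev] at h
    refine h.trans (le_of_eq ?_)
    ring
  · calc _ ≤ 3 * (C / c ^ 2) / X ^ 3 * Real.exp (-(σs * τ)) * ‖s.greenC η (t - τ) i j‖ := by
          gcongr
          · exact hρ τ h1
          · rfl
      _ = 3 * (C / c ^ 2) / X ^ 3 * (Real.exp (-(σs * τ)) * ‖s.greenC η (t - τ) i j‖) := by ring
      _ ≤ _ := by
          gcongr
          exact hD τ h1 h2

/-- The remainder of Duhamel's principle against the exponential growth of `greenC` in the strip. -/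
theorem exists_regC_strip_bound (hg : s.Gap Kc σ σs σ1) (hs : s.Regular) {b : ℝ} (hb0 : 0 ≤ b)
    (hb : b < σ) :
    ∃ C K : ℝ, 0 < C ∧ 0 < K ∧ ∀ (η : ℂ) (t : ℝ), |η.im| ≤ b → 0 ≤ t → ∀ i j,
      ‖s.regC Kc η t i j‖ ≤ C * t * Real.exp (K * t) / (1 + η.re ^ 2) ^ 3 := by
  obtain ⟨C, hC, h⟩ := hg.exists_regC_le hs hb0 hb
  obtain ⟨C', K, hC', hK, h'⟩ := exists_greenC_bound hs
  refine ⟨C * C', K, by positivity, hK, fun η t hη ht i j => ?_⟩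
  refine (h η t (C' * Real.exp (K * t)) hη ht i j fun τ h1 h2 => ?_).trans (le_of_eq ?_)
  · calc _ ≤ 1 * (C' * Real.exp (K * (t - τ))) := by
          gcongr
          · rw [Real.exp_le_one_iff]
            nlinarith [hg.decay_pos]
          · exact h' η (t - τ) (hη.trans (hb.trans hg.lt_one).le) (by linarith) i j
      _ ≤ _ := by
          rw [one_mul]
          gcongr
          linarith
  · ring

/-- On the real line away from the origin, the Green's function and the exponentials `e^{λ*_j t}`
both decay, hence so does the difference. -/
theorem exists_regC_decay (hg : s.Gap Kc σ σs σ1) (hs : s.Regular) {δ : ℝ} (hδ : 0 < δ) :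
    ∃ C c : ℝ, 0 < C ∧ 0 < c ∧ ∀ η t : ℝ, δ ≤ |η| → 0 ≤ t → ∀ i j,
      ‖s.regC Kc η t i j‖ ≤ C * t * Real.exp (-(c * t)) / (1 + η ^ 2) ^ 3 := by
  obtain ⟨C, hC, h⟩ := hg.exists_regC_le hs le_rfl hg.pos
  obtain ⟨C', c, hC', hc, h'⟩ := exists_greenC_decay hs
  set m := min σs (c * (δ ^ 2 / (1 + δ ^ 2))) with hm
  have hm0 : 0 < m := lt_min hg.decay_pos (by positivity)
  refine ⟨C * C', m, by positivity, hm0, fun η t hη ht i j => ?_⟩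
  refine (h η t (C' * Real.exp (-(m * t))) (by simp) ht i j fun τ h1 h2 => ?_).trans (le_of_eq ?_)
  · have hq : δ ^ 2 / (1 + δ ^ 2) ≤ η ^ 2 / (1 + η ^ 2) := by
      have : δ ^ 2 ≤ η ^ 2 := by rw [← sq_abs η]; gcongr
      rw [div_le_div_iff₀ (by positivity) (by positivity)]
      nlinarith
    have hq' : m ≤ c * (η ^ 2 / (1 + η ^ 2)) :=
      (min_le_right _ _).trans (by gcongr)
    calc _ ≤ Real.exp (-(m * τ)) * (C' * Real.exp (-(m * (t - τ)))) := by
          gcongr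
          · exact min_le_left _ _
          · refine (h' η (t - τ) (by linarith) i j).trans ?_
            gcongr
            rw [neg_mul, neg_le_neg_iff]
            have : 0 ≤ t - τ := by linarith
            gcongr
      _ = _ := by
          rw [mul_left_comm, ← Real.exp_add]
          ring_nf
  · simp
    ring

theorem exists_singC_bound (hg : s.Gap Kc σ σs σ1) (hs : s.Regular) (δ : ℝ) :
    ∃ C : ℝ, 0 < C ∧ ∀ η t : ℝ, |η| ≤ δ → 0 ≤ t → ∀ i j,
      ‖s.singC Kc η t i j‖ ≤ C * Real.exp (-(σs * t)) := by
  have h : ∀ k i j, ∃ C : ℝ, ∀ η ∈ Set.Icc (-δ) δ, ‖s.MhatStar Kc k (η : ℝ) i j‖ ≤ C := by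
    intro k i j
    refine isCompact_Icc.exists_bound_of_continuousOn (Continuous.continuousOn ?_)
    refine continuous_iff_continuousAt.2 fun η => ?_
    exact ContinuousAt.comp (f := fun η : ℝ => (η : ℂ))
      (hg.differentiableAt_MhatStar (by simpa using hg.pos) k i j).continuousAt
      Complex.continuous_ofReal.continuousAt
  choose C hC using h
  refine ⟨1 + ∑ k, ∑ i, ∑ j, |C k i j|, by positivity, fun η t hη ht i j => ?_⟩
  rw [singC_apply]
  have h1 : ∀ k, ‖s.MhatStar Kc k η i j‖ ≤ ∑ i, ∑ j, |C k i j| := by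
    intro k
    refine (hC k i j η (abs_le.1 hη)).trans ((le_abs_self _).trans ?_)
    refine (Finset.single_le_sum (f := fun j => |C k i j|) (fun _ _ => abs_nonneg _)
      (Finset.mem_univ j)).trans ?_
    exact Finset.single_le_sum (f := fun i => ∑ j, |C k i j|)
      (fun _ _ => Finset.sum_nonneg fun _ _ => abs_nonneg _) (Finset.mem_univ i)
  calc _ ≤ ∑ k, Real.exp (-(σs * t)) * ∑ i, ∑ j, |C k i j| := by
        refine (norm_sum_le _ _).trans (Finset.sum_le_sum fun k _ => ?_)
        rw [norm_mul]
        gcongr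
        · exact hg.norm_exp_le hs (by simpa using hg.pos) k ht
        · exact h1 k
    _ ≤ _ := by
        rw [← Finset.mul_sum, mul_comm]
        gcongr
        linarith

end Gap

/-! ### Existence of admissible constants -/

/-- For large `N`, the growth of `d X` for large `X` and that of `N / X⁴` for bounded `X` together
beat the constant `G`. -/
theorem exists_large_const {d G : ℝ} (hd : 0 < d) (hG : 0 ≤ G) :
    ∃ N : ℝ, 0 < N ∧ ∀ X : ℝ, 1 ≤ X → 1 ≤ d * X - G + N * (1 / (32 * X ^ 4)) := by
  refine ⟨(G + 1) * (32 * ((G + 1) / d) ^ 4), by positivity, fun X hX => ?_⟩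
  by_cases h : G + 1 ≤ d * X
  · have : 0 ≤ (G + 1) * (32 * ((G + 1) / d) ^ 4) * (1 / (32 * X ^ 4)) := by positivity
    linarith
  · have h1 : X ≤ (G + 1) / d := by rw [le_div_iff₀ hd]; linarith
    have h2 : G + 1 ≤ (G + 1) * (32 * ((G + 1) / d) ^ 4) * (1 / (32 * X ^ 4)) := by
      rw [mul_one_div, le_div_iff₀ (by positivity)]
      gcongr
    have : 0 < d * X := by positivity
    linarith

/-- In a narrow strip, `(1 + η²)⁻⁴` stays in a sector around the positive axis. -/
theorem re_inv_pow_four_ge (η : ℂ) (hη : |η.im| < 1 / 8) :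
    1 / (32 * (1 + η.re ^ 2) ^ 4) ≤ ((1 / (1 + η ^ 2)) ^ 4).re := by
  have hne := one_add_sq_ne_zero (hη.trans (by norm_num))
  have hre : (1 + η ^ 2).re = 1 + (η.re ^ 2 - η.im ^ 2) := by simp [pow_two]
  have him : (1 + η ^ 2).im = 2 * η.re * η.im := by simp [pow_two]; ring
  obtain ⟨a, y⟩ := η
  simp only at hη hre him ⊢
  obtain ⟨h1, h2⟩ := abs_lt.1 hη
  have hy : y ^ 2 ≤ 1 / 64 := by nlinarith
  generalize (1 + (⟨a, y⟩ : ℂ) ^ 2) = P at *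
  obtain ⟨X, Y⟩ := P
  simp only at hre him
  have hX : 63 / 64 * (1 + a ^ 2) ≤ X := by nlinarith [sq_nonneg a]
  have hXu : X ≤ 1 + a ^ 2 := by nlinarith
  have hX0 : 0 < X := lt_of_lt_of_le (by positivity) hX
  have hY2 : Y ^ 2 ≤ 1 / 32 * X ^ 2 := by
    have e1 : Y ^ 2 ≤ 1 / 64 * (1 + a ^ 2) ^ 2 := by
      rw [him]
      nlinarith [sq_nonneg (a ^ 2 - 1), sq_nonneg a, mul_le_mul_of_nonneg_left hy (sq_nonneg a)]
    have e2 : (63 / 64 * (1 + a ^ 2)) ^ 2 ≤ X ^ 2 := by gcongr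
    nlinarith
  have hN : Complex.normSq ⟨X, Y⟩ = X ^ 2 + Y ^ 2 := by simp [Complex.normSq_apply]; ring
  have hNle : X ^ 2 + Y ^ 2 ≤ 33 / 32 * X ^ 2 := by linarith
  have hN0 : 0 < X ^ 2 + Y ^ 2 := by positivity
  have hw : (1 / (⟨X, Y⟩ : ℂ)) = ⟨X / (X ^ 2 + Y ^ 2), -Y / (X ^ 2 + Y ^ 2)⟩ := by
    rw [one_div]
    apply Complex.ext
    · rw [Complex.inv_re, hN]
    · rw [Complex.inv_im, hN]
  have hre4 : (((1 / (⟨X, Y⟩ : ℂ))) ^ 4).re = (X ^ 4 - 6 * X ^ 2 * Y ^ 2 + Y ^ 4) /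
      (X ^ 2 + Y ^ 2) ^ 4 := by
    rw [hw]
    have : ∀ p q : ℝ, ((⟨p, q⟩ : ℂ) ^ 4).re = p ^ 4 - 6 * p ^ 2 * q ^ 2 + q ^ 4 := by
      intro p q
      rw [show (⟨p, q⟩ : ℂ) ^ 4 = (⟨p, q⟩ * ⟨p, q⟩) * (⟨p, q⟩ * ⟨p, q⟩) by ring]
      simp
      ring
    rw [this]
    field_simp
  rw [hre4, div_le_div_iff₀ (by positivity) (by positivity)]
  have g1 : (X ^ 2 + Y ^ 2) ^ 4 ≤ (33 / 32 * X ^ 2) ^ 4 := by gcongr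
  have g2 : X ^ 4 ≤ (1 + a ^ 2) ^ 4 := by gcongr
  have g3 : 13 / 16 * X ^ 4 ≤ X ^ 4 - 6 * X ^ 2 * Y ^ 2 + Y ^ 4 := by
    nlinarith [mul_le_mul_of_nonneg_left hY2 (sq_nonneg X), sq_nonneg (Y ^ 2)]
  have g4 : 0 ≤ X ^ 4 - 6 * X ^ 2 * Y ^ 2 + Y ^ 4 := le_trans (by positivity) g3
  calc 1 * (X ^ 2 + Y ^ 2) ^ 4 ≤ (33 / 32) ^ 4 * (X ^ 4 * X ^ 4) := by
        rw [one_mul]; refine g1.trans (le_of_eq (by ring))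
    _ ≤ 13 / 16 * X ^ 4 * (32 * X ^ 4) := by nlinarith [sq_nonneg (X ^ 4)]
    _ ≤ (X ^ 4 - 6 * X ^ 2 * Y ^ 2 + Y ^ 4) * (32 * (1 + a ^ 2) ^ 4) := by gcongr

/-- The constants `K_j = j N`, `j = 1, 2, 3`, are admissible for large `N`. -/
theorem exists_admissible {s : GasState} (hs : s.Regular) : ∃ Kc : Fin 3 → ℝ, s.Admissible Kc := by
  have hv := hs.v_pos
  have hmu := hs.mu_pos
  have hβ : s.betaStar 0 < 0 := by
    simp only [betaStar, Matrix.cons_val_zero]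
    exact div_neg_of_neg_of_pos (mul_neg_of_pos_of_neg hv hs.pv_neg) hmu
  let T : Fin 3 → ℝ := fun j => 2 * |s.A j 0| + 4 * |s.A j 1| + 8 * |s.A j 2|
  let G : ℝ := 2 * ∑ j, (|s.alphaStar j + s.betaStar j| + T j)
  set d : ℝ := min (s.mu / (2 * s.v)) (min ((s.k - s.mu) / s.v) (-s.betaStar 0 / 2)) with hd
  have hd0 : 0 < d := by
    have := sub_pos.2 hs.mu_lt_k
    have := neg_pos.2 hβ
    simp only [hd, lt_min_iff]
    refine ⟨?_, ?_, ?_⟩ <;> positivity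
  have hG0 : 0 ≤ G := by positivity
  obtain ⟨N, hN, hNX⟩ := exists_large_const (d := d * (63 / 64)) (G := G) (by positivity) hG0
  have hGj : ∀ j, 2 * (|s.alphaStar j + s.betaStar j| + T j) ≤ G := fun j => by
    have := Finset.single_le_sum (f := fun j => |s.alphaStar j + s.betaStar j| + T j)
      (fun i _ => by positivity) (Finset.mem_univ j)
    simp only [G]
    linarith
  -- monotonicity of the `K_j` in `j` makes all gaps grow
  have hsplit : ∀ (η : ℂ), |η.im| < 1 / 8 → ∀ j,
      |(s.lamStar (fun j => ((j : ℕ) + 1) * N) j η).re + s.alphaStar j * (1 + η ^ 2).re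
        - (s.alphaStar j + s.betaStar j)
        + ((j : ℕ) + 1) * N * ((1 / (1 + η ^ 2)) ^ 4).re| ≤ T j / (1 + η.re ^ 2) := by
    intro η hη j
    have hw := norm_inv_one_add_sq_le (b := 1 / 8) (by norm_num) (by norm_num) hη.le
    have hX : 1 ≤ 1 + η.re ^ 2 := by nlinarith [sq_nonneg η.re]
    have hw2 : ‖1 / (1 + η ^ 2)‖ ≤ 2 / (1 + η.re ^ 2) := by
      refine hw.trans ?_
      rw [div_le_div_iff₀ (by positivity) (by positivity)]
      nlinarith
    have hw3 : ‖1 / (1 + η ^ 2)‖ ≤ 2 := hw2.trans (div_le_self (by norm_num) hX)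
    have e : s.A j 0 * (1 / (1 + η ^ 2)) + s.A j 1 * (1 / (1 + η ^ 2)) ^ 2
        + s.A j 2 * (1 / (1 + η ^ 2)) ^ 3 =
        s.lamStar (fun j => ((j : ℕ) + 1) * N) j η + s.alphaStar j * (1 + η ^ 2)
          - ((s.alphaStar j + s.betaStar j : ℝ) : ℂ)
          + ((((j : ℕ) + 1) * N : ℝ) : ℂ) * (1 / (1 + η ^ 2)) ^ 4 := by
      rw [s.lamStar_eq _ j η (hη.trans (by norm_num)),
        show ((-s.alphaStar j : ℝ) : ℂ) / (1 / (1 + η ^ 2)) = -(s.alphaStar j * (1 + η ^ 2)) by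
          rw [div_div_eq_mul_div, div_one]; push_cast; ring]
      ring
    have e' := congrArg Complex.re e
    rw [Complex.add_re (_ - _), Complex.sub_re, Complex.add_re (s.lamStar _ _ _),
      Complex.re_ofReal_mul, Complex.re_ofReal_mul, Complex.ofReal_re] at e'
    rw [← e']
    refine (Complex.abs_re_le_norm _).trans ?_
    generalize 1 / (1 + η ^ 2) = w at *
    have hw4 : ‖w‖ ^ 2 ≤ 2 * (2 / (1 + η.re ^ 2)) := by
      rw [pow_two]; gcongr
    have hw5 : ‖w‖ ^ 3 ≤ 4 * (2 / (1 + η.re ^ 2)) := by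
      calc ‖w‖ ^ 3 = ‖w‖ * ‖w‖ * ‖w‖ := by ring
        _ ≤ 2 * 2 * (2 / (1 + η.re ^ 2)) := by gcongr
        _ = _ := by ring
    calc _ ≤ ‖(s.A j 0 : ℂ) * w‖ + ‖(s.A j 1 : ℂ) * w ^ 2‖ + ‖(s.A j 2 : ℂ) * w ^ 3‖ :=
          norm_add₃_le
      _ ≤ |s.A j 0| * (2 / (1 + η.re ^ 2)) + |s.A j 1| * (2 * (2 / (1 + η.re ^ 2)))
          + |s.A j 2| * (4 * (2 / (1 + η.re ^ 2))) := by
          simp only [norm_mul, norm_pow, Complex.norm_real, Real.norm_eq_abs]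
          gcongr
      _ = _ := by simp only [T]; ring
  have hTX : ∀ (η : ℂ) j, T j / (1 + η.re ^ 2) ≤ T j := fun η j =>
    div_le_self (by positivity) (by nlinarith [sq_nonneg η.re])
  have hP : ∀ η : ℂ, |η.im| < 1 / 8 → 63 / 64 * (1 + η.re ^ 2) ≤ (1 + η ^ 2).re := fun η hη => by
    refine le_trans (le_of_eq ?_) (re_one_add_sq_ge η hη.le)
    norm_num
  have hα0 : s.alphaStar 0 = 0 := by simp [alphaStar]
  have hα1 : s.alphaStar 1 = s.mu / s.v := by simp [alphaStar]
  have hα2 : s.alphaStar 2 = s.k / s.v := by simp [alphaStar]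
  have hd1 : d ≤ s.alphaStar 1 / 2 := by
    refine (min_le_left _ _).trans (le_of_eq ?_)
    rw [hα1]; field_simp
  have hd2 : d ≤ s.alphaStar 2 / 2 := by
    refine hd1.trans ?_
    rw [hα1, hα2]
    have := hs.mu_lt_k
    gcongr
  have hd3 : d ≤ s.alphaStar 2 - s.alphaStar 1 := by
    refine (min_le_right _ _).trans ((min_le_left _ _).trans (le_of_eq ?_))
    rw [hα1, hα2]; ring
  have hd4 : d ≤ -s.betaStar 0 / 2 := (min_le_right _ _).trans (min_le_right _ _)
  have hgap : ∀ η : ℂ, |η.im| < 1 / 8 → ∀ i j : Fin 3, i < j →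
      1 ≤ (s.lamStar (fun j => ((j : ℕ) + 1) * N) i η).re -
        (s.lamStar (fun j => ((j : ℕ) + 1) * N) j η).re := by
    intro η hη i j hij
    have hdij : d ≤ s.alphaStar j - s.alphaStar i := by
      fin_cases i <;> fin_cases j <;> simp at hij ⊢ <;> linarith
    have h1 := (abs_le.1 ((hsplit η hη i).trans (hTX η i))).1
    have h2 := (abs_le.1 ((hsplit η hη j).trans (hTX η j))).2
    have h3 := re_inv_pow_four_ge η hη
    have h4 := hNX (1 + η.re ^ 2) (by nlinarith [sq_nonneg η.re])
    have h5 : d * (63 / 64 * (1 + η.re ^ 2)) ≤ (s.alphaStar j - s.alphaStar i) * (1 + η ^ 2).re :=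
      mul_le_mul hdij (hP η hη) (by positivity) (hd0.le.trans hdij)
    have h6 : N * (1 / (32 * (1 + η.re ^ 2) ^ 4)) ≤
        (((j : ℕ) : ℝ) - (i : ℕ)) * N * ((1 / (1 + η ^ 2)) ^ 4).re := by
      have : (1 : ℝ) ≤ ((j : ℕ) : ℝ) - (i : ℕ) := by
        have h : (i : ℕ) + 1 ≤ (j : ℕ) := hij
        have h' : (((i : ℕ) + 1 : ℕ) : ℝ) ≤ (j : ℕ) := by exact_mod_cast h
        push_cast at h'
        linarith
      have h0 : 0 ≤ N * (1 / (32 * (1 + η.re ^ 2) ^ 4)) := by positivity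
      have h7 : N * (1 / (32 * (1 + η.re ^ 2) ^ 4)) ≤ N * ((1 / (1 + η ^ 2)) ^ 4).re := by gcongr
      nlinarith
    have h8 := neg_abs_le (s.alphaStar i + s.betaStar i)
    have h9 := le_abs_self (s.alphaStar j + s.betaStar j)
    have h10 := hGj i
    have h11 := hGj j
    linarith
  refine ⟨fun j => ((j : ℕ) + 1) * N, fun j => by positivity, 1 / 8,
    min (1 / 2) (-s.betaStar 0 / 4), 1, by norm_num, by norm_num,
    lt_min (by norm_num) (by linarith), one_pos, fun η hη => ⟨fun j => ?_, fun i j hij => ?_⟩⟩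
  · have h3 := re_inv_pow_four_ge η hη
    have h4 := hNX (1 + η.re ^ 2) (by nlinarith [sq_nonneg η.re])
    have h5 := (abs_le.1 (hsplit η hη j)).2
    have e : (s.lamStar (fun j => ((j : ℕ) + 1) * N) j η
        + (s.alphaStar j : ℂ) / 2 * (η ^ 2 + 1)).re =
        (s.lamStar (fun j => ((j : ℕ) + 1) * N) j η).re + s.alphaStar j / 2 * (1 + η ^ 2).re := by
      rw [show (s.alphaStar j : ℂ) / 2 * (η ^ 2 + 1) =
        ((s.alphaStar j / 2 : ℝ) : ℂ) * (1 + η ^ 2) by push_cast; ring, Complex.add_re,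
        Complex.re_ofReal_mul]
    rw [e]
    have h6 : N * (1 / (32 * (1 + η.re ^ 2) ^ 4)) ≤
        (((j : ℕ) : ℝ) + 1) * N * ((1 / (1 + η ^ 2)) ^ 4).re := by
      have h0 : 0 ≤ N * (1 / (32 * (1 + η.re ^ 2) ^ 4)) := by positivity
      have h7 : N * (1 / (32 * (1 + η.re ^ 2) ^ 4)) ≤ N * ((1 / (1 + η ^ 2)) ^ 4).re := by gcongr
      have : (0 : ℝ) ≤ (j : ℕ) := by positivity
      nlinarith
    have h10 := hGj j
    by_cases hj : j = 0
    · subst hj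
      rw [hα0] at h5 h10 ⊢
      have hX : 0 < 1 + η.re ^ 2 := by positivity
      have h11 : T 0 / (1 + η.re ^ 2) ≤
          -s.betaStar 0 / 2 + N * (1 / (32 * (1 + η.re ^ 2) ^ 4)) := by
        rw [div_le_iff₀ hX]
        have h12 : d * (63 / 64) * (1 + η.re ^ 2) ≤ -s.betaStar 0 / 2 * (1 + η.re ^ 2) := by
          gcongr
          linarith
        have h13 : 0 ≤ N * (1 / (32 * (1 + η.re ^ 2) ^ 4)) := by positivity
        have h14 := mul_nonneg h13 (sq_nonneg η.re)
        have h15 := abs_nonneg (0 + s.betaStar 0)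
        have h16 : 0 ≤ T 0 := by positivity
        linarith
      have := min_le_right (1 / 2) (-s.betaStar 0 / 4)
      linarith
    · have hdj : d ≤ s.alphaStar j / 2 := by
        fin_cases j <;> first | exact absurd rfl hj | exact hd1 | exact hd2
      have h7 : d * (63 / 64 * (1 + η.re ^ 2)) ≤ s.alphaStar j / 2 * (1 + η ^ 2).re :=
        mul_le_mul hdj (hP η hη) (by positivity) (hd0.le.trans hdj)
      have h8 := le_abs_self (s.alphaStar j + s.betaStar j)
      have h9 := hTX η j
      have h11 : 0 ≤ T j := by positivity
      have h12 := abs_nonneg (s.alphaStar j + s.betaStar j)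
      have := min_le_left (1 / 2) (-s.betaStar 0 / 4)
      linarith
  · rw [Complex.sub_re]
    rcases lt_or_gt_of_ne hij with h | h
    · exact (hgap η hη i j h).trans (le_abs_self _)
    · rw [abs_sub_comm]
      exact (hgap η hη j i h).trans (le_abs_self _)

end GasState

/-! ### Eigenvalues and spectral projections near the origin -/

/-- A simple root of a family of equations extends to a holomorphic root. -/
theorem exists_holomorphic_root {P : ℂ × ℂ → ℂ} (hP : ContDiff ℂ 1 P) {m0 d : ℂ}
    (h0 : P (0, m0) = 0) (hd : HasDerivAt (fun m => P (0, m)) d m0) (hd0 : d ≠ 0) :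
    ∃ m : ℂ → ℂ, m 0 = m0 ∧ (∀ᶠ z in 𝓝 0, DifferentiableAt ℂ m z) ∧
      ∀ᶠ z in 𝓝 0, P (z, m z) = 0 := by
  have hc : ContDiffAt ℂ 1 P (0, m0) := hP.contDiffAt
  have hinv : (fderiv ℂ P (0, m0) ∘L .inr ℂ ℂ ℂ).IsInvertible := by
    refine ⟨ContinuousLinearEquiv.unitsEquivAut ℂ (Units.mk0 d hd0), ?_⟩
    ext
    have h1 : HasFDerivAt P (fderiv ℂ P (0, m0)) (0, m0) :=
      (hP.differentiable one_ne_zero _).hasFDerivAt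
    have h2 : HasDerivAt (fun m : ℂ => ((0 : ℂ), m)) ((0 : ℂ), (1 : ℂ)) m0 :=
      (hasDerivAt_const m0 (0 : ℂ)).prodMk (hasDerivAt_id m0)
    have h3 := h1.comp_hasDerivAt m0 h2
    simpa using hd.unique h3
  refine ⟨hc.implicitFunction one_ne_zero hinv, hc.implicitFunction_apply_self one_ne_zero hinv,
    ?_, ?_⟩
  · have := (hc.contDiffAt_implicitFunction one_ne_zero hinv).eventually (by simp)
    filter_upwards [this] with z hz using hz.differentiableAt one_ne_zero
  · have := hc.eventually_apply_implicitFunction one_ne_zero hinv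
    rw [h0] at this
    exact this

/-- Taylor's formula of the second order for a holomorphic function. -/
theorem exists_second_order_bound {f : ℂ → ℂ} {f0 f1 : ℂ}
    (hf : ∀ᶠ z in 𝓝 0, DifferentiableAt ℂ f z) (h0 : f 0 = f0) (h1 : HasDerivAt f f1 0) :
    ∃ H : ℝ, 0 < H ∧ ∀ᶠ z in 𝓝 0, ‖f z - (f0 + z * f1)‖ ≤ H * ‖z‖ ^ 2 := by
  obtain ⟨s, hs, hs'⟩ := hf.exists_mem
  have hd : DifferentiableOn ℂ f s := fun z hz => (hs' z hz).differentiableWithinAt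
  have hd2 := (Complex.differentiableOn_dslope hs).2 ((Complex.differentiableOn_dslope hs).2 hd)
  have hc : ContinuousAt (dslope (dslope f 0) 0) 0 := (hd2.differentiableAt hs).continuousAt
  refine ⟨‖dslope (dslope f 0) 0 0‖ + 1, by positivity, ?_⟩
  have hev : ∀ᶠ z in 𝓝 0, ‖dslope (dslope f 0) 0 z‖ < ‖dslope (dslope f 0) 0 0‖ + 1 :=
    hc.norm.eventually_lt_const (by linarith)
  filter_upwards [hev] with z hz
  have e1 := sub_smul_dslope f 0 z
  have e2 := sub_smul_dslope (dslope f 0) 0 z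
  rw [dslope_same, h1.deriv] at e2
  simp only [sub_zero, smul_eq_mul] at e1 e2
  have e3 : f z - (f0 + z * f1) = z ^ 2 * dslope (dslope f 0) 0 z := by
    rw [← h0]
    linear_combination -e1 - z * e2
  rw [e3, norm_mul, norm_pow, mul_comm]
  gcongr

namespace GasState

/-- The matrix `T(z) = -F' + z B`, for which `z T(z)` is the symbol at `z = iη`. -/
def reduced (s : GasState) (z : ℂ) : Matrix (Fin 3) (Fin 3) ℂ :=
  -s.fluxJac.map Complex.ofReal + z • s.visc.map Complex.ofReal

theorem symbol_eq (s : GasState) (η : ℂ) :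
    s.symbol η = (Complex.I * η) • s.reduced (Complex.I * η) := by
  ext a b
  simp [symbol, reduced]
  linear_combination (-(η ^ 2) * (s.visc a b : ℂ)) * Complex.I_sq

/-- The characteristic polynomial of `reduced`. -/
def reducedDispersion (s : GasState) (x : ℂ × ℂ) : ℂ :=
  x.2 ^ 3 - (s.mu + s.k) / s.v * x.1 * x.2 ^ 2
    + (s.mu * s.k / s.v ^ 2 * x.1 ^ 2 - (s.p * s.pe - s.pv)) * x.2 - s.pv * s.k / s.v * x.1

theorem dispersion_eq_reducedDispersion (s : GasState) (z m : ℂ) :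
    s.dispersion (z * m) (-z ^ 2) = z ^ 3 * s.reducedDispersion (z, m) := by
  simp only [dispersion, reducedDispersion]
  ring

theorem three_mul_sq_beta_sub_ne {s : GasState} (hs : s.Regular) (j : Fin 3) :
    3 * s.beta j ^ 2 - (s.p * s.pe - s.pv) ≠ 0 := by
  have h := hs.sq_c
  have h1 := hs.sq_c_pos
  fin_cases j <;> simp [beta, h] <;> linarith

theorem cube_beta {s : GasState} (hs : s.Regular) (j : Fin 3) :
    s.beta j ^ 3 - (s.p * s.pe - s.pv) * s.beta j = 0 := by
  rw [← hs.sq_c]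
  fin_cases j <;> simp [beta] <;> ring

theorem alpha_mul_eq {s : GasState} (hs : s.Regular) (j : Fin 3) :
    s.alpha j * (3 * s.beta j ^ 2 - (s.p * s.pe - s.pv)) =
      (s.mu + s.k) / s.v * s.beta j ^ 2 + s.pv * s.k / s.v := by
  have h := hs.sq_c
  have h1 := hs.sq_c_pos.ne'
  have hv := hs.v_pos.ne'
  fin_cases j <;> simp [beta, alpha, h] <;> field_simp <;> ring

theorem beta_injective {s : GasState} (hs : s.Regular) : Function.Injective s.beta := by
  have hc := hs.c_pos
  intro i j hij
  fin_cases i <;> fin_cases j <;> simp [beta] at hij ⊢ <;> linarith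

theorem exists_eigenvalue {s : GasState} (hs : s.Regular) (j : Fin 3) :
    ∃ m : ℂ → ℂ, m 0 = s.beta j ∧ HasDerivAt m (s.alpha j) 0 ∧
      (∀ᶠ z in 𝓝 0, DifferentiableAt ℂ m z) ∧ ∀ᶠ z in 𝓝 0, s.reducedDispersion (z, m z) = 0 := by
  have hne : (3 * (s.beta j : ℂ) ^ 2 - (s.p * s.pe - s.pv)) ≠ 0 := by
    exact_mod_cast three_mul_sq_beta_sub_ne hs j
  have h0 : s.reducedDispersion (0, s.beta j) = 0 := by
    have : (s.beta j : ℂ) ^ 3 - (s.p * s.pe - s.pv) * s.beta j = 0 := by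
      exact_mod_cast cube_beta hs j
    simp only [reducedDispersion]
    linear_combination this
  obtain ⟨m, hm0, hm1, hm2⟩ := exists_holomorphic_root
    (P := s.reducedDispersion) (m0 := s.beta j) (by unfold reducedDispersion; fun_prop) h0
    (by
      have h1 : HasDerivAt (fun m : ℂ => m ^ 3 - (s.p * s.pe - s.pv) * m)
          (3 * (s.beta j : ℂ) ^ 2 - (s.p * s.pe - s.pv)) (s.beta j) := by
        have := (hasDerivAt_pow 3 (s.beta j : ℂ)).sub
          ((hasDerivAt_id (s.beta j : ℂ)).const_mul ((s.p : ℂ) * s.pe - s.pv))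
        exact this.congr_deriv (by simp)
      refine h1.congr_of_eventuallyEq (Eventually.of_forall fun m => ?_)
      simp only [reducedDispersion]
      ring) hne
  refine ⟨m, hm0, ?_, hm1, hm2⟩
  have hd := hm1.self_of_nhds.hasDerivAt
  have h2 : HasDerivAt (fun z => s.reducedDispersion (z, m z)) 0 0 :=
    (hasDerivAt_const (0 : ℂ) (0 : ℂ)).congr_of_eventuallyEq hm2
  have h3 : HasDerivAt (fun z => s.reducedDispersion (z, m z))
      (3 * (s.beta j : ℂ) ^ 2 * deriv m 0 - (s.mu + s.k) / s.v * (s.beta j : ℂ) ^ 2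
        - (s.p * s.pe - s.pv) * deriv m 0 - s.pv * s.k / s.v) 0 := by
    have hz := hasDerivAt_id (0 : ℂ)
    have := (((hd.pow 3).sub ((hz.const_mul (((s.mu : ℂ) + s.k) / s.v)).mul (hd.pow 2))).add
      ((((hz.pow 2).const_mul ((s.mu : ℂ) * s.k / s.v ^ 2)).sub_const
        ((s.p : ℂ) * s.pe - s.pv)).mul hd)).sub (hz.const_mul ((s.pv : ℂ) * s.k / s.v))
    refine this.congr_deriv ?_
    simp [hm0]
    ring
  have h4 := h3.unique h2
  have h5 : (s.alpha j : ℂ) * (3 * (s.beta j : ℂ) ^ 2 - (s.p * s.pe - s.pv)) =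
      (s.mu + s.k) / s.v * (s.beta j : ℂ) ^ 2 + s.pv * s.k / s.v := by
    exact_mod_cast alpha_mul_eq hs j
  have h6 : deriv m 0 = s.alpha j := by
    refine mul_right_cancel₀ hne ?_
    rw [h5]
    linear_combination h4
  rwa [h6] at hd

theorem adjugate_map_ofReal (X : Matrix (Fin 3) (Fin 3) ℝ) (a b : Fin 3) :
    (X.map Complex.ofReal).adjugate a b = ((X.adjugate a b : ℝ) : ℂ) := by
  have := congrFun (congrFun (RingHom.map_adjugate Complex.ofRealHom X) a) b
  exact this.symm

/-- The spectral projection of `reduced z` for the eigenvalue `m j`, if the `m k` are the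
eigenvalues. -/
def projection (s : GasState) (m : Fin 3 → ℂ → ℂ) (j : Fin 3) (z : ℂ) : Matrix (Fin 3) (Fin 3) ℂ :=
  (∏ k ∈ Finset.univ.erase j, (m j z - m k z))⁻¹ •
    (m j z • (1 : Matrix (Fin 3) (Fin 3) ℂ) - s.reduced z).adjugate

theorem hasDerivAt_entry (s : GasState) {f : ℂ → ℂ} {z f' : ℂ} (hf : HasDerivAt f f' z)
    (a b : Fin 3) :
    HasDerivAt (fun w => (f w • (1 : Matrix (Fin 3) (Fin 3) ℂ) - s.reduced w) a b)
      ((f' • (1 : Matrix (Fin 3) (Fin 3) ℂ) - s.visc.map Complex.ofReal) a b) z := by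
  have := (hf.mul_const ((1 : Matrix (Fin 3) (Fin 3) ℂ) a b)).sub
    ((hasDerivAt_const z (-(s.fluxJac a b : ℂ))).add
      ((hasDerivAt_id z).mul_const (s.visc a b : ℂ)))
  refine this.congr_deriv ?_
  simp

theorem differentiableAt_projection (s : GasState) {m : Fin 3 → ℂ → ℂ} {z : ℂ}
    (hm : ∀ j, DifferentiableAt ℂ (m j) z) (hinj : ∀ i j, i ≠ j → m i z ≠ m j z) (j a b : Fin 3) :
    DifferentiableAt ℂ (fun z => s.projection m j z a b) z := by
  simp only [projection, Matrix.smul_apply, smul_eq_mul]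
  refine DifferentiableAt.mul ?_ ?_
  · refine DifferentiableAt.fun_inv
      (DifferentiableAt.fun_finsetProd fun k _ => (hm j).sub (hm k)) ?_
    refine Finset.prod_ne_zero_iff.2 fun k hk => sub_ne_zero.2 ?_
    exact hinj j k (Finset.ne_of_mem_erase hk).symm
  · exact differentiableAt_adjugate
      (fun c d => (s.hasDerivAt_entry (hm j).hasDerivAt c d).differentiableAt) a b

theorem projection_zero {s : GasState} (hs : s.Regular) {m : Fin 3 → ℂ → ℂ}
    (h0 : ∀ j, m j 0 = s.beta j) (j a b : Fin 3) : s.projection m j 0 a b = s.M0 j a b := by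
  have h := congrFun (congrFun (s.adjugate_eq_smul_M0 hs.c_pos.ne' hs.sq_c j) a) b
  have e : m j 0 • (1 : Matrix (Fin 3) (Fin 3) ℂ) - s.reduced 0 =
      (s.beta j • (1 : Matrix (Fin 3) (Fin 3) ℝ) + s.fluxJac).map Complex.ofReal := by
    ext a b
    by_cases hab : a = b <;> simp [reduced, h0, hab]
  have hne : (∏ k ∈ Finset.univ.erase j, (s.beta j - s.beta k)) ≠ 0 :=
    Finset.prod_ne_zero_iff.2 fun k hk => sub_ne_zero.2
      ((beta_injective hs).ne (Finset.ne_of_mem_erase hk).symm)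
  have e2 : ∏ k ∈ Finset.univ.erase j, (m j 0 - m k 0) =
      ((∏ k ∈ Finset.univ.erase j, (s.beta j - s.beta k) : ℝ) : ℂ) := by
    simp [h0]
  rw [projection, e, e2, Matrix.smul_apply, adjugate_map_ofReal, h, Matrix.smul_apply, smul_eq_mul,
    smul_eq_mul, ← Complex.ofReal_inv, ← Complex.ofReal_mul, inv_mul_cancel_left₀ hne]

theorem hasDerivAt_projection_zero {s : GasState} (hs : s.Regular) {m : Fin 3 → ℂ → ℂ}
    (h0 : ∀ j, m j 0 = s.beta j) (h1 : ∀ j, HasDerivAt (m j) (s.alpha j) 0) (j a b : Fin 3) :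
    HasDerivAt (fun z => s.projection m j z a b) (s.M1 j a b) 0 := by
  obtain ⟨k, l, hjk, hjl, hkl, hu⟩ : ∃ k l : Fin 3, j ≠ k ∧ j ≠ l ∧ k ≠ l ∧
      Finset.univ.erase j = {k, l} := by revert j; decide
  have hb := beta_injective hs
  have n1 : (s.beta j : ℂ) - s.beta k ≠ 0 := by
    exact_mod_cast sub_ne_zero.2 (hb.ne hjk)
  have n2 : (s.beta j : ℂ) - s.beta l ≠ 0 := by
    exact_mod_cast sub_ne_zero.2 (hb.ne hjl)
  have hD := ((h1 j).sub (h1 k)).mul ((h1 j).sub (h1 l))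
  have hA := hasDerivAt_adjugate _ _ 0 (s.hasDerivAt_entry (h1 j)) a b
  have hI := hD.inv (by simp [h0, n1, n2])
  have hP := hI.mul hA
  have e0 : m j 0 • (1 : Matrix (Fin 3) (Fin 3) ℂ) - s.reduced 0 =
      (s.beta j • (1 : Matrix (Fin 3) (Fin 3) ℝ) + s.fluxJac).map Complex.ofReal := by
    ext a b
    by_cases hab : a = b <;> simp [reduced, h0, hab]
  have e1 : (s.alpha j : ℂ) • (1 : Matrix (Fin 3) (Fin 3) ℂ) - s.visc.map Complex.ofReal =
      (s.alpha j • (1 : Matrix (Fin 3) (Fin 3) ℝ) - s.visc).map Complex.ofReal := by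
    ext a b
    by_cases hab : a = b <;> simp [hab]
  have e2 : (s.beta j • (1 : Matrix (Fin 3) (Fin 3) ℝ) + s.fluxJac).map Complex.ofReal +
      (s.alpha j • (1 : Matrix (Fin 3) (Fin 3) ℝ) - s.visc).map Complex.ofReal =
      (s.beta j • (1 : Matrix (Fin 3) (Fin 3) ℝ) + s.fluxJac +
        (s.alpha j • (1 : Matrix (Fin 3) (Fin 3) ℝ) - s.visc)).map Complex.ofReal := by
    ext a b
    simp
  have p0 := congrFun (congrFun (s.adjugate_eq_smul_M0 hs.c_pos.ne' hs.sq_c j) a) b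
  rw [hu, Finset.prod_pair hkl] at p0
  have p1 := congrFun (congrFun (s.adjugate_polar_eq hs.v_pos.ne' hs.c_pos.ne' hs.sq_c j k l
    hjk hjl hkl) a) b
  simp only [Matrix.smul_apply, Matrix.add_apply, Matrix.sub_apply, smul_eq_mul] at p0 p1
  have p0' := congrArg Complex.ofReal p0
  have p1' := congrArg Complex.ofReal p1
  push_cast at p0' p1'
  have e3 : (fun z => s.projection m j z a b) = fun z => ((m j z - m k z) * (m j z - m l z))⁻¹ *
      (m j z • (1 : Matrix (Fin 3) (Fin 3) ℂ) - s.reduced z).adjugate a b := by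
    funext z
    rw [projection, hu, Finset.prod_pair hkl, Matrix.smul_apply, smul_eq_mul]
  rw [e3]
  refine hP.congr_deriv ?_
  rw [e0, e1, e2]
  simp only [Matrix.sub_apply, adjugate_map_ofReal, Pi.mul_apply, Pi.sub_apply, Pi.inv_apply, h0]
  rw [p1', p0']
  field_simp
  ring

/-- Near the origin, the Green's function is a sum of three modes with holomorphic eigenvalues
`z m_j(z)` and projections `M_j(z)`, `z = iη`. -/
structure LowFrequency (s : GasState) (r H : ℝ) (m : Fin 3 → ℂ → ℂ)
    (M : Fin 3 → Fin 3 → Fin 3 → ℂ → ℂ) : Prop where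
  r_pos : 0 < r
  H_pos : 0 < H
  m_diff : ∀ j z, ‖z‖ < r → DifferentiableAt ℂ (m j) z
  M_diff : ∀ j a b z, ‖z‖ < r → DifferentiableAt ℂ (M j a b) z
  m_bound : ∀ j z, ‖z‖ < r → ‖m j z - (s.beta j + z * s.alpha j)‖ ≤ H * ‖z‖ ^ 2
  M_bound : ∀ j a b z, ‖z‖ < r → ‖M j a b z - (s.M0 j a b + z * s.M1 j a b)‖ ≤ H * ‖z‖ ^ 2
  green_eq : ∀ η t : ℝ, η ≠ 0 → |η| < r → 0 ≤ t → ∀ a b, s.greenC η t a b =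
    ∑ j, Complex.exp (Complex.I * η * m j (Complex.I * η) * t) * M j a b (Complex.I * η)

/-- The eigenvalues near `β_j` are holomorphic by the implicit function theorem; the projections are
rational functions of them. -/
theorem exists_lowFrequency {s : GasState} (hs : s.Regular) :
    ∃ r H m M, s.LowFrequency r H m M := by
  choose m h0 h1 hd hroot using exists_eigenvalue hs
  have hne : ∀ i j, i ≠ j → ∀ᶠ z in 𝓝 0, m i z ≠ m j z := by
    intro i j hij
    have hne : (m i - m j) 0 ≠ 0 := by
      rw [Pi.sub_apply, h0, h0, sub_ne_zero]
      exact_mod_cast (beta_injective hs).ne hij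
    filter_upwards [((h1 i).continuousAt.sub (h1 j).continuousAt).eventually_ne hne] with z hz
    exact sub_ne_zero.1 hz
  have hdist : ∀ᶠ z in 𝓝 (0 : ℂ), ∀ i j, i ≠ j → m i z ≠ m j z := by
    refine eventually_all.2 fun i => eventually_all.2 fun j => ?_
    by_cases hij : i = j
    · exact Eventually.of_forall fun z h => absurd hij h
    · filter_upwards [hne i j hij] with z hz _ using hz
  have hd' := eventually_all.2 hd
  have hroot' := eventually_all.2 hroot
  have hMd : ∀ᶠ z in 𝓝 (0 : ℂ), ∀ j a b,
      DifferentiableAt ℂ (fun z => s.projection m j z a b) z := by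
    filter_upwards [hd', hdist] with z hz1 hz2 j a b
    exact s.differentiableAt_projection hz1 hz2 j a b
  have hmb := fun j => exists_second_order_bound (hd j) (h0 j) (h1 j)
  have hMb := fun j a b => exists_second_order_bound
    (f := fun z => s.projection m j z a b) (f0 := s.M0 j a b) (f1 := s.M1 j a b)
    (hMd.mono fun z hz => hz j a b) (projection_zero hs h0 j a b)
    (hasDerivAt_projection_zero hs h0 h1 j a b)
  choose H1 hH1 hmb using hmb
  choose H2 hH2 hMb using hMb
  have hmb' := eventually_all.2 hmb
  have hMb' := eventually_all.2 fun j => eventually_all.2 fun a => eventually_all.2 fun b =>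
    hMb j a b
  obtain ⟨r, hr, hball⟩ := Metric.eventually_nhds_iff.1
    (hd'.and (hroot'.and (hdist.and (hMd.and (hmb'.and hMb')))))
  simp only [dist_zero_right] at hball
  set H := ∑ j, H1 j + ∑ j, ∑ a, ∑ b, H2 j a b with hH
  have hle1 : ∀ j, H1 j ≤ H := fun j => by
    have e1 := Finset.single_le_sum (f := H1) (fun i _ => (hH1 i).le) (Finset.mem_univ j)
    have e2 : 0 ≤ ∑ j, ∑ a, ∑ b, H2 j a b := Finset.sum_nonneg fun j _ =>
      Finset.sum_nonneg fun a _ => Finset.sum_nonneg fun b _ => (hH2 j a b).le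
    linarith
  have hle2 : ∀ j a b, H2 j a b ≤ H := fun j a b => by
    have e1 := Finset.single_le_sum (f := H2 j a) (fun i _ => (hH2 j a i).le) (Finset.mem_univ b)
    have e2 := Finset.single_le_sum (f := fun a => ∑ b, H2 j a b)
      (fun i _ => Finset.sum_nonneg fun b _ => (hH2 j i b).le) (Finset.mem_univ a)
    have e3 := Finset.single_le_sum (f := fun j => ∑ a, ∑ b, H2 j a b)
      (fun i _ => Finset.sum_nonneg fun a _ => Finset.sum_nonneg fun b _ => (hH2 i a b).le)
      (Finset.mem_univ j)
    have e4 : 0 ≤ ∑ j, H1 j := Finset.sum_nonneg fun j _ => (hH1 j).le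
    linarith
  refine ⟨r, H, m, fun j a b z => s.projection m j z a b, hr, lt_of_lt_of_le (hH1 0) (hle1 0),
    fun j z hz => (hball hz).1 j, fun j a b z hz => (hball hz).2.2.2.1 j a b, fun j z hz => ?_,
    fun j a b z hz => ?_, fun η t hη0 hη ht a b => ?_⟩
  · exact ((hball hz).2.2.2.2.1 j).trans (by gcongr; exact hle1 j)
  · exact ((hball hz).2.2.2.2.2 j a b).trans (by gcongr; exact hle2 j a b)
  · set z : ℂ := Complex.I * η with hz
    have hz0 : z ≠ 0 := mul_ne_zero Complex.I_ne_zero (by exact_mod_cast hη0)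
    have hzr : ‖z‖ < r := by simpa [hz] using hη
    obtain ⟨-, hr1, hr2, -⟩ := hball hzr
    have hzη : (η : ℂ) ^ 2 = -z ^ 2 := by rw [hz]; ring_nf; simp
    have h := exp_eq_spectralSum (s.symbol η) (fun j => z * m j z)
      (fun i j hij => by
        by_contra hne
        exact hr2 i j hne (mul_left_cancel₀ hz0 hij))
      (fun j => by
        rw [s.det_sub_symbol hs.v_pos.ne', hzη, dispersion_eq_reducedDispersion, hr1 j, mul_zero])
      t ht
    rw [greenC, h, spectralSum, Matrix.sum_apply]
    refine Finset.sum_congr rfl fun j _ => ?_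
    have e1 : (z * m j z) • (1 : Matrix (Fin 3) (Fin 3) ℂ) - s.symbol η =
        z • (m j z • (1 : Matrix (Fin 3) (Fin 3) ℂ) - s.reduced z) := by
      rw [symbol_eq, ← hz, smul_sub, mul_smul]
    have e2 : ∏ k ∈ Finset.univ.erase j, (z * m j z - z * m k z) =
        z ^ 2 * ∏ k ∈ Finset.univ.erase j, (m j z - m k z) := by
      simp only [← mul_sub]
      rw [Finset.prod_mul_distrib, Finset.prod_const, Finset.card_erase_of_mem (Finset.mem_univ j),
        Finset.card_univ, Fintype.card_fin]
    rw [e1, e2, Matrix.adjugate_smul, Fintype.card_fin]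
    simp only [projection, Matrix.smul_apply, smul_eq_mul]
    have : (z ^ 2 : ℂ) ≠ 0 := pow_ne_zero 2 hz0
    congr 1
    rw [mul_inv]
    field_simp

end GasState

/-! ### The contribution of one mode near the origin -/

namespace GasState

/-- The difference of the `j`-th mode of the Green's function and of the profile. -/
def modeError (s : GasState) (m : Fin 3 → ℂ → ℂ) (M : Fin 3 → Fin 3 → Fin 3 → ℂ → ℂ)
    (j a b : Fin 3) (η : ℂ) (t : ℝ) : ℂ :=
  Complex.exp (Complex.I * η * m j (Complex.I * η) * t) * M j a b (Complex.I * η)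
    - s.gaussHat j η t * (s.M0 j a b + Complex.I * η * s.M1 j a b)

/-- The error of the eigenvalue multiplies the projection by `e^E - 1`, `E = O(|η|³ t)`; half of the
decay of the Gaussian absorbs `e^{|E|}`. -/
theorem LowFrequency.norm_modeError_le {s : GasState} {r H : ℝ} {m : Fin 3 → ℂ → ℂ}
    {M : Fin 3 → Fin 3 → Fin 3 → ℂ → ℂ} (hl : s.LowFrequency r H m M) (j a b : Fin 3) {η : ℂ}
    {t : ℝ}
    (ht : 0 ≤ t) (hr : ‖η‖ < r) (h1 : ‖η‖ ≤ 1) (hα : H * ‖η‖ ≤ s.alpha j / 2) :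
    ‖s.modeError m M j a b η t‖ ≤ ‖s.gaussHat j η t‖ * Real.exp (s.alpha j / 2 * ‖η‖ ^ 2 * t) *
      (H * ‖η‖ ^ 3 * t * |s.M0 j a b| + H * (|s.M1 j a b| + H) * ‖η‖ ^ 4 * t + H * ‖η‖ ^ 2) := by
  have hH := hl.H_pos
  set z := Complex.I * η with hz
  have hzn : ‖z‖ = ‖η‖ := by simp [hz]
  rw [← hzn] at hr h1 hα ⊢
  set E := z * (m j z - (s.beta j + z * s.alpha j)) * t with hE
  have hEn : ‖E‖ ≤ H * ‖z‖ ^ 3 * t := by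
    rw [hE, norm_mul, norm_mul, Complex.norm_real, Real.norm_of_nonneg ht]
    calc _ ≤ ‖z‖ * (H * ‖z‖ ^ 2) * t := by gcongr; exact hl.m_bound j z hr
      _ = _ := by ring
  have hEn2 : ‖E‖ ≤ s.alpha j / 2 * ‖z‖ ^ 2 * t := by
    refine hEn.trans ?_
    calc H * ‖z‖ ^ 3 * t = (H * ‖z‖) * ‖z‖ ^ 2 * t := by ring
      _ ≤ _ := by gcongr
  have hsplit : s.modeError m M j a b η t = s.gaussHat j η t * ((Complex.exp E - 1) * M j a b z +
      (M j a b z - (s.M0 j a b + z * s.M1 j a b))) := by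
    have e1 : Complex.exp (z * m j z * t) = s.gaussHat j η t * Complex.exp E := by
      rw [gaussHat, ← Complex.exp_add, hE, ← hz]
      congr 1
      ring
    rw [modeError, ← hz, e1]
    ring
  have hexp : ‖Complex.exp E - 1‖ ≤ H * ‖z‖ ^ 3 * t * Real.exp (s.alpha j / 2 * ‖z‖ ^ 2 * t) := by
    have := Complex.norm_exp_sub_sum_le_norm_mul_exp E 1
    simp at this
    refine this.trans ?_
    gcongr
  have hM : ‖M j a b z‖ ≤ |s.M0 j a b| + (|s.M1 j a b| + H) * ‖z‖ := by
    have e1 := hl.M_bound j a b z hr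
    have e2 : ‖M j a b z‖ ≤ ‖M j a b z - (s.M0 j a b + z * s.M1 j a b)‖ +
        (|s.M0 j a b| + ‖z‖ * |s.M1 j a b|) := by
      calc ‖M j a b z‖ = ‖(M j a b z - (s.M0 j a b + z * s.M1 j a b)) +
            ((s.M0 j a b : ℂ) + z * s.M1 j a b)‖ := by ring_nf
        _ ≤ _ := by
          refine (norm_add_le _ _).trans ?_
          gcongr
          refine (norm_add_le _ _).trans ?_
          rw [norm_mul, Complex.norm_real, Complex.norm_real, Real.norm_eq_abs, Real.norm_eq_abs]
    have e3 : H * ‖z‖ ^ 2 ≤ H * ‖z‖ := by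
      gcongr
      nlinarith [norm_nonneg z]
    linarith
  have hone : 1 ≤ Real.exp (s.alpha j / 2 * ‖z‖ ^ 2 * t) :=
    Real.one_le_exp ((norm_nonneg E).trans hEn2)
  rw [hsplit, norm_mul, mul_assoc (‖s.gaussHat j η t‖)]
  refine mul_le_mul_of_nonneg_left ?_ (norm_nonneg _)
  refine (norm_add_le _ _).trans ?_
  rw [norm_mul]
  calc _ ≤ H * ‖z‖ ^ 3 * t * Real.exp (s.alpha j / 2 * ‖z‖ ^ 2 * t) *
        (|s.M0 j a b| + (|s.M1 j a b| + H) * ‖z‖) +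
        Real.exp (s.alpha j / 2 * ‖z‖ ^ 2 * t) * (H * ‖z‖ ^ 2) := by
        gcongr
        calc _ ≤ H * ‖z‖ ^ 2 := hl.M_bound j a b z hr
          _ = 1 * (H * ‖z‖ ^ 2) := by ring
          _ ≤ _ := by gcongr
    _ = _ := by ring

theorem sq_norm_add_mul_I (p q : ℝ) : ‖(p : ℂ) + q * Complex.I‖ ^ 2 = p ^ 2 + q ^ 2 := by
  rw [← Complex.normSq_eq_norm_sq, Complex.normSq_add_mul_I]

/-- The integrand of the `j`-th mode, on the line at height `q`. -/
theorem LowFrequency.norm_integrand_le {s : GasState} {r H : ℝ} {m : Fin 3 → ℂ → ℂ}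
    {M : Fin 3 → Fin 3 → Fin 3 → ℂ → ℂ} (hl : s.LowFrequency r H m M) (j a b : Fin 3) (n : ℕ)
    {δ p q t x : ℝ} (hr : 2 * δ < r) (h1 : 2 * δ ≤ 1) (hα : H * (2 * δ) ≤ s.alpha j / 2)
    (hp : |p| ≤ δ) (hq : |q| ≤ δ) (ht : 0 ≤ t) :
    ‖Complex.exp (Complex.I * (p + q * Complex.I) * x) * ((Complex.I * (p + q * Complex.I)) ^ n *
      s.modeError m M j a b (p + q * Complex.I) t)‖ ≤
    Real.exp (-(q * (x + s.beta j * t)) + 3 / 2 * s.alpha j * q ^ 2 * t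
        - s.alpha j / 2 * p ^ 2 * t) *
      (H * ‖(p : ℂ) + q * Complex.I‖ ^ (n + 3) * t * |s.M0 j a b|
        + H * (|s.M1 j a b| + H) * ‖(p : ℂ) + q * Complex.I‖ ^ (n + 4) * t
        + H * ‖(p : ℂ) + q * Complex.I‖ ^ (n + 2)) := by
  have hδ : 0 ≤ δ := (abs_nonneg p).trans hp
  have hn : ‖(p : ℂ) + q * Complex.I‖ ≤ 2 * δ := by
    refine (norm_add_le _ _).trans ?_
    rw [norm_mul, Complex.norm_I, mul_one, Complex.norm_real, Complex.norm_real, Real.norm_eq_abs,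
      Real.norm_eq_abs]
    linarith
  have h := hl.norm_modeError_le j a b ht (lt_of_le_of_lt hn hr) (hn.trans h1)
    ((mul_le_mul_of_nonneg_left hn hl.H_pos.le).trans hα)
  rw [norm_gaussHat, ← Real.exp_add] at h
  rw [norm_mul, norm_mul, norm_pow, norm_mul, Complex.norm_I, one_mul]
  have he : ‖Complex.exp (Complex.I * (p + q * Complex.I) * x)‖ = Real.exp (-(q * x)) := by
    rw [Complex.norm_exp]
    simp
  rw [he]
  refine (mul_le_mul_of_nonneg_left (mul_le_mul_of_nonneg_left h
    (pow_nonneg (norm_nonneg ((p : ℂ) + q * Complex.I)) n)) (Real.exp_pos (-(q * x))).le).trans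
    (le_of_eq ?_)
  have e : Real.exp (-(q * (x + s.beta j * t)) + 3 / 2 * s.alpha j * q ^ 2 * t
        - s.alpha j / 2 * p ^ 2 * t) = Real.exp (-(q * x)) *
      Real.exp ((-(q * s.beta j) + s.alpha j * (q ^ 2 - p ^ 2)) * t +
        s.alpha j / 2 * ‖(p : ℂ) + q * Complex.I‖ ^ 2 * t) := by
    rw [← Real.exp_add, sq_norm_add_mul_I]
    congr 1
    ring
  rw [e]
  ring

theorem mul_exp_neg_le {θ : ℝ} (hθ : 0 < θ) (t : ℝ) :
    t * Real.exp (-(θ * t)) ≤ 2 / θ * Real.exp (-(θ / 2 * t)) := by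
  have h := Real.add_one_le_exp (θ / 2 * t)
  have h2 : t ≤ 2 / θ * Real.exp (θ / 2 * t) := by
    rw [div_mul_eq_mul_div, le_div_iff₀ hθ]; linarith
  calc t * Real.exp (-(θ * t)) ≤ 2 / θ * Real.exp (θ / 2 * t) * Real.exp (-(θ * t)) := by gcongr
    _ = _ := by rw [mul_assoc, ← Real.exp_add]; ring_nf

/-- Moving the contour to the height `(x + β_j t) / (L t)` yields the Gaussian decay around the
characteristic `x + β_j t = 0`. -/
theorem LowFrequency.exists_mode_bound {s : GasState} (hs : s.Regular) {r H : ℝ}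
    {m : Fin 3 → ℂ → ℂ} {M : Fin 3 → Fin 3 → Fin 3 → ℂ → ℂ} (hl : s.LowFrequency r H m M)
    (j : Fin 3) {δ L X : ℝ} (hδ : 0 < δ) (hr : 2 * δ < r) (h1 : 2 * δ ≤ 1)
    (hα : H * (2 * δ) ≤ s.alpha j / 2) (hL : 3 * s.alpha j ≤ L) (hX : X + |s.beta j| ≤ δ * L) :
    ∃ O c : ℝ, 0 < O ∧ 0 < c ∧ ∀ x t : ℝ, 1 ≤ t → |x| ≤ X * t → ∀ n : ℕ, n ≤ 3 → ∀ a b,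
      ‖∫ η in -δ..δ, Complex.exp (Complex.I * η * x) * ((Complex.I * η) ^ n *
        s.modeError m M j a b η t)‖ ≤
      O * Real.exp (-(x + s.beta j * t) ^ 2 / (4 * L * t)) / t ^ (((n : ℝ) + 2) / 2)
          * |s.M0 j a b|
        + O * Real.exp (-(x + s.beta j * t) ^ 2 / (4 * L * t)) / t ^ (((n : ℝ) + 3) / 2)
        + O * Real.exp (-(c * t)) := by
  have hα0 := hs.alpha_pos j
  have hH := hl.H_pos
  have hL0 : 0 < L := by linarith
  set θ := min (L / 4) (s.alpha j / 4) with hθ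
  have hθ0 : 0 < θ := by positivity
  choose Cp hCp hpow using fun k => pow_mul_exp_le k hθ0
  set G := ∑ a, ∑ b, (|s.M0 j a b| + |s.M1 j a b|) + H with hG
  have hGle : ∀ a b, |s.M0 j a b| + |s.M1 j a b| + H ≤ G := fun a b => by
    have e1 := Finset.single_le_sum (f := fun b => |s.M0 j a b| + |s.M1 j a b|)
      (fun i _ => by positivity) (Finset.mem_univ b)
    have e2 := Finset.single_le_sum (f := fun a => ∑ b, (|s.M0 j a b| + |s.M1 j a b|))
      (fun i _ => Finset.sum_nonneg fun b _ => by positivity) (Finset.mem_univ a)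
    linarith
  have hG0 : 0 < G := by positivity
  set Cs := ∑ k ∈ Finset.range 8, Cp k with hCs
  have hCle : ∀ k < 8, Cp k ≤ Cs := fun k hk =>
    Finset.single_le_sum (fun i _ => (hCp i).le) (Finset.mem_range.2 hk)
  have hCs0 : 0 < Cs := lt_of_lt_of_le (hCp 0) (hCle 0 (by norm_num))
  set Q := Real.sqrt (Real.pi / (s.alpha j / 4)) with hQ
  have hQ0 : 0 < Q := by positivity
  set O1 := H * Cs * Q * (1 + G) with hO1
  set O2 := 2 * δ * (H * (2 * G + 1)) * (2 / (s.alpha j / 2 * δ ^ 2)) with hO2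
  have hO1p : 0 < O1 := by positivity
  have hO2p : 0 < O2 := by positivity
  refine ⟨O1 + O2, s.alpha j / 2 * δ ^ 2 / 2, by positivity, by positivity,
    fun x t ht hx n hn a b => ?_⟩
  have ht0 : 0 < t := by linarith
  set y := x + s.beta j * t with hy
  set q := y / (L * t) with hq
  have hqy : y = q * (L * t) := by rw [hq]; field_simp
  have hqδ : |q| ≤ δ := by
    rw [hq, abs_div, abs_of_pos (by positivity : 0 < L * t), div_le_iff₀ (by positivity)]
    calc |y| ≤ |x| + |s.beta j| * t := by
          rw [hy]; refine (abs_add_le _ _).trans ?_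
          rw [abs_mul, abs_of_pos ht0]
      _ ≤ (X + |s.beta j|) * t := by linarith
      _ ≤ δ * L * t := by gcongr
      _ = _ := by ring
  set A0 := |s.M0 j a b| with hA0
  set A1 := |s.M1 j a b| with hA1
  have hA0n : 0 ≤ A0 := abs_nonneg _
  have hA1n : 0 ≤ A1 := abs_nonneg _
  have hAG := hGle a b
  -- the bound on the shifted line
  set B := H * (Cs * t ^ (-(((n + 3 : ℕ) : ℝ) / 2))) * t * A0
    + H * (A1 + H) * (Cs * t ^ (-(((n + 4 : ℕ) : ℝ) / 2))) * t
    + H * (Cs * t ^ (-(((n + 2 : ℕ) : ℝ) / 2))) with hB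
  have hB0 : 0 ≤ B := by positivity
  set ey := Real.exp (-y ^ 2 / (4 * L * t)) with hey
  have hgi := integral_exp_neg_mul_sq_mul (θ := s.alpha j / 4) (by positivity) ht0
  have hmain := norm_integral_le_of_shift (δ := δ) (b := q)
    (f := fun η => Complex.exp (Complex.I * η * x) * ((Complex.I * η) ^ n *
        s.modeError m M j a b η t))
    (g := fun p => ey * B * Real.exp (-(s.alpha j / 4 * p ^ 2 * t)))
    (S := Real.exp (-(s.alpha j / 2 * δ ^ 2 * t)) * (t * (H * (2 * G + 1)))) hδ.le ?_
    (hgi.1.const_mul _) (fun p => by positivity) ?_ ?_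
  · refine hmain.trans ?_
    rw [integral_const_mul, hgi.2, ← hQ]
    have hside : 2 * |q| * (Real.exp (-(s.alpha j / 2 * δ ^ 2 * t)) * (t * (H * (2 * G + 1)))) ≤
        O2 * Real.exp (-(s.alpha j / 2 * δ ^ 2 / 2 * t)) := by
      have h3 := mul_exp_neg_le (by positivity : 0 < s.alpha j / 2 * δ ^ 2) t
      calc _ ≤ 2 * δ * (Real.exp (-(s.alpha j / 2 * δ ^ 2 * t)) * (t * (H * (2 * G + 1)))) := by
            gcongr
        _ = 2 * δ * (H * (2 * G + 1)) * (t * Real.exp (-(s.alpha j / 2 * δ ^ 2 * t))) := by ring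
        _ ≤ 2 * δ * (H * (2 * G + 1)) * (2 / (s.alpha j / 2 * δ ^ 2) *
              Real.exp (-(s.alpha j / 2 * δ ^ 2 / 2 * t))) := by gcongr
        _ = _ := by rw [hO2]; ring
    have hint : ey * B * (Q * t ^ (-(1 : ℝ) / 2)) ≤ O1 * ey / t ^ (((n : ℝ) + 2) / 2) * A0 +
        O1 * ey / t ^ (((n : ℝ) + 3) / 2) := by
      have hey0 : 0 ≤ ey := (Real.exp_pos _).le
      have p1 : t ^ (-(((n + 3 : ℕ) : ℝ) / 2)) * t * t ^ (-(1 : ℝ) / 2) =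
          (t ^ (((n : ℝ) + 2) / 2))⁻¹ := by
        rw [← Real.rpow_neg ht0.le]
        nth_rewrite 2 [← Real.rpow_one t]
        rw [← Real.rpow_add ht0, ← Real.rpow_add ht0]
        congr 1; push_cast; ring
      have p2 : t ^ (-(((n + 4 : ℕ) : ℝ) / 2)) * t * t ^ (-(1 : ℝ) / 2) =
          (t ^ (((n : ℝ) + 3) / 2))⁻¹ := by
        rw [← Real.rpow_neg ht0.le]
        nth_rewrite 2 [← Real.rpow_one t]
        rw [← Real.rpow_add ht0, ← Real.rpow_add ht0]
        congr 1; push_cast; ring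
      have p3 : t ^ (-(((n + 2 : ℕ) : ℝ) / 2)) * t ^ (-(1 : ℝ) / 2) =
          (t ^ (((n : ℝ) + 3) / 2))⁻¹ := by
        rw [← Real.rpow_neg ht0.le, ← Real.rpow_add ht0]
        congr 1; push_cast; ring
      have e1 : ey * B * (Q * t ^ (-(1 : ℝ) / 2)) = H * Cs * Q * ey *
          ((t ^ (((n : ℝ) + 2) / 2))⁻¹ * A0) + H * Cs * Q * (A1 + H + 1) * ey *
          (t ^ (((n : ℝ) + 3) / 2))⁻¹ := by
        have e2 : ey * B * (Q * t ^ (-(1 : ℝ) / 2)) = H * Cs * Q * ey *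
            ((t ^ (-(((n + 3 : ℕ) : ℝ) / 2)) * t * t ^ (-(1 : ℝ) / 2)) * A0) +
            H * Cs * Q * ey * ((A1 + H) * (t ^ (-(((n + 4 : ℕ) : ℝ) / 2)) * t * t ^ (-(1 : ℝ) / 2))
            + t ^ (-(((n + 2 : ℕ) : ℝ) / 2)) * t ^ (-(1 : ℝ) / 2)) := by
          rw [hB]; ring
        rw [e2, p1, p2, p3]
        ring
      have e3 : O1 * ey / t ^ (((n : ℝ) + 2) / 2) * A0 + O1 * ey / t ^ (((n : ℝ) + 3) / 2) =
          H * Cs * Q * (1 + G) * ey * ((t ^ (((n : ℝ) + 2) / 2))⁻¹ * A0) +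
            H * Cs * Q * (1 + G) * ey * (t ^ (((n : ℝ) + 3) / 2))⁻¹ := by
        rw [hO1]; ring
      rw [e1, e3]
      have q1 : 0 ≤ (t ^ (((n : ℝ) + 2) / 2))⁻¹ * A0 := by positivity
      have q2 : A1 + H + 1 ≤ 1 + G := by linarith
      have q3 : H * Cs * Q ≤ H * Cs * Q * (1 + G) :=
        le_mul_of_one_le_right (by positivity) (by linarith)
      exact add_le_add (mul_le_mul_of_nonneg_right (mul_le_mul_of_nonneg_right q3 hey0) q1)
        (by gcongr)
    have q1 : O1 * ey / t ^ (((n : ℝ) + 2) / 2) * A0 ≤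
        (O1 + O2) * ey / t ^ (((n : ℝ) + 2) / 2) * A0 := by gcongr; linarith
    have q2 : O1 * ey / t ^ (((n : ℝ) + 3) / 2) ≤ (O1 + O2) * ey / t ^ (((n : ℝ) + 3) / 2) := by
      gcongr; linarith
    have q3 : O2 * Real.exp (-(s.alpha j / 2 * δ ^ 2 / 2 * t)) ≤
        (O1 + O2) * Real.exp (-(s.alpha j / 2 * δ ^ 2 / 2 * t)) := by gcongr; linarith
    linarith
  · intro η hη
    refine DifferentiableAt.differentiableWithinAt ?_
    have hηr : ‖Complex.I * η‖ < r := by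
      rw [norm_mul, Complex.norm_I, one_mul]
      refine lt_of_le_of_lt (Complex.norm_le_abs_re_add_abs_im η) ?_
      have := hη.2.trans hqδ
      have := hη.1
      linarith
    have hm : DifferentiableAt ℂ (fun η => m j (Complex.I * η)) η :=
      (hl.m_diff j _ hηr).comp η (by fun_prop)
    have hM : DifferentiableAt ℂ (fun η => M j a b (Complex.I * η)) η :=
      (hl.M_diff j a b _ hηr).comp η (by fun_prop)
    unfold modeError gaussHat
    have hI : DifferentiableAt ℂ (fun η : ℂ => Complex.I * η) η := by fun_prop
    refine DifferentiableAt.mul (by fun_prop) (DifferentiableAt.mul (by fun_prop) ?_)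
    exact ((((hI.mul hm).mul_const _).cexp).mul hM).sub (by fun_prop)
  · intro p hp
    refine (hl.norm_integrand_le j a b n hr h1 hα hp hqδ ht0.le).trans ?_
    set N := ‖(p : ℂ) + q * Complex.I‖ with hN
    have hN2 : N ^ 2 = p ^ 2 + q ^ 2 := sq_norm_add_mul_I p q
    have hN0 : 0 ≤ N := norm_nonneg _
    have hexp : Real.exp (-(q * y) + 3 / 2 * s.alpha j * q ^ 2 * t - s.alpha j / 2 * p ^ 2 * t) ≤
        ey * Real.exp (-(s.alpha j / 4 * p ^ 2 * t)) * Real.exp (-(θ * N ^ 2 * t)) := by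
      rw [hey, ← Real.exp_add, ← Real.exp_add, Real.exp_le_exp]
      have e1 : -y ^ 2 / (4 * L * t) = -(L / 4 * q ^ 2 * t) := by
        rw [hqy]; field_simp
      have e2 : q * y = L * q ^ 2 * t := by rw [hqy]; ring
      have e3 : θ * N ^ 2 * t ≤ s.alpha j / 4 * p ^ 2 * t + L / 4 * q ^ 2 * t := by
        rw [hN2]
        have f1 : θ * p ^ 2 * t ≤ s.alpha j / 4 * p ^ 2 * t := by
          gcongr; exact min_le_right _ _
        have f2 : θ * q ^ 2 * t ≤ L / 4 * q ^ 2 * t := by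
          gcongr; exact min_le_left _ _
        linarith
      have e4 : 3 * s.alpha j * (q ^ 2 * t) ≤ L * (q ^ 2 * t) := by gcongr
      rw [e1, e2]
      linarith
    have hk : ∀ k : ℕ, k < 8 → Real.exp (-(θ * N ^ 2 * t)) * N ^ k ≤ Cs * t ^ (-((k : ℝ) / 2)) := by
      intro k hk
      rw [mul_comm]
      refine (hpow k N t hN0 ht0).trans ?_
      gcongr
      exact hCle k hk
    calc _ ≤ ey * Real.exp (-(s.alpha j / 4 * p ^ 2 * t)) * Real.exp (-(θ * N ^ 2 * t)) *
          (H * N ^ (n + 3) * t * A0 + H * (A1 + H) * N ^ (n + 4) * t + H * N ^ (n + 2)) := by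
          gcongr
      _ = ey * Real.exp (-(s.alpha j / 4 * p ^ 2 * t)) *
          (H * (Real.exp (-(θ * N ^ 2 * t)) * N ^ (n + 3)) * t * A0 + H * (A1 + H) *
          (Real.exp (-(θ * N ^ 2 * t)) * N ^ (n + 4)) * t +
          H * (Real.exp (-(θ * N ^ 2 * t)) * N ^ (n + 2))) := by ring
      _ ≤ ey * Real.exp (-(s.alpha j / 4 * p ^ 2 * t)) * B := by
          rw [hB]
          refine mul_le_mul_of_nonneg_left (add_le_add (add_le_add ?_ ?_) ?_) (by positivity)
          · exact mul_le_mul_of_nonneg_right (mul_le_mul_of_nonneg_right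
              (mul_le_mul_of_nonneg_left (hk (n + 3) (by omega)) hH.le) ht0.le) hA0n
          · exact mul_le_mul_of_nonneg_right
              (mul_le_mul_of_nonneg_left (hk (n + 4) (by omega)) (by positivity)) ht0.le
          · exact mul_le_mul_of_nonneg_left (hk (n + 2) (by omega)) hH.le
      _ = _ := by ring
  · intro y' hy' hyq
    have hy'δ : |y'| ≤ δ := hy'.trans hqδ
    have hside : ∀ p : ℝ, |p| = δ → ‖Complex.exp (Complex.I * (p + y' * Complex.I) * x) *
        ((Complex.I * (p + y' * Complex.I)) ^ n *
          s.modeError m M j a b (p + y' * Complex.I) t)‖ ≤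
        Real.exp (-(s.alpha j / 2 * δ ^ 2 * t)) * (t * (H * (2 * G + 1))) := by
      intro p hp
      refine (hl.norm_integrand_le j a b n hr h1 hα hp.le hy'δ ht0.le).trans ?_
      have hn1 : ‖(p : ℂ) + y' * Complex.I‖ ≤ 1 := by
        refine (norm_add_le _ _).trans ?_
        rw [norm_mul, Complex.norm_I, mul_one, Complex.norm_real, Complex.norm_real,
          Real.norm_eq_abs, Real.norm_eq_abs]
        linarith
      have hpk : ∀ k, ‖(p : ℂ) + y' * Complex.I‖ ^ k ≤ 1 := fun k =>
        pow_le_one₀ (norm_nonneg _) hn1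
      have hp2 : p ^ 2 = δ ^ 2 := by rw [← sq_abs, hp]
      gcongr
      · rw [← hy, hqy, hp2]
        have e1 : y' ^ 2 ≤ y' * q := by
          have : |y'| * |y'| ≤ |y'| * |q| := by gcongr
          rw [← abs_mul y' q, abs_of_nonneg hyq] at this
          rw [← sq_abs, pow_two]
          exact this
        have e2 : 3 * s.alpha j * (y' ^ 2 * t) ≤ L * (y' ^ 2 * t) := by gcongr
        have e3 : L * (y' ^ 2 * t) ≤ L * (y' * q * t) := by gcongr
        have e4 : 0 ≤ L * (y' ^ 2 * t) := by positivity
        linarith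
      · calc _ ≤ H * 1 * t * A0 + H * (A1 + H) * 1 * t + H * 1 := by
              gcongr <;> exact hpk _
          _ = t * (H * (A0 + A1 + H)) + H * 1 := by ring
          _ ≤ t * (H * G) + H * t := by gcongr
          _ ≤ _ := by
            have : 0 ≤ t * (H * G) := by positivity
            linarith
    have := hside (-δ) (by rw [abs_neg, abs_of_pos hδ])
    push_cast at this
    exact ⟨hside δ (abs_of_pos hδ), this⟩

end GasState

/-! ### Estimates away from the characteristics -/

theorem norm_pow_le_of_abs_im_le {η : ℂ} (hη : |η.im| ≤ 1) {n : ℕ} (hn : n ≤ 4) :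
    ‖η‖ ^ n ≤ (1 + η.re ^ 2) ^ 2 := by
  have h1 : ‖η‖ ^ 2 ≤ 1 + η.re ^ 2 := by
    rw [← Complex.normSq_eq_norm_sq, Complex.normSq_apply]
    have : η.im ^ 2 ≤ 1 := (sq_le_one_iff_abs_le_one _).2 hη
    nlinarith
  rcases le_total ‖η‖ 1 with h | h
  · refine (pow_le_one₀ (norm_nonneg _) h).trans (one_le_pow₀ ?_)
    nlinarith [sq_nonneg η.re]
  · calc ‖η‖ ^ n ≤ ‖η‖ ^ 4 := pow_le_pow_right₀ h hn
      _ = (‖η‖ ^ 2) ^ 2 := by ring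
      _ ≤ _ := by gcongr

theorem norm_pow_mul_le_of_le {f : ℂ → ℂ} {D : ℝ} {η : ℂ} (hη : |η.im| ≤ 1)
    (hf : ‖f η‖ ≤ D / (1 + η.re ^ 2) ^ 3) {n : ℕ} (hn : n ≤ 4) :
    ‖(Complex.I * η) ^ n * f η‖ ≤ D / (1 + η.re ^ 2) := by
  rw [norm_mul, norm_pow, norm_mul, Complex.norm_I, one_mul]
  calc ‖η‖ ^ n * ‖f η‖ ≤ (1 + η.re ^ 2) ^ 2 * (D / (1 + η.re ^ 2) ^ 3) := by
        gcongr
        exact norm_pow_le_of_abs_im_le hη hn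
    _ = _ := by field_simp

theorem integrable_pow_mul_of_strip {f : ℂ → ℂ} {σ D : ℝ} (hσ : 0 < σ)
    (hf : DifferentiableOn ℂ f {z | |z.im| < σ})
    (hD : ∀ a : ℝ, ‖f a‖ ≤ D / (1 + a ^ 2) ^ 3) {n : ℕ} (hn : n ≤ 4) :
    Integrable (fun a : ℝ => (Complex.I * a) ^ n * f a) := by
  refine (integrable_inv_one_add_sq.const_mul D).mono' ?_ (Eventually.of_forall fun a => ?_)
  · refine Continuous.aestronglyMeasurable (Continuous.mul (by fun_prop) ?_)
    exact hf.continuousOn.comp_continuous (by fun_prop) fun a => by simpa using hσ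
  · have := norm_pow_mul_le_of_le (f := f) (η := (a : ℂ)) (by simp) (by simpa using hD a) hn
    simpa [div_eq_mul_inv] using this

/-- Moving the contour to `Im η = ± b`, with the sign of `x`, yields exponential decay in `x`. -/
theorem norm_fourierInt_le_of_strip {f : ℂ → ℂ} {σ b D : ℝ} (hb0 : 0 ≤ b) (hb : b < σ)
    (hb1 : b ≤ 1) (hf : DifferentiableOn ℂ f {z | |z.im| < σ})
    (hD : ∀ η : ℂ, |η.im| ≤ b → ‖f η‖ ≤ D / (1 + η.re ^ 2) ^ 3) {n : ℕ} (hn : n ≤ 4) (x : ℝ) :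
    ‖fourierInt (fun η : ℝ => f η) n x‖ ≤ Real.pi * D * Real.exp (-(b * |x|)) := by
  obtain ⟨b', hb', hx⟩ : ∃ b' : ℝ, |b'| = b ∧ b' * x = b * |x| := by
    rcases le_total 0 x with h | h
    · exact ⟨b, abs_of_nonneg hb0, by rw [abs_of_nonneg h]⟩
    · exact ⟨-b, by rw [abs_neg, abs_of_nonneg hb0], by rw [abs_of_nonpos h]; ring⟩
  have hF : ∀ a y : ℝ, |y| ≤ b → ‖Complex.exp (Complex.I * (a + y * Complex.I) * x) *
      ((Complex.I * (a + y * Complex.I)) ^ n * f (a + y * Complex.I))‖ ≤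
      Real.exp (-(y * x)) * (D / (1 + a ^ 2)) := by
    intro a y hy
    have e1 : ‖Complex.exp (Complex.I * (a + y * Complex.I) * x)‖ = Real.exp (-(y * x)) := by
      rw [Complex.norm_exp]
      simp
    rw [norm_mul, e1]
    have e2 := norm_pow_mul_le_of_le (f := f) (η := a + y * Complex.I)
      (by simpa using hy.trans hb1) (hD _ (by simpa using hy)) hn
    simp only [Complex.add_re, Complex.ofReal_re, Complex.mul_re, Complex.I_re, mul_zero,
      Complex.ofReal_im, Complex.I_im, mul_one, sub_self, add_zero] at e2
    gcongr
  have hD0 : 0 ≤ D := by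
    have := (norm_nonneg _).trans (hD 0 (by simpa using hb0))
    simpa using this
  have hs := integral_shift (f := fun η => Complex.exp (Complex.I * η * x) *
      ((Complex.I * η) ^ n * f η)) (σ := σ) (b := b') (D := Real.exp (b * |x|) * D)
    (by rwa [hb']) ?_ ?_
  · rw [fourierInt, hs.2]
    refine (norm_integral_le_of_norm_le
      (integrable_inv_one_add_sq.const_mul (Real.exp (-(b * |x|)) * D))
      (Eventually.of_forall fun a => ?_)).trans ?_
    · refine (hF a b' hb'.le).trans (le_of_eq ?_)
      rw [hx]; ring
    · rw [integral_const_mul, integral_univ_inv_one_add_sq]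
      apply le_of_eq; ring
  · exact DifferentiableOn.mul (by fun_prop) (DifferentiableOn.mul (by fun_prop) hf)
  · intro a y hy
    rw [hb'] at hy
    refine (hF a y hy).trans ?_
    rw [mul_div_assoc]
    gcongr
    calc -(y * x) ≤ |y * x| := neg_le_abs _
      _ = |y| * |x| := abs_mul _ _
      _ ≤ _ := by gcongr

theorem fourierInt_sub {f g : ℝ → ℂ} {n : ℕ}
    (hf : Integrable (fun η : ℝ => (Complex.I * η) ^ n * f η))
    (hg : Integrable (fun η : ℝ => (Complex.I * η) ^ n * g η)) (x : ℝ) :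
    fourierInt (fun η => f η - g η) n x = fourierInt f n x - fourierInt g n x := by
  have h : ∀ {f : ℝ → ℂ}, Integrable (fun η : ℝ => (Complex.I * η) ^ n * f η) →
      Integrable (fun η : ℝ => Complex.exp (Complex.I * η * x) * ((Complex.I * η) ^ n * f η)) := by
    intro f hf
    refine hf.norm.mono' ((Continuous.aestronglyMeasurable (by fun_prop)).mul hf.1)
      (Eventually.of_forall fun η => ?_)
    rw [norm_mul, norm_exp_I_mul, one_mul]
  simp only [fourierInt]
  rw [← integral_sub (h hf) (h hg)]
  refine integral_congr_ae (Eventually.of_forall fun η => ?_)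
  simp only
  ring

theorem exists_exp_neg_mul_sq_le {θ : ℝ} (hθ : 0 < θ) :
    ∃ C : ℝ, 0 < C ∧ ∀ a : ℝ, Real.exp (-(θ * a ^ 2)) ≤ C / (1 + a ^ 2) ^ 4 := by
  obtain ⟨C, hC, h⟩ := pow_mul_exp_le 8 hθ
  refine ⟨Real.exp θ * C, by positivity, fun a => ?_⟩
  have h1 := h (Real.sqrt (1 + a ^ 2)) 1 (Real.sqrt_nonneg _) one_pos
  rw [Real.sq_sqrt (by positivity), Real.one_rpow, mul_one, mul_one,
    show Real.sqrt (1 + a ^ 2) ^ 8 = (Real.sqrt (1 + a ^ 2) ^ 2) ^ 4 by ring,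
    Real.sq_sqrt (by positivity)] at h1
  rw [le_div_iff₀ (by positivity)]
  calc Real.exp (-(θ * a ^ 2)) * (1 + a ^ 2) ^ 4 =
        Real.exp θ * ((1 + a ^ 2) ^ 4 * Real.exp (-(θ * (1 + a ^ 2)))) := by
        rw [mul_left_comm, ← Real.exp_add, mul_comm]; ring_nf
    _ ≤ _ := by gcongr

namespace GasState

theorem exists_abs_M_le (s : GasState) :
    ∃ G : ℝ, 0 < G ∧ ∀ j a b, |s.M0 j a b| ≤ G ∧ |s.M1 j a b| ≤ G := by
  have h : ∀ f : Fin 3 → Fin 3 → Fin 3 → ℝ, ∀ j a b, |f j a b| ≤ ∑ j, ∑ a, ∑ b, |f j a b| := by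
    intro f j a b
    refine (Finset.single_le_sum (f := fun b => |f j a b|) (fun _ _ => abs_nonneg _)
      (Finset.mem_univ b)).trans ?_
    refine (Finset.single_le_sum (f := fun a => ∑ b, |f j a b|)
      (fun _ _ => by positivity) (Finset.mem_univ a)).trans ?_
    exact Finset.single_le_sum (f := fun j => ∑ a, ∑ b, |f j a b|)
      (fun _ _ => by positivity) (Finset.mem_univ j)
  have n0 : 0 ≤ ∑ j, ∑ a, ∑ b, |s.M0 j a b| := by positivity
  have n1 : 0 ≤ ∑ j, ∑ a, ∑ b, |s.M1 j a b| := by positivity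
  exact ⟨1 + ∑ j, ∑ a, ∑ b, |s.M0 j a b| + ∑ j, ∑ a, ∑ b, |s.M1 j a b|, by positivity,
    fun j a b => ⟨by linarith [h (fun j => s.M0 j) j a b], by linarith [h (fun j => s.M1 j) j a b]⟩⟩

theorem exists_alpha_ge {s : GasState} (hs : s.Regular) :
    ∃ α : ℝ, 0 < α ∧ ∀ j, α ≤ s.alpha j := by
  refine ⟨min (s.alpha 0) (min (s.alpha 1) (s.alpha 2)),
    lt_min (hs.alpha_pos 0) (lt_min (hs.alpha_pos 1) (hs.alpha_pos 2)), fun j => ?_⟩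
  fin_cases j <;> simp

theorem norm_profileHat_le {s : GasState} {G : ℝ}
    (hG : ∀ j a b, |s.M0 j a b| ≤ G ∧ |s.M1 j a b| ≤ G) {η : ℂ} (hη : |η.im| ≤ 1) (t D : ℝ)
    (hD : ∀ j, ‖s.gaussHat j η t‖ ≤ D / (1 + η.re ^ 2) ^ 4) (a b : Fin 3) :
    ‖s.profileHat a b η t‖ ≤ 6 * G * D / (1 + η.re ^ 2) ^ 3 := by
  have hG0 : 0 ≤ G := (abs_nonneg _).trans (hG 0 0 0).1
  have hη1 : ‖η‖ ≤ 1 + η.re ^ 2 := by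
    have h := norm_pow_le_of_abs_im_le (n := 2) hη (by norm_num)
    exact le_of_sq_le_sq h (by positivity)
  have h1 : (1 : ℝ) ≤ 1 + η.re ^ 2 := by nlinarith [sq_nonneg η.re]
  calc ‖s.profileHat a b η t‖ ≤
        ∑ _j : Fin 3, D / (1 + η.re ^ 2) ^ 4 * (2 * G * (1 + η.re ^ 2)) := by
        refine (norm_sum_le _ _).trans (Finset.sum_le_sum fun j _ => ?_)
        rw [norm_mul]
        refine mul_le_mul (hD j) ?_ (norm_nonneg _) ((norm_nonneg _).trans (hD j))
        refine (norm_add_le _ _).trans ?_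
        rw [norm_mul, norm_mul, Complex.norm_I, one_mul, Complex.norm_real, Complex.norm_real,
          Real.norm_eq_abs, Real.norm_eq_abs]
        calc _ ≤ G * (1 + η.re ^ 2) + (1 + η.re ^ 2) * G := by
              gcongr
              · exact (hG j a b).1.trans (le_mul_of_one_le_right hG0 h1)
              · exact (hG j a b).2
          _ = _ := by ring
    _ = _ := by
      rw [Finset.sum_const, Finset.card_univ, Fintype.card_fin, nsmul_eq_mul]
      push_cast
      field_simp
      ring

theorem exists_profileHat_strip_bound {s : GasState} (hs : s.Regular) :
    ∃ C K : ℝ, 0 < C ∧ 0 < K ∧ ∀ (η : ℂ) (t : ℝ), |η.im| ≤ 1 → 1 ≤ t → ∀ a b,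
      ‖s.profileHat a b η t‖ ≤ C * Real.exp (K * t) / (1 + η.re ^ 2) ^ 3 := by
  obtain ⟨G, hG0, hG⟩ := s.exists_abs_M_le
  obtain ⟨α, hα0, hα⟩ := exists_alpha_ge hs
  obtain ⟨C, hC, h⟩ := exists_exp_neg_mul_sq_le hα0
  have hK : ∀ j, |s.beta j| + s.alpha j ≤ ∑ j, (|s.beta j| + s.alpha j) := fun j =>
    Finset.single_le_sum (f := fun j => |s.beta j| + s.alpha j)
      (fun i _ => add_nonneg (abs_nonneg _) (hs.alpha_pos i).le) (Finset.mem_univ j)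
  refine ⟨6 * G * C, ∑ j, (|s.beta j| + s.alpha j), by positivity, ?_, fun η t hη ht a b => ?_⟩
  · exact lt_of_lt_of_le (add_pos_of_nonneg_of_pos (abs_nonneg _) (hs.alpha_pos 0)) (hK 0)
  · rw [mul_assoc (6 * G)]
    refine norm_profileHat_le hG hη t _ (fun j => ?_) a b
    have e := s.norm_gaussHat j η.re η.im t
    rw [Complex.re_add_im] at e
    rw [e, mul_comm C, mul_div_assoc]
    refine le_trans ?_ (mul_le_mul_of_nonneg_left (h η.re) (Real.exp_pos _).le)
    rw [← Real.exp_add, Real.exp_le_exp]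
    have ht0 : 0 ≤ t := by linarith
    have e1 : -(η.im * s.beta j) ≤ |s.beta j| := by
      calc -(η.im * s.beta j) ≤ |η.im * s.beta j| := neg_le_abs _
        _ = |η.im| * |s.beta j| := abs_mul _ _
        _ ≤ 1 * |s.beta j| := by gcongr
        _ = _ := one_mul _
    have e2 : s.alpha j * η.im ^ 2 ≤ s.alpha j * 1 :=
      mul_le_mul_of_nonneg_left ((sq_le_one_iff_abs_le_one _).2 hη) (hs.alpha_pos j).le
    have e3 : α * η.re ^ 2 ≤ s.alpha j * η.re ^ 2 * t :=
      (mul_le_mul_of_nonneg_right (hα j) (sq_nonneg _)).trans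
        (le_mul_of_one_le_right (mul_nonneg (hs.alpha_pos j).le (sq_nonneg _)) ht)
    have e4 := mul_le_mul_of_nonneg_right (add_le_add e1 e2) ht0
    have e5 := mul_le_mul_of_nonneg_right (hK j) ht0
    linarith

theorem exists_profileHat_decay {s : GasState} (hs : s.Regular) {δ : ℝ} (hδ : 0 < δ) :
    ∃ C c : ℝ, 0 < C ∧ 0 < c ∧ ∀ η t : ℝ, δ ≤ |η| → 1 ≤ t → ∀ a b,
      ‖s.profileHat a b η t‖ ≤ C * Real.exp (-(c * t)) / (1 + η ^ 2) ^ 3 := by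
  obtain ⟨G, hG0, hG⟩ := s.exists_abs_M_le
  obtain ⟨α, hα0, hα⟩ := exists_alpha_ge hs
  obtain ⟨C, hC, h⟩ := exists_exp_neg_mul_sq_le (half_pos hα0)
  refine ⟨6 * G * C, α / 2 * δ ^ 2, by positivity, by positivity, fun η t hη ht a b => ?_⟩
  rw [mul_assoc (6 * G)]
  have := norm_profileHat_le hG (η := (η : ℂ)) (by simp) t
    (C * Real.exp (-(α / 2 * δ ^ 2 * t))) (fun j => ?_) a b
  · simpa using this
  · rw [norm_gaussHat_ofReal, Complex.ofReal_re, mul_comm C, mul_div_assoc]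
    refine le_trans ?_ (mul_le_mul_of_nonneg_left (h η) (Real.exp_pos _).le)
    rw [← Real.exp_add, Real.exp_le_exp]
    have h1 : δ ^ 2 ≤ η ^ 2 := by rw [← sq_abs η]; gcongr
    have e1 : α / 2 * δ ^ 2 * t ≤ α / 2 * η ^ 2 * t := by gcongr
    have e2 : α / 2 * η ^ 2 ≤ α / 2 * η ^ 2 * t := le_mul_of_one_le_right (by positivity) ht
    have e3 : α * (η ^ 2 * t) ≤ s.alpha j * (η ^ 2 * t) := by
      gcongr; exact hα j
    linarith

theorem differentiable_profileHat (s : GasState) (a b : Fin 3) (t : ℝ) :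
    Differentiable ℂ (fun η => s.profileHat a b η t) := by
  unfold profileHat gaussHat
  fun_prop

namespace Gap

variable {s : GasState} {Kc : Fin 3 → ℝ} {σ σs σ1 : ℝ}

theorem integrable_regC (hg : s.Gap Kc σ σs σ1) (hs : s.Regular) {t : ℝ} (ht : 0 ≤ t)
    (a b : Fin 3) {n : ℕ} (hn : n ≤ 4) :
    Integrable (fun η : ℝ => (Complex.I * η) ^ n * s.regC Kc η t a b) := by
  obtain ⟨C, K, -, -, h⟩ := hg.exists_regC_strip_bound hs le_rfl hg.pos
  exact integrable_pow_mul_of_strip hg.pos (hg.differentiableOn_regC t a b)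
    (fun η => by simpa using h η t (by simp) ht a b) hn

theorem reg_eq (Kc : Fin 3 → ℝ) (t : ℝ) (a b : Fin 3) :
    (fun x => s.reg Kc x t a b) = fun x =>
      (2 * (Real.pi : ℂ))⁻¹ * fourierInt (fun η => s.regC Kc η t a b) 0 x := by
  funext x
  simp [reg, fourierInt, regHat_eq]

theorem contDiff_reg (hg : s.Gap Kc σ σs σ1) (hs : s.Regular) {t : ℝ} (ht : 0 ≤ t)
    (a b : Fin 3) : ContDiff ℝ 3 (fun x => s.reg Kc x t a b) := by
  rw [reg_eq]
  exact contDiff_const.mul (contDiff_fourierInt (n := 3) fun k hk =>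
    hg.integrable_regC hs ht a b (by omega))

theorem dxReg_eq (hg : s.Gap Kc σ σs σ1) (hs : s.Regular) {t : ℝ} (ht : 0 ≤ t) (a b : Fin 3)
    {n : ℕ} (hn : n ≤ 3) (x : ℝ) :
    s.dxReg Kc n x t a b =
      (2 * (Real.pi : ℂ))⁻¹ * fourierInt (fun η => s.regC Kc η t a b) n x := by
  have hi : ∀ k ≤ 3, Integrable (fun η : ℝ => (Complex.I * η) ^ k * s.regC Kc η t a b) :=
    fun k hk => hg.integrable_regC hs ht a b (by omega)
  rw [dxReg, Matrix.of_apply, reg_eq, iteratedDeriv_const_mul_field,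
    iteratedDeriv_fourierInt hi n hn]

theorem norm_two_pi_inv_mul_le (z : ℂ) : ‖(2 * (Real.pi : ℂ))⁻¹ * z‖ ≤ ‖z‖ := by
  rw [norm_mul, norm_inv, norm_mul, Complex.norm_real, Real.norm_of_nonneg Real.pi_pos.le]
  refine mul_le_of_le_one_left (norm_nonneg _) (inv_le_one_of_one_le₀ ?_)
  simp
  linarith [Real.pi_gt_three]

/-- The regular part for small times. -/
theorem exists_small_time_bound (hg : s.Gap Kc σ σs σ1) (hs : s.Regular) :
    ∃ C : ℝ, 0 < C ∧ ∀ t x : ℝ, 0 < t → t < 1 → ∀ n ≤ 3, ∀ a b,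
      ‖s.dxReg Kc n x t a b‖ ≤ C * t * Real.exp (-(σ / 2 * |x|)) := by
  have hσ := hg.pos
  have hσ1 := hg.lt_one
  obtain ⟨C, K, hC, hK, h⟩ := hg.exists_regC_strip_bound hs (half_pos hg.pos).le
    (half_lt_self hg.pos)
  refine ⟨Real.pi * C * Real.exp K, by positivity, fun t x ht ht1 n hn a b => ?_⟩
  rw [hg.dxReg_eq hs ht.le a b hn]
  refine (norm_two_pi_inv_mul_le _).trans ?_
  refine (norm_fourierInt_le_of_strip (half_pos hσ).le (half_lt_self hσ) (by linarith)
    (hg.differentiableOn_regC t a b) (fun η hη => h η t hη ht.le a b) (by omega) x).trans ?_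
  calc Real.pi * (C * t * Real.exp (K * t)) * Real.exp (-(σ / 2 * |x|)) ≤
        Real.pi * (C * t * Real.exp (K * 1)) * Real.exp (-(σ / 2 * |x|)) := by gcongr
    _ = _ := by rw [mul_one]; ring

/-- The difference between the regular part and the profile, for `x` outside the domain of
influence of the waves. -/
theorem exists_far_bound (hg : s.Gap Kc σ σs σ1) (hs : s.Regular) :
    ∃ C X : ℝ, 0 < C ∧ 0 < X ∧ ∀ t x : ℝ, 1 ≤ t → X * t ≤ |x| → ∀ n ≤ 3, ∀ a b,
      ‖fourierInt (fun η => s.regC Kc η t a b - s.profileHat a b η t) n x‖ ≤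
        C * Real.exp (-t - σ / 4 * |x|) := by
  have hσ := hg.pos
  have hσ1 := hg.lt_one
  obtain ⟨C, K, hC, hK, h⟩ := hg.exists_regC_strip_bound hs (half_pos hg.pos).le
    (half_lt_self hg.pos)
  obtain ⟨C', K', hC', hK', h'⟩ := exists_profileHat_strip_bound hs
  set k := K + 1 + K' with hk
  refine ⟨Real.pi * (C + C'), 4 * (k + 1) / σ, by positivity, by positivity,
    fun t x ht hx n hn a b => ?_⟩
  have hbound := norm_fourierInt_le_of_strip (half_pos hσ).le (half_lt_self hσ) (by linarith)
    ((hg.differentiableOn_regC t a b).sub (s.differentiable_profileHat a b t).differentiableOn)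
    (D := (C + C') * Real.exp (k * t)) (fun η hη => ?_) (n := n) (by omega) x
  · refine hbound.trans ?_
    rw [← mul_assoc, mul_assoc _ (Real.exp _), ← Real.exp_add]
    gcongr
    rw [div_mul_eq_mul_div, div_le_iff₀ hσ] at hx
    linarith
  · refine (norm_sub_le _ _).trans ?_
    have e1 := h η t hη (by linarith) a b
    have e2 := h' η t (by linarith) ht a b
    refine (add_le_add e1 e2).trans ?_
    rw [← add_div]
    gcongr
    have ht1 : t ≤ Real.exp t := by linarith [Real.add_one_le_exp t]
    calc C * t * Real.exp (K * t) + C' * Real.exp (K' * t) ≤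
          C * Real.exp t * Real.exp (K * t) + C' * Real.exp (K' * t) := by gcongr
      _ = C * Real.exp ((K + 1) * t) + C' * Real.exp (K' * t) := by
          rw [mul_assoc, ← Real.exp_add]; ring_nf
      _ ≤ C * Real.exp (k * t) + C' * Real.exp (k * t) := by
          gcongr <;> linarith
      _ = _ := by ring

/-! ### Estimates near the characteristics -/

/-- The frequencies away from the origin contribute an exponentially small amount. -/
theorem exists_high_frequency_bound (hg : s.Gap Kc σ σs σ1) (hs : s.Regular) {δ : ℝ}
    (hδ : 0 < δ) :
    ∃ C c : ℝ, 0 < C ∧ 0 < c ∧ ∀ t x : ℝ, 1 ≤ t → ∀ n ≤ 3, ∀ a b,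
      ‖∫ η in (Set.Ioc (-δ) δ)ᶜ, Complex.exp (Complex.I * (η : ℝ) * x) * ((Complex.I * η) ^ n *
        (s.regC Kc η t a b - s.profileHat a b η t))‖ ≤ C * Real.exp (-(c * t)) := by
  obtain ⟨C, c, hC, hc, h⟩ := hg.exists_regC_decay hs hδ
  obtain ⟨C', c', hC', hc', h'⟩ := exists_profileHat_decay hs hδ
  set m := min (c / 2) c' with hm
  have hm0 : 0 < m := by positivity
  set D := C * (2 / c) + C' with hD
  have hD0 : 0 < D := by positivity
  refine ⟨Real.pi * D, m, by positivity, hm0, fun t x ht n hn a b => ?_⟩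
  have ht0 : 0 ≤ t := by linarith
  have hi : Integrable (fun η : ℝ => D * Real.exp (-(m * t)) * (1 + η ^ 2)⁻¹) :=
    integrable_inv_one_add_sq.const_mul _
  refine (norm_integral_le_of_norm_le hi.integrableOn ?_).trans ?_
  · refine (ae_restrict_iff' measurableSet_Ioc.compl).2 (Eventually.of_forall fun η hη => ?_)
    have hηδ : δ ≤ |η| := by
      by_contra hlt
      have := abs_lt.1 (not_le.1 hlt)
      exact hη ⟨this.1, this.2.le⟩
    rw [norm_mul, norm_exp_I_mul, one_mul, ← div_eq_mul_inv]
    have hb : ‖s.regC Kc η t a b - s.profileHat a b η t‖ ≤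
        D * Real.exp (-(m * t)) / (1 + η ^ 2) ^ 3 := by
      refine (norm_sub_le _ _).trans
        ((add_le_add (h η t hηδ ht0 a b) (h' η t hηδ ht a b)).trans ?_)
      rw [← add_div]
      gcongr
      have e1 : Real.exp (-(c / 2 * t)) ≤ Real.exp (-(m * t)) := by
        gcongr; exact min_le_left _ _
      have e2 : Real.exp (-(c' * t)) ≤ Real.exp (-(m * t)) := by
        gcongr; exact min_le_right _ _
      calc C * t * Real.exp (-(c * t)) + C' * Real.exp (-(c' * t)) =
            C * (t * Real.exp (-(c * t))) + C' * Real.exp (-(c' * t)) := by ring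
        _ ≤ C * (2 / c * Real.exp (-(m * t))) + C' * Real.exp (-(m * t)) := by
            refine add_le_add (mul_le_mul_of_nonneg_left
              ((mul_exp_neg_le hc t).trans (by gcongr)) hC.le) (by gcongr)
        _ = _ := by ring
    have := norm_pow_mul_le_of_le (f := fun η => s.regC Kc η t a b - s.profileHat a b η t)
      (η := (η : ℂ)) (by simp) (by simpa using hb) (n := n) (by omega)
    simpa using this
  · refine (setIntegral_le_integral hi (Eventually.of_forall fun η => by positivity)).trans ?_
    rw [integral_const_mul, integral_univ_inv_one_add_sq]
    apply le_of_eq; ring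

/-- The frequencies near the origin: the singular part is exponentially small there, and the Green's
function is the sum of its three modes. -/
theorem exists_low_frequency_bound (hg : s.Gap Kc σ σs σ1) (hs : s.Regular) {r H : ℝ}
    {m : Fin 3 → ℂ → ℂ} {M : Fin 3 → Fin 3 → Fin 3 → ℂ → ℂ} (hl : s.LowFrequency r H m M)
    {δ : ℝ} (hδ : 0 < δ) (hr : 2 * δ < r) (h1 : 2 * δ ≤ 1) :
    ∃ C : ℝ, 0 < C ∧ ∀ t x : ℝ, 1 ≤ t → ∀ (n : ℕ) (a b : Fin 3),
      ‖∫ η in Set.Ioc (-δ) δ, Complex.exp (Complex.I * (η : ℝ) * x) * ((Complex.I * η) ^ n *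
        (s.regC Kc η t a b - s.profileHat a b η t))‖ ≤
      ∑ j, ‖∫ η in -δ..δ, Complex.exp (Complex.I * η * x) * ((Complex.I * η) ^ n *
        s.modeError m M j a b η t)‖ + C * Real.exp (-(σs * t)) := by
  obtain ⟨C, hC, hsing⟩ := hg.exists_singC_bound hs δ
  refine ⟨2 * δ * C, by positivity, fun t x ht n a b => ?_⟩
  have ht0 : 0 ≤ t := by linarith
  have hle : -δ ≤ δ := by linarith
  have hmode : ∀ j, IntervalIntegrable (fun η : ℝ => Complex.exp (Complex.I * η * x) *
      ((Complex.I * η) ^ n * s.modeError m M j a b η t)) volume (-δ) δ := by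
    intro j
    refine ContinuousOn.intervalIntegrable fun η hη => ContinuousAt.continuousWithinAt ?_
    rw [Set.uIcc_of_le hle] at hη
    have hηr : ‖Complex.I * (η : ℂ)‖ < r := by
      rw [norm_mul, Complex.norm_I, one_mul, Complex.norm_real, Real.norm_eq_abs]
      linarith [abs_le.2 hη]
    have hI : ContinuousAt (fun η : ℝ => Complex.I * (η : ℂ)) η := by fun_prop
    have hm : ContinuousAt (fun η : ℝ => m j (Complex.I * η)) η :=
      ContinuousAt.comp (f := fun η : ℝ => Complex.I * (η : ℂ)) (hl.m_diff j _ hηr).continuousAt hI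
    have hM : ContinuousAt (fun η : ℝ => M j a b (Complex.I * η)) η :=
      ContinuousAt.comp (f := fun η : ℝ => Complex.I * (η : ℂ))
        (hl.M_diff j a b _ hηr).continuousAt hI
    unfold modeError gaussHat
    refine ContinuousAt.mul (by fun_prop) (ContinuousAt.mul (by fun_prop) ?_)
    exact ((((hI.mul hm).mul continuousAt_const).cexp).mul hM).sub (by fun_prop)
  have hsum : IntervalIntegrable (fun η : ℝ => ∑ j, Complex.exp (Complex.I * η * x) *
      ((Complex.I * η) ^ n * s.modeError m M j a b η t)) volume (-δ) δ := by
    simpa only [Finset.sum_fn] using IntervalIntegrable.sum Finset.univ fun j _ => hmode j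
  have hS : IntervalIntegrable (fun η : ℝ => Complex.exp (Complex.I * η * x) *
      ((Complex.I * η) ^ n * s.singC Kc η t a b)) volume (-δ) δ := by
    refine Continuous.intervalIntegrable (Continuous.mul (by fun_prop)
      (Continuous.mul (by fun_prop) ?_)) _ _
    exact (hg.differentiableOn_singC t a b).continuousOn.comp_continuous (by fun_prop)
      fun η => by simpa using hg.pos
  have hsplit : ∫ η in Set.Ioc (-δ) δ, Complex.exp (Complex.I * (η : ℝ) * x) *
      ((Complex.I * η) ^ n * (s.regC Kc η t a b - s.profileHat a b η t)) =
      ∑ j, (∫ η in -δ..δ, Complex.exp (Complex.I * η * x) * ((Complex.I * η) ^ n *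
        s.modeError m M j a b η t)) - ∫ η in -δ..δ, Complex.exp (Complex.I * η * x) *
        ((Complex.I * η) ^ n * s.singC Kc η t a b) := by
    rw [← intervalIntegral.integral_of_le hle, ← intervalIntegral.integral_finsetSum
      (fun j _ => hmode j), ← intervalIntegral.integral_sub
      hsum hS]
    refine intervalIntegral.integral_congr_ae ?_
    have hne : ∀ᵐ η : ℝ, η ≠ 0 := by simp [ae_iff]
    filter_upwards [hne] with η hη0 hη
    rw [Set.uIoc_of_le hle] at hη
    have hηr : |η| < r := by linarith [abs_le.2 ⟨hη.1.le, hη.2⟩]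
    have e := hl.green_eq η t hη0 hηr ht0 a b
    have e1 : s.regC Kc η t a b = s.greenC η t a b - s.singC Kc η t a b := rfl
    rw [e1, e, profileHat, ← Finset.mul_sum, ← Finset.mul_sum]
    simp only [modeError, Finset.sum_sub_distrib]
    ring
  rw [hsplit]
  refine (norm_sub_le _ _).trans (add_le_add (norm_sum_le _ _) ?_)
  have h := intervalIntegral.norm_integral_le_of_norm_le_const (a := -δ) (b := δ)
    (f := fun η : ℝ => Complex.exp (Complex.I * η * x) *
      ((Complex.I * η) ^ n * s.singC Kc η t a b)) (C := C * Real.exp (-(σs * t))) ?_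
  · refine h.trans (le_of_eq ?_)
    rw [show δ - -δ = 2 * δ by ring, abs_of_pos (by positivity)]
    ring
  · intro η hη
    rw [Set.uIoc_of_le hle] at hη
    have hηδ : |η| ≤ δ := abs_le.2 ⟨hη.1.le, hη.2⟩
    rw [norm_mul, norm_exp_I_mul, one_mul, norm_mul, norm_pow, norm_mul, Complex.norm_I, one_mul,
      Complex.norm_real, Real.norm_eq_abs]
    refine (mul_le_of_le_one_left (norm_nonneg _) (pow_le_one₀ (abs_nonneg _)
      (by linarith))).trans (hsing η t hηδ ht0 a b)

/-- The difference between the regular part and the profile, in the domain of influence of the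
waves. -/
theorem exists_near_bound (hg : s.Gap Kc σ σs σ1) (hs : s.Regular) {X : ℝ} (hX : 0 < X) :
    ∃ L O c : ℝ, 0 < L ∧ 0 < O ∧ 0 < c ∧ ∀ t x : ℝ, 1 ≤ t → |x| ≤ X * t → ∀ n ≤ 3, ∀ a b,
      ‖fourierInt (fun η => s.regC Kc η t a b - s.profileHat a b η t) n x‖ ≤
        ∑ j, O * Real.exp (-(x + s.beta j * t) ^ 2 / (4 * L * t)) / t ^ (((n : ℝ) + 2) / 2)
            * |s.M0 j a b|
          + ∑ j, O * Real.exp (-(x + s.beta j * t) ^ 2 / (4 * L * t)) / t ^ (((n : ℝ) + 3) / 2)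
          + O * Real.exp (-(c * t)) := by
  obtain ⟨r, H, m, M, hl⟩ := exists_lowFrequency hs
  have hH := hl.H_pos
  have hr := hl.r_pos
  obtain ⟨α, hα0, hα⟩ := exists_alpha_ge hs
  set δ := min (r / 4) (min (1 / 2) (α / (4 * H))) with hδd
  have hδ : 0 < δ := by positivity
  have hδr : 2 * δ < r := by linarith [min_le_left (r / 4) (min (1 / 2) (α / (4 * H)))]
  have hδ1 : 2 * δ ≤ 1 := by
    linarith [(min_le_right (r / 4) (min (1 / 2) (α / (4 * H)))).trans (min_le_left _ _)]
  have hδα : ∀ j, H * (2 * δ) ≤ s.alpha j / 2 := by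
    intro j
    have := (min_le_right (r / 4) (min (1 / 2) (α / (4 * H)))).trans (min_le_right _ _)
    rw [← hδd, le_div_iff₀ (by positivity)] at this
    linarith [hα j]
  set L := ∑ j, (3 * s.alpha j + (X + |s.beta j|) / δ) with hL
  have hLj : ∀ j, 3 * s.alpha j + (X + |s.beta j|) / δ ≤ L := fun j =>
    Finset.single_le_sum (f := fun j => 3 * s.alpha j + (X + |s.beta j|) / δ)
      (fun i _ => by have := hs.alpha_pos i; positivity) (Finset.mem_univ j)
  have hL3 : ∀ j, 3 * s.alpha j ≤ L := fun j =>
    le_trans (le_add_of_nonneg_right (by positivity)) (hLj j)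
  have hLX : ∀ j, X + |s.beta j| ≤ δ * L := by
    intro j
    have := (le_add_of_nonneg_left (by have := hs.alpha_pos j; positivity)).trans (hLj j)
    rw [div_le_iff₀ hδ] at this
    linarith
  have hL0 : 0 < L := by linarith [hL3 0, hs.alpha_pos 0]
  choose O c hO hc hmode using fun j => hl.exists_mode_bound hs j hδ hδr hδ1 (hδα j) (hL3 j)
    (hLX j)
  obtain ⟨C1, c1, hC1, hc1, hhigh⟩ := hg.exists_high_frequency_bound hs hδ
  obtain ⟨C2, hC2, hlow⟩ := hg.exists_low_frequency_bound hs hl hδ hδr hδ1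
  have hσs := hg.decay_pos
  obtain ⟨d, hd, hdj⟩ : ∃ d : ℝ, 0 < d ∧ ∀ j, d ≤ c j := by
    refine ⟨min (c 0) (min (c 1) (c 2)), lt_min (hc 0) (lt_min (hc 1) (hc 2)), fun j => ?_⟩
    fin_cases j <;> simp
  set e := min d (min c1 σs) with he
  have he0 : 0 < e := by positivity
  set S := ∑ j, O j with hS
  have hSj : ∀ j, O j ≤ S := fun j =>
    Finset.single_le_sum (fun i _ => (hO i).le) (Finset.mem_univ j)
  have hS0 : 0 < S := lt_of_lt_of_le (hO 0) (hSj 0)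
  refine ⟨L, S + C1 + C2, e, hL0, by positivity, he0, fun t x ht hx n hn a b => ?_⟩
  have ht0 : 0 < t := by linarith
  have hexp : ∀ c', e ≤ c' → Real.exp (-(c' * t)) ≤ Real.exp (-(e * t)) := fun c' h => by gcongr
  have x1 := hexp c1 ((min_le_right _ _).trans (min_le_left _ _))
  have x2 := hexp σs ((min_le_right _ _).trans (min_le_right _ _))
  have hSO : ∀ j, O j ≤ S + C1 + C2 := fun j => by linarith [hSj j]
  have hint : Integrable (fun η : ℝ => Complex.exp (Complex.I * η * x) * ((Complex.I * η) ^ n *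
      (s.regC Kc η t a b - s.profileHat a b η t))) := by
    have hi := (hg.integrable_regC hs ht0.le a b (n := n) (by omega)).sub
      (integrable_profileHat hs a b ht0 n)
    refine hi.norm.mono' ?_ (Eventually.of_forall fun η => ?_)
    · have hE : Continuous fun η : ℝ => Complex.exp (Complex.I * η * x) := by fun_prop
      refine (hE.aestronglyMeasurable.mul hi.1).congr (Eventually.of_forall fun η => ?_)
      simp only [Pi.mul_apply, Pi.sub_apply]
      ring
    · rw [norm_mul, norm_exp_I_mul, one_mul, mul_sub]
      rfl
  rw [fourierInt, ← integral_add_compl measurableSet_Ioc hint (s := Set.Ioc (-δ) δ)]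
  refine (norm_add_le _ _).trans ((add_le_add (hlow t x ht n a b) (hhigh t x ht n hn a b)).trans ?_)
  have hsum : ∑ j, ‖∫ η in -δ..δ, Complex.exp (Complex.I * η * x) * ((Complex.I * η) ^ n *
      s.modeError m M j a b η t)‖ ≤
      ∑ j, (S + C1 + C2) * Real.exp (-(x + s.beta j * t) ^ 2 / (4 * L * t)) /
          t ^ (((n : ℝ) + 2) / 2) * |s.M0 j a b|
        + ∑ j, (S + C1 + C2) * Real.exp (-(x + s.beta j * t) ^ 2 / (4 * L * t)) /
          t ^ (((n : ℝ) + 3) / 2) + S * Real.exp (-(e * t)) := by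
    rw [hS, Finset.sum_mul, ← Finset.sum_add_distrib, ← Finset.sum_add_distrib]
    refine Finset.sum_le_sum fun j _ => (hmode j x t ht hx n hn a b).trans ?_
    rw [← hS]
    refine add_le_add (add_le_add ?_ ?_) ?_
    · have := hSO j
      gcongr
    · have := hSO j
      gcongr
    · exact mul_le_mul_of_nonneg_left (hexp _ ((min_le_left _ _).trans (hdj j))) (hO j).le
  have y1 := mul_le_mul_of_nonneg_left x1 hC1.le
  have y2 := mul_le_mul_of_nonneg_left x2 hC2.le
  linarith

/-- The difference between the regular part and the profile for large times. -/
theorem exists_large_time_bound (hg : s.Gap Kc σ σs σ1) (hs : s.Regular) :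
    ∃ C σ₀ τ O : ℝ, 0 < C ∧ 0 < σ₀ ∧ 0 < τ ∧ 0 < O ∧
      ∀ t x : ℝ, 1 ≤ t → ∀ n : ℕ, n ≤ 3 → ∀ a b : Fin 3,
        ‖s.dxReg Kc n x t a b - ((s.profile n x t a b : ℝ) : ℂ)‖
          ≤ ∑ j, O * Real.exp (-(x + s.beta j * t) ^ 2 / (4 * C * t))
                / t ^ (((n : ℝ) + 2) / 2) * |s.M0 j a b|
            + ∑ j, O * Real.exp (-(x + s.beta j * t) ^ 2 / (4 * C * t)) / t ^ (((n : ℝ) + 3) / 2)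
            + O * Real.exp (-τ * t - σ₀ * |x|) := by
  obtain ⟨D, X, hD, hX, hfar⟩ := hg.exists_far_bound hs
  obtain ⟨L, O, c, hL, hO, hc, hnear⟩ := hg.exists_near_bound hs hX
  have hσ := hg.pos
  refine ⟨L, min (σ / 4) (c / (2 * X)), min 1 (c / 2), O + D, hL, by positivity, by positivity,
    by positivity, fun t x ht n hn a b => ?_⟩
  have ht0 : 0 < t := by linarith
  have hdiff : s.dxReg Kc n x t a b - ((s.profile n x t a b : ℝ) : ℂ) = (2 * (Real.pi : ℂ))⁻¹ *
      fourierInt (fun η => s.regC Kc η t a b - s.profileHat a b η t) n x := by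
    rw [hg.dxReg_eq hs ht0.le a b hn, ofReal_profile hs n x ht0, fourierInt_sub
      (hg.integrable_regC hs ht0.le a b (by omega)) (integrable_profileHat hs a b ht0 n), mul_sub]
  rw [hdiff]
  refine (norm_two_pi_inv_mul_le _).trans ?_
  have hσ4 := mul_le_mul_of_nonneg_right (min_le_left (σ / 4) (c / (2 * X))) (abs_nonneg x)
  have hcX := mul_le_mul_of_nonneg_right (min_le_right (σ / 4) (c / (2 * X))) (abs_nonneg x)
  have h1 := mul_le_mul_of_nonneg_right (min_le_left 1 (c / 2)) ht0.le
  have hc2 := mul_le_mul_of_nonneg_right (min_le_right 1 (c / 2)) ht0.le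
  rcases le_total (X * t) |x| with h | h
  · refine (hfar t x ht h n hn a b).trans ?_
    refine le_add_of_nonneg_of_le (by positivity) ?_
    gcongr
    · linarith
    · linarith
  · refine (hnear t x ht h n hn a b).trans ?_
    have e1 : c / (2 * X) * |x| ≤ c / 2 * t := by
      rw [div_mul_eq_mul_div, div_le_iff₀ (by positivity)]
      have := mul_le_mul_of_nonneg_left h hc.le
      linarith
    have hOD : O ≤ O + D := by linarith
    refine add_le_add (add_le_add (Finset.sum_le_sum fun j _ => ?_)
      (Finset.sum_le_sum fun j _ => ?_)) ?_
    · gcongr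
    · gcongr
    · gcongr
      linarith

end Gap

/-- A state near `(1, 0, 1)` has positive specific volume and temperature. -/
theorem regular_of_near {s : GasState} (hK : 0 < s.K) (hcv : 0 < s.cv) (hmu : 0 < s.mu)
    (hkappa : 0 < s.kappa) (hmk : s.mu / (s.kappa * s.thetae) < 1)
    (h : (s.v - 1) ^ 2 + s.u ^ 2 + (s.E - 1) ^ 2 < (1 / 10) ^ 2 ∨
      (s.v - 1) ^ 2 + s.u ^ 2 + (s.theta - 1) ^ 2 < (1 / 10) ^ 2) : s.Regular := by
  have hv : 0 < s.v := by
    rcases h with h | h <;> nlinarith [sq_nonneg s.u, sq_nonneg (s.E - 1), sq_nonneg (s.theta - 1)]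
  have he : 0 < s.e := by
    rcases h with h | h
    · unfold e
      nlinarith [sq_nonneg (s.v - 1), sq_nonneg s.u]
    · have hθ : 0 < s.theta := by nlinarith [sq_nonneg (s.v - 1), sq_nonneg s.u]
      exact (div_pos_iff_of_pos_right hcv).1 hθ
  have hk : 0 < s.kappa * s.thetae := mul_pos hkappa (one_div_pos.2 hcv)
  refine ⟨hv, hmu, (div_lt_one hk).1 hmk, ?_, ?_, ?_⟩
  · unfold p; positivity
  · unfold pv; exact neg_neg_of_pos (by positivity)
  · unfold pe; positivity

end GasState

theorem matNorm_le {A : Matrix (Fin 3) (Fin 3) ℂ} {D : ℝ} (hD : ∀ a b, ‖A a b‖ ≤ D) :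
    matNorm A ≤ 3 * D := by
  have hD0 : 0 ≤ D := (norm_nonneg _).trans (hD 0 0)
  refine Real.sqrt_le_iff.2 ⟨by positivity, ?_⟩
  calc ∑ a, ∑ b, ‖A a b‖ ^ 2 ≤ ∑ _a : Fin 3, ∑ _b : Fin 3, D ^ 2 := by
        gcongr with a _ b _
        exact hD a b
    _ = _ := by
      simp
      ring

end NSGreen

end

theorem theorem4p3 :
    ∃ ε : ℝ, 0 < ε ∧ ∀ s : NSGreen.GasState,
      0 < s.K → 0 < s.cv → 0 < s.mu → 0 < s.kappa → s.mu / (s.kappa * s.thetae) < 1 →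
      ((s.v - 1) ^ 2 + s.u ^ 2 + (s.E - 1) ^ 2 < ε ^ 2 ∨
        (s.v - 1) ^ 2 + s.u ^ 2 + (s.theta - 1) ^ 2 < ε ^ 2) →
      (∃ Kc : Fin 3 → ℝ, s.Admissible Kc) ∧
      ∀ Kc : Fin 3 → ℝ, s.Admissible Kc →
        (∀ t : ℝ, 0 < t → ∀ a b : Fin 3,
          MeasureTheory.Integrable (fun η : ℝ => s.regHat Kc η t a b) ∧
          ContDiff ℝ 3 (fun x : ℝ => s.reg Kc x t a b)) ∧
        ∃ C σ₀ σs O₁ : ℝ, 0 < C ∧ 0 < σ₀ ∧ 0 < σs ∧ 0 < O₁ ∧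
          (∀ t x : ℝ, 0 < t → t < 1 →
            ∑ n ∈ Finset.range 4, NSGreen.matNorm (s.dxReg Kc n x t)
              ≤ O₁ * t * Real.exp (-σ₀ * |x|)) ∧
          (∀ t x : ℝ, 1 ≤ t → ∀ n : ℕ, n ≤ 3 → ∀ a b : Fin 3,
            ‖s.dxReg Kc n x t a b - ((s.profile n x t a b : ℝ) : ℂ)‖
              ≤ ∑ j, O₁ * Real.exp (-(x + s.beta j * t) ^ 2 / (4 * C * t))
                    / t ^ (((n : ℝ) + 2) / 2) * |s.M0 j a b|
                + ∑ j, O₁ * Real.exp (-(x + s.beta j * t) ^ 2 / (4 * C * t))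
                    / t ^ (((n : ℝ) + 3) / 2)
                + O₁ * Real.exp (-σs * t - σ₀ * |x|)) := by
  refine ⟨1 / 10, by norm_num, fun s hK hcv hmu hkappa hmk hnear => ?_⟩
  have hs := NSGreen.GasState.regular_of_near hK hcv hmu hkappa hmk hnear
  refine ⟨NSGreen.GasState.exists_admissible hs, fun Kc hKc => ?_⟩
  obtain ⟨σ, τ, σ1, hg⟩ := hKc.exists_gap
  refine ⟨fun t ht a b => ⟨?_, hg.contDiff_reg hs ht.le a b⟩, ?_⟩
  · have := hg.integrable_regC hs ht.le a b (n := 0) (by norm_num)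
    simpa only [pow_zero, one_mul, NSGreen.GasState.regHat_eq] using this
  obtain ⟨C, σ₀, σs, O, hC, hσ₀, hσs, hO, hlarge⟩ := hg.exists_large_time_bound hs
  obtain ⟨D, hD, hsmall⟩ := hg.exists_small_time_bound hs
  have hσ := hg.pos
  refine ⟨C, min σ₀ (σ / 2), σs, O + 12 * D, hC, by positivity, hσs, by positivity,
    fun t x ht ht1 => ?_, fun t x ht n hn a b => (hlarge t x ht n hn a b).trans ?_⟩
  · calc ∑ n ∈ Finset.range 4, NSGreen.matNorm (s.dxReg Kc n x t)
        ≤ ∑ _n ∈ Finset.range 4, 3 * (D * t * Real.exp (-(σ / 2 * |x|))) := by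
          refine Finset.sum_le_sum fun n hn => NSGreen.matNorm_le fun a b => ?_
          rw [Finset.mem_range] at hn
          exact hsmall t x ht ht1 n (by omega) a b
      _ = 12 * D * t * Real.exp (-(σ / 2 * |x|)) := by
          rw [Finset.sum_const, Finset.card_range, nsmul_eq_mul]
          push_cast
          ring
      _ ≤ (O + 12 * D) * t * Real.exp (-min σ₀ (σ / 2) * |x|) := by
          have h := mul_le_mul_of_nonneg_right (min_le_right σ₀ (σ / 2)) (abs_nonneg x)
          gcongr
          · linarith
          · linarith
  · have hOD : O ≤ O + 12 * D := by linarith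
    refine add_le_add (add_le_add (Finset.sum_le_sum fun j _ => ?_)
      (Finset.sum_le_sum fun j _ => ?_)) ?_
    · gcongr
    · gcongr
    · gcongr
      exact min_le_left _ _
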